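/- Proposition 9.10. Let $n\ge 2$ and consider type $D_{n+1}$, with simple roots $\alpha_i=\varepsilon_i-\varepsilon_{i+1}$ ($1\le i\le n$) and $\alpha_{n+1}=\varepsilon_n+\varepsilon_{n+1}$, positive roots $\Phi^+$, simple reflections $s_i$ and longest element $w_0$. Let $\vee$ be the involution of $\{1,\dots,n+1\}$ exchanging $n$ and $n+1$ and fixing the other indices, let $*$ be the involution with $w_0\alpha_i=-\alpha_{i^*}$, and let $\bar\imath=\min(i,n)\in\bar I=\{1,\dots,n\}$ be the label of the $\vee$-orbit of $i$. Two words are commutation equivalent if they differ by relations $s_is_j=s_js_i$; $[\mathbf i]$ is the commutation class of $\mathbf i$. A reflection functor replaces a class $[i_1i_2\cdots i_\ell]$ of reduced words of $w_0$ by $[i_2\cdots i_\ell i_1^*]$ or by $[i_\ell^*i_1\cdots i_{\ell-1}]$. The twisted adapted cluster point is the set of all classes obtained by reflection functors from $[\prod_{r=0}^n(1\,2\cdots n)^{r\vee}]$, where $(\cdot)^{r\vee}$ means that $\vee$ is applied $r$ times to each letter; its elements are the twisted adapted classes. Let $K$ be a class. For a word $\mathbf i=i_1i_2\cdots\in K$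 put $\beta_k=s_{i_1}\cdots s_{i_{k-1}}\alpha_{i_k}$ and $\beta_k<_{\mathbf i}\beta_l$ iff $k<l$; write $\alpha\prec_K\beta$ if $\alpha<_{\mathbf i}\beta$ for all $\mathbf i\in K$. For $m,m'\colon\Phi^+\to\mathbb Z_{\ge0}$ ("sequences") write $m\prec^b_K m'$ if $\sum_\beta m(\beta)\beta=\sum_\beta m'(\beta)\beta$ and, for every $\mathbf i\in K$, $m$ is smaller than $m'$ both at the first and at the last root (with respect to $<_{\mathbf i}$) where they differ. A pair $\alpha\ne\beta$ is identified with the sequence that is $1$ at $\alpha,\beta$ and $0$ elsewhere; it is simple if there is no smaller sequence. A sequence is simple if it is a single root or if all pairs of distinct roots on which it is positive are simple. If $\alpha\prec_K\beta$ or $\beta\prec_K\alpha$, then $\mathrm{gdist}_K(\alpha,\beta)$ is $0$ if the pair is simple, and otherwise the largest $r$ for which there is a chain $m^{(1)}\prec^b_K\cdots\prec^b_K m^{(r)}=(\alpha,\beta)$ of non-simple sequences. If $K=[\prod_{r=0}^n(i_1\cdots i_n)^{r\vee}]$, where $i_1,\dots,i_n$ contains exactly one element of each $\vee$-orbit, choose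 a height function $\xi\colon\bar I\to\mathbb Z$, i.e. $\xi(a)=\xi(b)+1$ whenever $|a-b|=1$ and $a$ precedes $b$ in $\bar\imath_1,\dots,\bar\imath_n$. Folded coordinates of positive roots are given as follows: $s_{i_1}\cdots s_{i_{q-1}}\alpha_{i_q}$ has $(\bar\imath_q,\xi(\bar\imath_q))$; $s_{i_1}\cdots s_{i_n}s_{i_1^\vee}\cdots s_{i_{q-1}^\vee}\alpha_{i_q^\vee}$ has $(\bar\imath_q,\xi(\bar\imath_q)-2)$; and with $\psi=s_{i_1}\cdots s_{i_n}s_{i_1^\vee}\cdots s_{i_n^\vee}$, if $\beta,\psi\beta\in\Phi^+$ and $\beta$ has $(k,p)$, then $\psi\beta$ has $(k,p-4)$. For $k,l\in\bar I$ and $t\in\mathbb Z_{\ge0}$ let $\Phi_K(k,l)[t]$ be the set of pairs $(\alpha,\beta)$, comparable under $\prec_K$, whose folded coordinates are $(k,a)$ and $(l,b)$ in some order, with $|a-b|=t$. (It does not depend on the choices.) Let $o_t^K(k,l)$ be the common value of $\mathrm{gdist}_K$ on $\Phi_K(k,l)[t]$, and $0$ if this set is empty. Let $\mathbf k$ be an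 algebraic closure of $\mathbb C(q)$, let $q_s\in\mathbf k$ with $q_s^2=q$, and put $$\widehat D^K_{k,l}(z)=\prod_{t\ge0}\bigl(z-(-q_s)^t\bigr)^{\lceil o_t^K(k,l)/2\rceil}\in\mathbf k[z].$$ Then for all $k,l\in\bar I$: every twisted adapted class $K$ is of the form $[\prod_{r=0}^n(i_1\cdots i_n)^{r\vee}]$ as above and has a height function; $\mathrm{gdist}_K$ is constant on each $\Phi_K(k,l)[t]$, and $o_t^K(k,l)\ne0$ for finitely many $t$ only, so that $\widehat D^K_{k,l}(z)$ is defined; and $$\widehat D^{K_1}_{k,l}(z)=\widehat D^{K_2}_{k,l}(z)$$ for any two twisted adapted classes $K_1,K_2$. The same equality holds for the polynomials in which $\lceil o_t^K(k,l)/2\rceil$ is replaced by $\lfloor o_t^K(k,l)/2\rfloor$. -/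

import Mathlib

namespace TwistedD

/-! ### Type `D_{n+1}`: roots, Weyl group action, words

The index `i ∈ {1, …, n+1}` of the Dynkin diagram is represented by `i - 1 : Fin (n + 1)`, and the
vector `ε_i` is the corresponding standard basis vector of `ℤ^{n+1}`.  Everything is used for
`n ≥ 2` only. -/

/-- The simple roots `α_i = ε_i - ε_{i+1}` for `1 ≤ i ≤ n`, and `α_{n+1} = ε_n + ε_{n+1}`. -/
def simpleRoot {n : ℕ} (i : Fin (n + 1)) : Fin (n + 1) → ℤ :=
  if h : i.val < n then Pi.single i 1 - Pi.single ⟨i.val + 1, by omega⟩ 1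
  else Pi.single ⟨n - 1, by omega⟩ 1 + Pi.single (Fin.last n) 1

/-- The positive roots `ε_a - ε_b` and `ε_a + ε_b` with `a < b`. -/
def posRoots (n : ℕ) : Finset (Fin (n + 1) → ℤ) :=
  ((Finset.univ.filter fun ab : Fin (n + 1) × Fin (n + 1) => ab.1 < ab.2).image
      fun ab => Pi.single ab.1 1 - Pi.single ab.2 1) ∪
  ((Finset.univ.filter fun ab : Fin (n + 1) × Fin (n + 1) => ab.1 < ab.2).image
      fun ab => Pi.single ab.1 1 + Pi.single ab.2 1)

/-- The type `Φ⁺` of positive roots. -/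
abbrev PosRoot (n : ℕ) : Type := {v : Fin (n + 1) → ℤ // v ∈ posRoots n}

/-- The simple reflection `s_i` (all roots have squared length `2`). -/
def refl {n : ℕ} (i : Fin (n + 1)) (v : Fin (n + 1) → ℤ) : Fin (n + 1) → ℤ :=
  v - (v ⬝ᵥ simpleRoot i) • simpleRoot i

/-- Words in the indices of the Dynkin diagram. -/
abbrev Word (n : ℕ) : Type := List (Fin (n + 1))

/-- The action of `s_{i_1} s_{i_2} ⋯ s_{i_r}` for the word `i_1 i_2 ⋯ i_r`. -/
def wordAct {n : ℕ} (w : Word n) (v : Fin (n + 1) → ℤ) : Fin (n + 1) → ℤ :=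
  w.foldr refl v

/-- The diagram automorphism `∨` exchanging `n` and `n + 1` and fixing the other indices. -/
def vee {n : ℕ} (i : Fin (n + 1)) : Fin (n + 1) :=
  if i.val = n then ⟨n - 1, by omega⟩ else if i.val = n - 1 then Fin.last n else i

/-- The involution `*` given by `w₀ α_i = -α_{i*}`: for type `D_{n+1}` it is the identity if
`n + 1` is even, and it exchanges the last two indices if `n + 1` is odd. -/
def star {n : ℕ} (i : Fin (n + 1)) : Fin (n + 1) :=
  if Even (n + 1) then i else vee i

/-- The folded index `ī ∈ {1, …, n}` of `i`, that is the `∨`-orbit of `i`, labelled by its smallest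
element (in the numbering that starts with `1`). -/
def bar {n : ℕ} (i : Fin (n + 1)) : ℕ := min (i.val + 1) n

/-! ### Commutation classes, reflection functors, the twisted adapted cluster point -/

/-- One application of a commutation relation `s_i s_j = s_j s_i` to a word. -/
def CommMove {n : ℕ} (w w' : Word n) : Prop :=
  ∃ (u x : Word n) (i j : Fin (n + 1)),
    (∀ v, refl i (refl j v) = refl j (refl i v)) ∧ w = u ++ i :: j :: x ∧ w' = u ++ j :: i :: x

/-- The commutation class `[w]`. -/
def commClass {n : ℕ} (w : Word n) : Set (Word n) :=
  {w' | Relation.ReflTransGen CommMove w w'}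

/-- One effective application of a (right or left) reflection functor to a commutation class. -/
inductive ReflectionStep {n : ℕ} : Set (Word n) → Set (Word n) → Prop
  | right (i : Fin (n + 1)) (w : Word n) :
      ReflectionStep (commClass (i :: w)) (commClass (w ++ [star i]))
  | left (i : Fin (n + 1)) (w : Word n) :
      ReflectionStep (commClass (w ++ [i])) (commClass (star i :: w))

/-- The word `∏_{k=0}^{n} c^{k∨}`. -/
def foldedWord {n : ℕ} (c : Word n) : Word n :=
  (List.range (n + 1)).flatMap fun k => c.map (vee^[k])

/-- The twisted adapted cluster point: all commutation classes obtained by reflection functors from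
the class of `∏_{k=0}^{n} (1 2 ⋯ n)^{k∨}`.  Its elements are the twisted adapted classes. -/
def twistedAdaptedClusterPoint (n : ℕ) : Set (Set (Word n)) :=
  {K | Relation.ReflTransGen ReflectionStep
    (commClass (foldedWord ((List.finRange n).map Fin.castSucc))) K}

/-! ### Orders on roots and on sequences of roots, generalized distance -/

/-- `β <_w γ`: for `w = i_1 i_2 ⋯` and `β_k = s_{i_1} ⋯ s_{i_{k-1}} α_{i_k}`, we have `β = β_k`
and `γ = β_l` with `k < l`. -/
def WordLT {n : ℕ} (w : Word n) (β γ : PosRoot n) : Prop :=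
  ∃ (u x y : Word n) (i j : Fin (n + 1)), w = u ++ i :: (x ++ j :: y) ∧
    β.val = wordAct u (simpleRoot i) ∧ γ.val = wordAct (u ++ i :: x) (simpleRoot j)

/-- The convex partial order `β ≺_K γ` of a commutation class `K`. -/
def ClassLT {n : ℕ} (K : Set (Word n)) (β γ : PosRoot n) : Prop :=
  ∀ w ∈ K, WordLT w β γ

/-- Sequences: a multiplicity in `ℤ_{≥0}` for every positive root. -/
abbrev RootSeq (n : ℕ) : Type := PosRoot n → ℕ

/-- The weight of a sequence. -/
def wt {n : ℕ} (m : RootSeq n) : Fin (n + 1) → ℤ := ∑ β : PosRoot n, (m β : ℤ) • β.val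

/-- The bi-lexicographical order `m <ᵇ_w m'` induced by `<_w`: at the first and at the last
position where `m` and `m'` differ, `m` is smaller. -/
def BiLexLT {n : ℕ} (w : Word n) (m m' : RootSeq n) : Prop :=
  (∃ β, m β < m' β ∧ ∀ δ, WordLT w δ β → m δ = m' δ) ∧
  (∃ γ, m γ < m' γ ∧ ∀ δ, WordLT w γ δ → m δ = m' δ)

/-- The partial order `m ≺ᵇ_K m'`. -/
def SeqLT {n : ℕ} (K : Set (Word n)) (m m' : RootSeq n) : Prop :=
  wt m = wt m' ∧ ∀ w ∈ K, BiLexLT w m m'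

/-- The sequence `α + β` (a pair if `α ≠ β`). -/
def pairSeq {n : ℕ} (α β : PosRoot n) : RootSeq n := Pi.single α 1 + Pi.single β 1

/-- A pair `(α, β)` is `K`-simple if no sequence is smaller. -/
def IsSimplePair {n : ℕ} (K : Set (Word n)) (α β : PosRoot n) : Prop :=
  ¬ ∃ m : RootSeq n, SeqLT K m (pairSeq α β)

/-- `K`-simple sequences: one single root, or all pairs of distinct members are simple. -/
def IsSimpleSeq {n : ℕ} (K : Set (Word n)) (m : RootSeq n) : Prop :=
  (∑ β, m β = 1) ∨ ∀ α β, α ≠ β → 0 < m α → 0 < m β → IsSimplePair K α β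

open Classical in
/-- The generalized distance of a sequence: `0` if it is simple, and otherwise the maximal length
`r` of a chain `m⁽¹⁾ ≺ᵇ ⋯ ≺ᵇ m⁽ʳ⁾ = m` of non-simple sequences (the lengths are bounded since only
finitely many sequences have the weight of `m`). -/
noncomputable def gdist {n : ℕ} (K : Set (Word n)) (m : RootSeq n) : ℕ :=
  if IsSimpleSeq K m then 0
  else sSup {r | ∃ L : List (RootSeq n), L.IsChain (SeqLT K) ∧ (∀ x ∈ L, ¬ IsSimpleSeq K x) ∧
    L.getLast? = some m ∧ L.length = r}

open Classical in
/-- The generalized distance of two positive roots. -/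
noncomputable def gdistRoots {n : ℕ} (K : Set (Word n)) (α β : PosRoot n) : ℕ :=
  if ClassLT K α β ∨ ClassLT K β α then gdist K (pairSeq α β) else 0

/-! ### Folded coordinates -/

/-- `c = i_1 ⋯ i_n` contains exactly one index from every `∨`-orbit, so that
`(s_{i_1} ⋯ s_{i_n})∨` is a twisted Coxeter element. -/
def IsTwistedCoxeterWord {n : ℕ} (c : Word n) : Prop :=
  (c.map bar).Perm (List.range' 1 n)

/-- `ξ` is a height function for `c = i_1 ⋯ i_n`.  Let `Q` be the quiver of type `A_n` to which the
word `ī_1 ⋯ ī_n` is adapted (each letter is a sink when it is read): for neighbours `a`, `b` there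
is an arrow `b → a` in `Q` if and only if `a` occurs before `b`.  A height function satisfies
`ξ a = ξ b + 1` whenever there is an arrow `b → a`. -/
def IsHeightFunction {n : ℕ} (c : Word n) (ξ : ℕ → ℤ) : Prop :=
  ∀ a b : ℕ, (a = b + 1 ∨ b = a + 1) → List.Sublist [a, b] (c.map bar) → ξ a = ξ b + 1

/-- Coordinates `(i, p)` of roots, for `c = i_1 ⋯ i_n` and a height function `ξ`:
`s_{i_1} ⋯ s_{i_{q-1}} α_{i_q}` has the coordinates `(i_q, ξ(ī_q))`, then
`s_{i_1} ⋯ s_{i_n} s_{i_1^∨} ⋯ s_{i_{q-1}^∨} α_{i_q^∨}` has the coordinates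
`(i_q^∨, ξ(ī_q) - 2)`, and with
`ψ = s_{i_1} ⋯ s_{i_n} s_{i_1^∨} ⋯ s_{i_n^∨}`, if `β` has the coordinates `(i, p)` and
`β`, `ψ β` are positive, then `ψ β` has the coordinates `(i, p - 4)`. -/
inductive HasCoord {n : ℕ} (c : Word n) (ξ : ℕ → ℤ) :
    (Fin (n + 1) → ℤ) → Fin (n + 1) → ℤ → Prop
  | first (u x : Word n) (i : Fin (n + 1)) (h : c = u ++ i :: x) :
      HasCoord c ξ (wordAct u (simpleRoot i)) i (ξ (bar i))
  | second (u x : Word n) (i : Fin (n + 1)) (h : c = u ++ i :: x) :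
      HasCoord c ξ (wordAct (c ++ u.map vee) (simpleRoot (vee i))) (vee i) (ξ (bar i) - 2)
  | step (β : Fin (n + 1) → ℤ) (i : Fin (n + 1)) (p : ℤ) (h : HasCoord c ξ β i p)
      (hβ : β ∈ posRoots n) (hψ : wordAct (c ++ c.map vee) β ∈ posRoots n) :
      HasCoord c ξ (wordAct (c ++ c.map vee) β) i (p - 4)

/-- The folded coordinates of `β` are `(k, p)`. -/
def HasFoldedCoord {n : ℕ} (c : Word n) (ξ : ℕ → ℤ) (β : PosRoot n) (k : ℕ) (p : ℤ) : Prop :=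
  ∃ i : Fin (n + 1), HasCoord c ξ β.val i p ∧ bar i = k

/-- The data from which the folded AR-quiver of a class `K` gets its coordinates: a twisted Coxeter
element `(s_{i_1} ⋯ s_{i_n})∨` with `K = [∏_{k=0}^{n} (i_1 ⋯ i_n)^{k∨}]`, and a height function. -/
def IsCoordDatum {n : ℕ} (K : Set (Word n)) (c : Word n) (ξ : ℕ → ℤ) : Prop :=
  IsTwistedCoxeterWord c ∧ K = commClass (foldedWord c) ∧ IsHeightFunction c ξ

/-- The set `Φ_K(k, l)[t]` of comparable pairs with folded coordinates `(k, a)` and `(l, b)`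
such that `|a - b| = t`.  (For a given class the words `c` differ by commutations only, and the
functions `ξ` by constants, on the indices `1, …, n`; so `|a - b|` does not depend on them.) -/
def pairsAtDist {n : ℕ} (K : Set (Word n)) (k l t : ℕ) : Set (PosRoot n × PosRoot n) :=
  {P | (ClassLT K P.1 P.2 ∨ ClassLT K P.2 P.1) ∧
    ∃ (c : Word n) (ξ : ℕ → ℤ), IsCoordDatum K c ξ ∧ ∃ a b : ℤ, |a - b| = (t : ℤ) ∧
      ((HasFoldedCoord c ξ P.1 k a ∧ HasFoldedCoord c ξ P.2 l b) ∨
        (HasFoldedCoord c ξ P.1 l b ∧ HasFoldedCoord c ξ P.2 k a))}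

/-- `o_t^K(k, l)`: the common value of the generalized distance on `Φ_K(k, l)[t]`, and `0` if this
set is empty. -/
noncomputable def distAt {n : ℕ} (K : Set (Word n)) (k l t : ℕ) : ℕ :=
  sSup ((fun P : PosRoot n × PosRoot n => gdistRoots K P.1 P.2) '' pairsAtDist K k l t)

/-! ### Folded distance polynomials -/

/-- The base field: an algebraic closure of `ℂ(q)`. -/
abbrev BaseField : Type := AlgebraicClosure (RatFunc ℂ)

/-- The element `q` of the base field. -/
noncomputable def qElt : BaseField := algebraMap (RatFunc ℂ) BaseField RatFunc.X

/-- `∏_{t ≥ 0} (z - (-q_s)^t)^{⌈o_t^K(k, l) / 2⌉}`. -/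
noncomputable def foldedDistPoly {n : ℕ} (qs : BaseField) (K : Set (Word n)) (k l : ℕ) :
    Polynomial BaseField :=
  ∏ᶠ t : ℕ, (Polynomial.X - Polynomial.C ((-qs) ^ t)) ^ ⌈(distAt K k l t : ℚ) / 2⌉₊

/-- `∏_{t ≥ 0} (z - (-q_s)^t)^{⌊o_t^K(k, l) / 2⌋}`, the version with the other rounding. -/
noncomputable def foldedDistPolyFloor {n : ℕ} (qs : BaseField) (K : Set (Word n)) (k l : ℕ) :
    Polynomial BaseField :=
  ∏ᶠ t : ℕ, (Polynomial.X - Polynomial.C ((-qs) ^ t)) ^ ⌊(distAt K k l t : ℚ) / 2⌋₊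

end TwistedD

namespace TwistedD

/-! ### Reflections, the diagram automorphism and lists of roots -/

section Basic

variable {n : ℕ}

/-! The twisted Coxeter element of a class acts like a rotation of a regular 2(n+1)-gon: it shifts
by one step a family `v : ℤ → ℤ^{n+1}` with `v (a + n + 1) = -v a`, any `n + 1` consecutive members
of which are orthonormal (`IsFrame`, `IsModel`). The positive roots are chords `v x + v y` with `1 ≤
y - x ≤ n`. Row `k` has `y - x = n + 1 - k`, and a class cuts out of it `n + 1` consecutive chords
starting at `x = X k`, where `X (k + 1) - X k` is `0` or `1`. Up to sign and a constant, `x + y` is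
the second folded coordinate. A reflection functor drops the chord at one end of a row and adds its
negative at the other, in a reflected frame (`IsModel.rotate`, `IsModel.rotate_symm`), so the model
of the initial word spreads over the cluster point (`exists_isModel_of_mem_cluster`).

The order of the class is the componentwise order on pairs `(x, y)` (`exists_isPosition`):
incomparable chords are nested, hence orthogonal, and can be commuted, while chords one step apart
are not orthogonal. The bi-lexicographical orders of all words together then depend on this poset
only (`IsHeapClass.seqLT_eq`), and a sequence below a pair lives on the interval between its
members. Windows are convex, so the generalized distance depends only on that interval and its
vectors, up to an injective homomorphism (`absGdist_extend`, `IsPosition.gdist_eq`). A translation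
or an order-reversing reflection carries the interval to a standard one given by `k`, `l`, `t`.

It remains to see that emptiness of the set of pairs does no harm. For `t ≤ 2n + 1` this set is
nonempty for all classes or for none (`IsSection.exists_comparable`). For larger `t` it may depend
on the class, but every pair in it is simple, as a linear functional shows
(`IsPosition.gdist_eq_zero_of_distant`). Hence `distAt` equals `rowDist`, which does not involve the
class. -/

theorem dotProduct_simpleRoot_of_lt (v : Fin (n + 1) → ℤ) (i : Fin (n + 1)) (h : i.val < n) :
    v ⬝ᵥ simpleRoot i = v i - v ⟨i.val + 1, by omega⟩ := by
  simp [simpleRoot, h, dotProduct_sub]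

theorem dotProduct_simpleRoot_last (v : Fin (n + 1) → ℤ) (i : Fin (n + 1)) (h : ¬ i.val < n) :
    v ⬝ᵥ simpleRoot i = v ⟨n - 1, by omega⟩ + v (Fin.last n) := by
  simp [simpleRoot, h, dotProduct_add]

theorem simpleRoot_apply (i j : Fin (n + 1)) :
    simpleRoot i j = if i.val < n then
      (if j.val = i.val then 1 else 0) - (if j.val = i.val + 1 then 1 else 0)
      else (if j.val = n - 1 then 1 else 0) + (if j.val = n then 1 else 0) := by
  unfold simpleRoot
  by_cases h : i.val < n
  · rw [dif_pos h, if_pos h]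
    simp only [Pi.sub_apply, Pi.single_apply, Fin.ext_iff]
  · rw [dif_neg h, if_neg h]
    simp only [Pi.add_apply, Pi.single_apply, Fin.ext_iff, Fin.val_last]

theorem simpleRoot_dot_self (hn : 2 ≤ n) (i : Fin (n + 1)) :
    simpleRoot i ⬝ᵥ simpleRoot i = 2 := by
  by_cases h : i.val < n
  · rw [dotProduct_simpleRoot_of_lt _ _ h]
    simp [simpleRoot_apply, h]
  · rw [dotProduct_simpleRoot_last _ _ h]
    have h1 : n - 1 ≠ n := by omega
    have h2 : n ≠ n - 1 := by omega
    simp [simpleRoot_apply, h, h1, h2]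

theorem simpleRoot_dot_of_ne (hn : 2 ≤ n) {i j : Fin (n + 1)} (hij : i ≠ j) :
    simpleRoot i ⬝ᵥ simpleRoot j =
      if bar j = bar i + 1 ∨ bar i = bar j + 1 then -1 else 0 := by
  have hij' : i.val ≠ j.val := fun h => hij (Fin.ext h)
  have hi := i.isLt
  have hj := j.isLt
  by_cases h : j.val < n
  · rw [dotProduct_simpleRoot_of_lt _ _ h]
    simp only [simpleRoot_apply, bar]
    split_ifs <;> omega
  · rw [dotProduct_simpleRoot_last _ _ h]
    simp only [simpleRoot_apply, bar, Fin.val_last]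
    split_ifs <;> omega

theorem refl_add (i : Fin (n + 1)) (v w : Fin (n + 1) → ℤ) :
    refl i (v + w) = refl i v + refl i w := by
  simp only [refl, add_dotProduct, add_smul]; abel

theorem refl_neg (i : Fin (n + 1)) (v : Fin (n + 1) → ℤ) : refl i (-v) = -refl i v := by
  simp only [refl, neg_dotProduct, neg_smul]; abel

theorem refl_dot_simpleRoot (hn : 2 ≤ n) (i : Fin (n + 1)) (v : Fin (n + 1) → ℤ) :
    refl i v ⬝ᵥ simpleRoot i = -(v ⬝ᵥ simpleRoot i) := by
  simp only [refl, sub_dotProduct, smul_dotProduct, simpleRoot_dot_self hn, smul_eq_mul]; ring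

theorem refl_refl (hn : 2 ≤ n) (i : Fin (n + 1)) (v : Fin (n + 1) → ℤ) :
    refl i (refl i v) = v := by
  rw [refl, refl_dot_simpleRoot hn, refl]; simp

theorem refl_simpleRoot_self (hn : 2 ≤ n) (i : Fin (n + 1)) :
    refl i (simpleRoot i) = -simpleRoot i := by
  rw [refl, simpleRoot_dot_self hn, two_smul]; abel

theorem refl_dot_refl (hn : 2 ≤ n) (i : Fin (n + 1)) (v w : Fin (n + 1) → ℤ) :
    refl i v ⬝ᵥ refl i w = v ⬝ᵥ w := by
  simp only [refl, sub_dotProduct, dotProduct_sub, smul_dotProduct, dotProduct_smul,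
    simpleRoot_dot_self hn, smul_eq_mul, dotProduct_comm (simpleRoot i) w]
  ring

theorem refl_of_dot_eq_zero {i : Fin (n + 1)} {v : Fin (n + 1) → ℤ}
    (h : v ⬝ᵥ simpleRoot i = 0) : refl i v = v := by
  simp [refl, h]

/-- Two simple reflections commute when the simple roots are orthogonal. -/
theorem refl_comm_of_dot {i j : Fin (n + 1)} (h : simpleRoot i ⬝ᵥ simpleRoot j = 0)
    (v : Fin (n + 1) → ℤ) : refl i (refl j v) = refl j (refl i v) := by
  have h' : simpleRoot j ⬝ᵥ simpleRoot i = 0 := by rw [dotProduct_comm, h]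
  simp only [refl, sub_dotProduct, smul_dotProduct, h, h', smul_zero, sub_zero]
  abel

theorem dot_eq_zero_of_refl_comm (hn : 2 ≤ n) {i j : Fin (n + 1)} (hij : i ≠ j)
    (h : ∀ v, refl i (refl j v) = refl j (refl i v)) : simpleRoot i ⬝ᵥ simpleRoot j = 0 := by
  have h1 := congrArg (fun w => w ⬝ᵥ simpleRoot j) (h (simpleRoot i))
  have h2 := simpleRoot_dot_of_ne hn hij
  simp only [refl, sub_dotProduct, smul_dotProduct, simpleRoot_dot_self hn, smul_eq_mul,
    dotProduct_comm (simpleRoot j) (simpleRoot i)] at h1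
  split_ifs at h2
  · rw [h2] at h1; norm_num at h1
  · exact h2

/-- The linear action of the diagram automorphism. -/
def veeVec (v : Fin (n + 1) → ℤ) : Fin (n + 1) → ℤ :=
  fun i => if i = Fin.last n then -v i else v i

theorem veeVec_add (v w : Fin (n + 1) → ℤ) : veeVec (v + w) = veeVec v + veeVec w := by
  ext i; simp only [veeVec, Pi.add_apply]; split_ifs <;> ring

theorem veeVec_neg (v : Fin (n + 1) → ℤ) : veeVec (-v) = -veeVec v := by
  ext i; simp only [veeVec, Pi.neg_apply]; split_ifs <;> ring

theorem veeVec_veeVec (v : Fin (n + 1) → ℤ) : veeVec (veeVec v) = v := by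
  ext i; simp only [veeVec]; split_ifs <;> simp

theorem veeVec_sub (v w : Fin (n + 1) → ℤ) : veeVec (v - w) = veeVec v - veeVec w := by
  rw [sub_eq_add_neg, veeVec_add, veeVec_neg, sub_eq_add_neg]

theorem veeVec_smul (a : ℤ) (v : Fin (n + 1) → ℤ) : veeVec (a • v) = a • veeVec v := by
  ext i; simp only [veeVec, Pi.smul_apply, smul_eq_mul]; split_ifs <;> ring

theorem veeVec_dot_veeVec (v w : Fin (n + 1) → ℤ) : veeVec v ⬝ᵥ veeVec w = v ⬝ᵥ w := by
  simp only [dotProduct, veeVec]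
  refine Finset.sum_congr rfl fun i _ => ?_
  split_ifs <;> ring

theorem veeVec_simpleRoot (hn : 2 ≤ n) (i : Fin (n + 1)) :
    veeVec (simpleRoot i) = simpleRoot (vee i) := by
  ext j
  have hi := i.isLt
  have hj := j.isLt
  simp only [veeVec, simpleRoot_apply, vee, Fin.ext_iff, Fin.val_last, apply_ite Fin.val]
  split_ifs <;> omega

theorem veeVec_refl (hn : 2 ≤ n) (i : Fin (n + 1)) (v : Fin (n + 1) → ℤ) :
    veeVec (refl i v) = refl (vee i) (veeVec v) := by
  rw [refl, veeVec_sub, veeVec_smul, refl, ← veeVec_simpleRoot hn, veeVec_dot_veeVec]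

theorem vee_vee (hn : 2 ≤ n) (i : Fin (n + 1)) : vee (vee i) = i := by
  have hi := i.isLt
  simp only [vee, Fin.ext_iff, apply_ite Fin.val, Fin.val_last]
  split_ifs <;> omega

theorem bar_vee (hn : 2 ≤ n) (i : Fin (n + 1)) : bar (vee i) = bar i := by
  have hi := i.isLt
  simp only [vee, bar, apply_ite Fin.val, Fin.val_last]
  split_ifs <;> omega

theorem one_le_bar (hn : 2 ≤ n) (i : Fin (n + 1)) : 1 ≤ bar i := by simp only [bar]; omega

theorem bar_le (i : Fin (n + 1)) : bar i ≤ n := by simp only [bar]; omega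

theorem eq_or_eq_vee_of_bar_eq (hn : 2 ≤ n) {i j : Fin (n + 1)} (h : bar i = bar j) :
    i = j ∨ i = vee j := by
  have hi := i.isLt
  have hj := j.isLt
  simp only [bar] at h
  simp only [vee, Fin.ext_iff, apply_ite Fin.val, Fin.val_last]
  split_ifs <;> omega

theorem vee_eq_self (hn : 2 ≤ n) {i : Fin (n + 1)} (h : bar i ≠ n) : vee i = i := by
  have hi := i.isLt
  simp only [bar] at h
  simp only [vee, Fin.ext_iff, apply_ite Fin.val, Fin.val_last]
  split_ifs <;> omega

/-- In a folded word the copy number `r` of `c` is twisted `r` times, for `r ≤ n`; so `star i` is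
the letter with which the next copy would continue. This makes reflection functors act on folded
words by rotation of `c`. -/
theorem star_eq_iterate (hn : 2 ≤ n) (i : Fin (n + 1)) : star i = vee^[n + 1] i := by
  have h2 : (vee : Fin (n + 1) → Fin (n + 1))^[2] = id := by
    ext i; simp [vee_vee hn]
  unfold star
  split_ifs with h
  · obtain ⟨m, hm⟩ := h
    exact (congrFun (show (vee : Fin (n + 1) → Fin (n + 1))^[n + 1] = id by
      conv_lhs => rw [show (vee : Fin (n + 1) → Fin (n + 1))^[n + 1] = vee^[2 * m] from
        congrArg (fun k => (vee : Fin (n + 1) → Fin (n + 1))^[k]) (by omega)]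
      rw [Function.iterate_mul, h2, Function.iterate_id]) i).symm
  · obtain ⟨m, hm⟩ := Nat.not_even_iff_odd.mp h
    exact (congrFun (show (vee : Fin (n + 1) → Fin (n + 1))^[n + 1] = vee by
      conv_lhs => rw [show (vee : Fin (n + 1) → Fin (n + 1))^[n + 1] = vee^[2 * m + 1] from
        congrArg (fun k => (vee : Fin (n + 1) → Fin (n + 1))^[k]) hm]
      rw [Function.iterate_succ, Function.iterate_mul, h2, Function.iterate_id, Function.id_comp]) i).symm

theorem wordAct_append (u w : Word n) (v : Fin (n + 1) → ℤ) :
    wordAct (u ++ w) v = wordAct u (wordAct w v) := by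
  simp [wordAct]

theorem wordAct_cons (i : Fin (n + 1)) (w : Word n) (v : Fin (n + 1) → ℤ) :
    wordAct (i :: w) v = refl i (wordAct w v) := rfl

theorem wordAct_add (w : Word n) (u v : Fin (n + 1) → ℤ) :
    wordAct w (u + v) = wordAct w u + wordAct w v := by
  induction w with
  | nil => rfl
  | cons i w ih => simp only [wordAct_cons, ih, refl_add]

theorem wordAct_neg (w : Word n) (v : Fin (n + 1) → ℤ) :
    wordAct w (-v) = -wordAct w v := by
  induction w with
  | nil => rfl
  | cons i w ih => simp only [wordAct_cons, ih, refl_neg]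

theorem wordAct_dot_wordAct (hn : 2 ≤ n) (w : Word n) (u v : Fin (n + 1) → ℤ) :
    wordAct w u ⬝ᵥ wordAct w v = u ⬝ᵥ v := by
  induction w with
  | nil => rfl
  | cons i w ih => simp only [wordAct_cons, refl_dot_refl hn, ih]

theorem wordAct_injective (hn : 2 ≤ n) (w : Word n) :
    Function.Injective (wordAct w : (Fin (n + 1) → ℤ) → _) := by
  induction w with
  | nil => exact Function.injective_id
  | cons i w ih =>
    intro u v h
    have := congrArg (refl i) h
    simp only [wordAct_cons, refl_refl hn] at this
    exact ih this

theorem wordAct_map_vee (hn : 2 ≤ n) (w : Word n) (v : Fin (n + 1) → ℤ) :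
    wordAct (w.map vee) (veeVec v) = veeVec (wordAct w v) := by
  induction w with
  | nil => rfl
  | cons i w ih => simp only [List.map_cons, wordAct_cons, veeVec_refl hn, ih]

/-- The list of the vectors `β_k = s_{i_1} ⋯ s_{i_{k-1}} α_{i_k}`. -/
def rootList : Word n → List (Fin (n + 1) → ℤ)
  | [] => []
  | i :: w => simpleRoot i :: (rootList w).map (refl i)

theorem rootList_append (u w : Word n) :
    rootList (u ++ w) = rootList u ++ (rootList w).map (wordAct u) := by
  induction u with
  | nil => exact (List.map_id _).symm
  | cons i u ih => simp [rootList, ih, wordAct]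

theorem rootList_map_vee (hn : 2 ≤ n) (w : Word n) :
    rootList (w.map vee) = (rootList w).map veeVec := by
  induction w with
  | nil => rfl
  | cons i w ih => simp [rootList, ih, veeVec_simpleRoot hn, veeVec_refl hn, Function.comp_def]

theorem length_rootList (w : Word n) : (rootList w).length = w.length := by
  induction w with
  | nil => rfl
  | cons i w ih => simp [rootList, ih]

/-- Replaces factorizations of the word by positions in a single list of vectors. -/
theorem wordLT_iff (w : Word n) (β γ : PosRoot n) :
    WordLT w β γ ↔ ∃ A B C, rootList w = A ++ β.val :: (B ++ γ.val :: C) := by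
  constructor
  · rintro ⟨u, x, y, i, j, rfl, hβ, hγ⟩
    refine ⟨rootList u, (rootList x).map (wordAct u ∘ refl i),
      (rootList y).map (wordAct u ∘ refl i ∘ wordAct x ∘ refl j), ?_⟩
    simp only [rootList_append, rootList, hβ, hγ, List.map_append, List.map_cons, List.map_map,
      wordAct_append, wordAct_cons]
  · rintro ⟨A, B, C, h⟩
    have key : ∀ (w : Word n) (A C : List (Fin (n + 1) → ℤ)) (b : Fin (n + 1) → ℤ),
        rootList w = A ++ b :: C → ∃ (u x : Word n) (i : Fin (n + 1)), w = u ++ i :: x ∧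
          rootList u = A ∧ b = wordAct u (simpleRoot i) ∧ C = (rootList x).map (wordAct (u ++ [i])) := by
      intro w A C b hw
      have hl : A.length < w.length := by
        rw [← length_rootList, hw]; simp
      refine ⟨w.take A.length, w.drop (A.length + 1), w[A.length], by simp, ?_⟩
      have hsplit : w = w.take A.length ++ w[A.length] :: w.drop (A.length + 1) := by simp
      rw [hsplit, rootList_append, rootList] at hw
      have hlen : (rootList (w.take A.length)).length = A.length := by
        rw [length_rootList]; simp; omega
      obtain ⟨h1, h2⟩ := List.append_inj hw hlen
      simp only [List.map_cons, List.map_map, List.cons.injEq] at h2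
      refine ⟨h1, h2.1.symm, ?_⟩
      rw [← h2.2]
      refine List.map_congr_left fun v _ => ?_
      exact (wordAct_append _ [_] v).symm
    obtain ⟨u, z, i, rfl, hu, hβ, hz⟩ := key w A _ _ h
    obtain ⟨B', C', hBC, rfl, hC⟩ := List.map_eq_append_iff.mp hz.symm
    obtain ⟨g, C'', rfl, hg, rfl⟩ := List.map_eq_cons_iff.mp hC
    obtain ⟨x, y, j, rfl, hx, hg', -⟩ := key z _ _ _ hBC
    refine ⟨u, x, y, i, j, rfl, hβ, ?_⟩
    rw [← hg, hg', ← wordAct_append]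
    simp

end Basic

/-! ### Commutation equivalence of words -/

section Commutation

variable {n : ℕ}

/-- Commutation equivalence of words. -/
def CommEquiv (w w' : Word n) : Prop := Relation.ReflTransGen CommMove w w'

theorem CommMove.symm {w w' : Word n} (h : CommMove w w') : CommMove w' w := by
  obtain ⟨u, x, i, j, hc, h1, h2⟩ := h
  exact ⟨u, x, j, i, fun v => (hc v).symm, h2, h1⟩

theorem CommEquiv.refl (w : Word n) : CommEquiv w w := Relation.ReflTransGen.refl

theorem CommEquiv.symm {w w' : Word n} (h : CommEquiv w w') : CommEquiv w' w := by
  induction h with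
  | refl => exact Relation.ReflTransGen.refl
  | tail _ h ih => exact Relation.ReflTransGen.head h.symm ih

theorem CommEquiv.trans {w w' w'' : Word n} (h : CommEquiv w w') (h' : CommEquiv w' w'') :
    CommEquiv w w'' := Relation.ReflTransGen.trans h h'

theorem CommMove.append_left {w w' : Word n} (u : Word n) (h : CommMove w w') :
    CommMove (u ++ w) (u ++ w') := by
  obtain ⟨a, x, i, j, hc, rfl, rfl⟩ := h
  exact ⟨u ++ a, x, i, j, hc, by simp, by simp⟩

theorem CommMove.append_right {w w' : Word n} (u : Word n) (h : CommMove w w') :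
    CommMove (w ++ u) (w' ++ u) := by
  obtain ⟨a, x, i, j, hc, rfl, rfl⟩ := h
  exact ⟨a, x ++ u, i, j, hc, by simp, by simp⟩

theorem CommEquiv.append_left {w w' : Word n} (u : Word n) (h : CommEquiv w w') :
    CommEquiv (u ++ w) (u ++ w') :=
  Relation.ReflTransGen.lift (u ++ ·) (fun _ _ h => h.append_left u) _ _ h

theorem CommEquiv.append_right {w w' : Word n} (u : Word n) (h : CommEquiv w w') :
    CommEquiv (w ++ u) (w' ++ u) :=
  Relation.ReflTransGen.lift (· ++ u) (fun _ _ h => h.append_right u) _ _ h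

theorem CommEquiv.append {u u' w w' : Word n} (h : CommEquiv u u') (h' : CommEquiv w w') :
    CommEquiv (u ++ w) (u' ++ w') :=
  (h.append_right w).trans (h'.append_left u')

theorem CommEquiv.cons {w w' : Word n} (i : Fin (n + 1)) (h : CommEquiv w w') :
    CommEquiv (i :: w) (i :: w') := h.append_left [i]

theorem CommMove.map_vee (hn : 2 ≤ n) {w w' : Word n} (h : CommMove w w') :
    CommMove (w.map vee) (w'.map vee) := by
  obtain ⟨a, x, i, j, hc, rfl, rfl⟩ := h
  refine ⟨a.map vee, x.map vee, vee i, vee j, fun v => ?_, by simp, by simp⟩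
  rw [← veeVec_veeVec v]
  simp only [← veeVec_refl hn, hc]

theorem CommEquiv.map_vee (hn : 2 ≤ n) {w w' : Word n} (h : CommEquiv w w') :
    CommEquiv (w.map vee) (w'.map vee) :=
  Relation.ReflTransGen.lift (List.map vee) (fun _ _ h => h.map_vee hn) _ _ h

theorem CommEquiv.map_vee_iterate (hn : 2 ≤ n) {w w' : Word n} (h : CommEquiv w w') (k : ℕ) :
    CommEquiv (w.map vee^[k]) (w'.map vee^[k]) := by
  induction k with
  | zero => simpa using h
  | succ k ih =>
    have := ih.map_vee hn
    rwa [List.map_map, List.map_map, ← Function.iterate_succ'] at this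

theorem CommMove.perm {w w' : Word n} (h : CommMove w w') : w.Perm w' := by
  obtain ⟨a, x, i, j, hc, rfl, rfl⟩ := h
  exact List.Perm.append_left a (List.Perm.swap j i x)

theorem CommEquiv.perm {w w' : Word n} (h : CommEquiv w w') : w.Perm w' := by
  induction h with
  | refl => exact List.Perm.refl _
  | tail _ h ih => exact ih.trans h.perm

theorem CommMove.reverse {w w' : Word n} (h : CommMove w w') :
    CommMove w.reverse w'.reverse := by
  obtain ⟨a, x, i, j, hc, rfl, rfl⟩ := h
  exact ⟨x.reverse, a.reverse, j, i, fun v => (hc v).symm, by simp, by simp⟩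

theorem CommEquiv.reverse {w w' : Word n} (h : CommEquiv w w') :
    CommEquiv w.reverse w'.reverse :=
  Relation.ReflTransGen.lift List.reverse (fun _ _ h => h.reverse) _ _ h

/-- Yields left cancellation in `CommEquiv.of_cons`, and later strips the letter appended by a
rotation. -/
theorem CommMove.erase {w w' : Word n} (h : CommMove w w') (k : Fin (n + 1)) :
    CommEquiv (w.erase k) (w'.erase k) := by
  obtain ⟨a, x, i, j, hc, rfl, rfl⟩ := h
  by_cases hk : k ∈ a
  · rw [List.erase_append_left _ hk, List.erase_append_left _ hk]
    exact Relation.ReflTransGen.single ⟨_, x, i, j, hc, rfl, rfl⟩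
  · rw [List.erase_append_right _ hk, List.erase_append_right _ hk]
    apply CommEquiv.append_left
    by_cases hi : i = k <;> by_cases hj : j = k
    · subst hi; subst hj; exact CommEquiv.refl _
    · subst hi
      rw [List.erase_cons_head, List.erase_cons_tail (by simpa using hj), List.erase_cons_head]
      exact CommEquiv.refl _
    · subst hj
      rw [List.erase_cons_head, List.erase_cons_tail (by simpa using hi), List.erase_cons_head]
      exact CommEquiv.refl _
    · rw [List.erase_cons_tail (by simpa using hi), List.erase_cons_tail (by simpa using hj),
        List.erase_cons_tail (by simpa using hj), List.erase_cons_tail (by simpa using hi)]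
      exact Relation.ReflTransGen.single ⟨[], _, i, j, hc, rfl, rfl⟩

theorem CommEquiv.erase {w w' : Word n} (h : CommEquiv w w') (k : Fin (n + 1)) :
    CommEquiv (w.erase k) (w'.erase k) := by
  induction h with
  | refl => exact CommEquiv.refl _
  | tail _ h ih => exact ih.trans (h.erase k)

theorem CommEquiv.of_cons {w w' : Word n} {i : Fin (n + 1)} (h : CommEquiv (i :: w) (i :: w')) :
    CommEquiv w w' := by
  simpa using h.erase i

/-- The subword of two letters that do not commute is invariant under commutation. -/
theorem CommEquiv.filter_eq (hn : 2 ≤ n) {w w' : Word n} (h : CommEquiv w w') {i j : Fin (n + 1)}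
    (hij : simpleRoot i ⬝ᵥ simpleRoot j ≠ 0) :
    w.filter (fun k => k = i ∨ k = j) = w'.filter (fun k => k = i ∨ k = j) := by
  induction h with
  | refl => rfl
  | tail _ h ih =>
    rw [ih]
    obtain ⟨a, x, k, l, hc, rfl, rfl⟩ := h
    by_cases hkl : k = l
    · rw [hkl]
    · have h0 := dot_eq_zero_of_refl_comm hn hkl hc
      have : ¬ ((k = i ∨ k = j) ∧ (l = i ∨ l = j)) := by
        rintro ⟨rfl | rfl, rfl | rfl⟩
        · exact hkl rfl
        · exact hij h0
        · rw [dotProduct_comm] at h0; exact hij h0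
        · exact hkl rfl
      simp only [List.filter_append, List.filter_cons, decide_eq_true_eq]
      split_ifs <;> simp_all

/-- A letter that commutes with everything before it can be moved to the front. -/
theorem commEquiv_move_front (i : Fin (n + 1)) (a b : Word n)
    (h : ∀ k ∈ a, simpleRoot k ⬝ᵥ simpleRoot i = 0) :
    CommEquiv (a ++ i :: b) (i :: (a ++ b)) := by
  induction a with
  | nil => exact CommEquiv.refl _
  | cons k a ih =>
    have h1 := (ih fun l hl => h l (List.mem_cons_of_mem _ hl)).cons k
    refine h1.trans (Relation.ReflTransGen.single ⟨[], a ++ b, k, i, ?_, rfl, rfl⟩)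
    exact refl_comm_of_dot (h k List.mem_cons_self)

/-! ### Folded words -/

theorem foldedWord_eq_flatMap (c : Word n) :
    foldedWord c = (List.range (n + 1)).flatMap fun k => c.map (vee^[k]) := rfl

theorem CommEquiv.foldedWord (hn : 2 ≤ n) {c c' : Word n} (h : CommEquiv c c') :
    CommEquiv (foldedWord c) (foldedWord c') := by
  unfold TwistedD.foldedWord
  induction (List.range (n + 1)) with
  | nil => exact CommEquiv.refl _
  | cons k l ih => exact (h.map_vee_iterate hn k).append ih

/-- Moving the first letter of `c` to the end and applying `∨` to it. -/
theorem foldedWord_rotate (hn : 2 ≤ n) (i : Fin (n + 1)) (c : Word n) :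
    foldedWord (i :: c) ++ [star i] = i :: foldedWord (c ++ [vee i]) := by
  have key : ∀ m : ℕ, ((List.range m).flatMap fun k => (i :: c).map (vee^[k])) ++ [vee^[m] i] =
      i :: (List.range m).flatMap fun k => (c ++ [vee i]).map (vee^[k]) := by
    intro m
    induction m with
    | zero => rfl
    | succ m ih =>
      rw [List.range_succ, List.flatMap_append, List.flatMap_append, ← List.cons_append, ← ih]
      simp [Function.iterate_succ_apply]
  rw [star_eq_iterate hn]
  exact key (n + 1)

/-- Reversal exchanges right and left reflection functors, so only the first letters of a class need
to be studied. The exponent is `n` because the last copy, number `n`, comes first after reversal. -/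
theorem foldedWord_reverse (hn : 2 ≤ n) (c : Word n) :
    (foldedWord c).reverse = foldedWord (c.map vee^[n]).reverse := by
  -- For `m` copies the natural exponent is `m - 1`; `m + 1` has the same parity and avoids
  -- truncated subtraction.
  have key : ∀ m : ℕ, ((List.range m).flatMap fun k => c.map (vee^[k])).reverse =
      (List.range m).flatMap fun k => (c.map (vee^[m + 1])).reverse.map (vee^[k]) := by
    intro m
    induction m with
    | zero => rfl
    | succ m ih =>
      have hv : ∀ k, (vee : Fin (n + 1) → Fin (n + 1))^[k + 2] = vee^[k] := fun k => by
        ext i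
        rw [Function.iterate_succ_apply, Function.iterate_succ_apply, vee_vee hn]
      rw [List.range_succ, List.flatMap_append, List.reverse_append, ih, ← List.range_succ,
        List.range_succ_eq_map (n := m)]
      simp only [List.flatMap_cons, List.flatMap_nil, List.append_nil, List.flatMap_map, List.map_reverse, List.map_map, ← Function.iterate_add, hv]
      congr 1
      · rw [Nat.zero_add]
      · congr 1
        ext1 k
        rw [show k.succ + m = k + (m + 1) by omega]
  rw [foldedWord_eq_flatMap, key, foldedWord_eq_flatMap]
  congr 1
  ext1 k
  rw [show (vee : Fin (n + 1) → Fin (n + 1))^[n + 1 + 1] = vee^[n] by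
    ext i
    rw [Function.iterate_succ_apply, Function.iterate_succ_apply, vee_vee hn]]

/-! ### Twisted Coxeter words: rotation and uniqueness up to commutation -/

theorem IsTwistedCoxeterWord.of_perm {c c' : Word n} (h : IsTwistedCoxeterWord c)
    (hc : c.Perm c') : IsTwistedCoxeterWord c' :=
  (hc.map bar).symm.trans h

theorem IsTwistedCoxeterWord.rotate (hn : 2 ≤ n) {i : Fin (n + 1)} {c : Word n}
    (h : IsTwistedCoxeterWord (i :: c)) : IsTwistedCoxeterWord (c ++ [vee i]) := by
  unfold IsTwistedCoxeterWord at *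
  refine List.Perm.trans ?_ h
  rw [List.map_append, List.map_cons, List.map_nil, bar_vee hn, List.map_cons]
  exact List.perm_append_singleton _ _

theorem IsTwistedCoxeterWord.nodup_map {c : Word n} (h : IsTwistedCoxeterWord c) :
    (c.map bar).Nodup := (List.Perm.nodup_iff h).mpr List.nodup_range'

theorem IsTwistedCoxeterWord.exists_mem {c : Word n} (h : IsTwistedCoxeterWord c) {k : ℕ}
    (hk : 1 ≤ k) (hk' : k ≤ n) : ∃ i ∈ c, bar i = k := by
  have : k ∈ c.map bar := (List.Perm.mem_iff h).mpr (List.mem_range'_1.mpr ⟨hk, by omega⟩)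
  simpa using this

theorem IsTwistedCoxeterWord.length {c : Word n} (h : IsTwistedCoxeterWord c) : c.length = n := by
  have := List.Perm.length_eq h
  simpa using this

theorem mem_foldedWord_prefix (c : Word n) : ∃ x, foldedWord c = c ++ x := by
  rw [foldedWord_eq_flatMap, List.range_succ_eq_map, List.flatMap_cons]
  exact ⟨_, by simp; rfl⟩

/-- A possible first letter of the class of a folded word is a possible first letter of `c`. -/
theorem IsTwistedCoxeterWord.exists_cons (hn : 2 ≤ n) {c w : Word n} {i : Fin (n + 1)}
    (hc : IsTwistedCoxeterWord c) (h : CommEquiv (i :: w) (foldedWord c)) :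
    ∃ c₀, CommEquiv c (i :: c₀) ∧ CommEquiv (w ++ [star i]) (foldedWord (c₀ ++ [vee i])) := by
  obtain ⟨x, hx⟩ := mem_foldedWord_prefix c
  -- If `k` did not commute with `i`, the subword on these two letters would start with `i` on one
  -- side and, as `i` does not occur in `a`, with `k` on the other.
  have hfirst : ∀ (a b : Word n), c = a ++ b → i ∉ a →
      ∀ k ∈ a, simpleRoot k ⬝ᵥ simpleRoot i = 0 := by
    intro a b hab hia k hk
    by_contra hne
    have hf := h.filter_eq hn hne
    rw [hx, hab, List.append_assoc, List.filter_append] at hf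
    rcases hl : a.filter (fun l => l = k ∨ l = i) with _ | ⟨l, ls⟩
    · have : k ∈ a.filter (fun l => l = k ∨ l = i) := by simp [hk]
      rw [hl] at this
      simp at this
    · have hmem : l ∈ a.filter (fun l => l = k ∨ l = i) := by rw [hl]; simp
      rw [hl, List.filter_cons_of_pos (by simp), List.cons_append] at hf
      rw [← (List.cons.inj hf).1] at hmem
      exact hia (List.mem_filter.mp hmem).1
  -- Otherwise `c` contains only the other letter of the orbit of `i`, so `bar i = n`; but the
  -- letter of `c` with label `n - 1` is then a neighbour of `i`, against `hfirst`.
  have hic : i ∈ c := by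
    by_contra hi
    obtain ⟨j, hj, hji⟩ := hc.exists_mem (one_le_bar hn i) (bar_le i)
    have hbn : bar i = n := by
      by_contra hb
      rcases eq_or_eq_vee_of_bar_eq hn hji with rfl | rfl
      · exact hi hj
      · rw [vee_eq_self hn hb] at hj; exact hi hj
    obtain ⟨k, hk, hkn⟩ := hc.exists_mem (k := n - 1) (by omega) (by omega)
    have := hfirst c [] (by simp) hi k hk
    rw [simpleRoot_dot_of_ne hn (by rintro rfl; exact hi hk), if_pos (by omega)] at this
    norm_num at this
  obtain ⟨a, b, hia, hab, -⟩ := List.exists_erase_eq hic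
  have hc₀ : CommEquiv c (i :: (a ++ b)) := by
    rw [hab]
    exact commEquiv_move_front i a b (hfirst a (i :: b) hab hia)
  refine ⟨a ++ b, hc₀, CommEquiv.of_cons (i := i) ?_⟩
  rw [← foldedWord_rotate hn, ← List.cons_append]
  exact (h.trans (hc₀.foldedWord hn)).append_right _

/-- A twisted Coxeter word is determined up to commutations by the class of its folded word. -/
theorem IsTwistedCoxeterWord.commEquiv_of_foldedWord (hn : 2 ≤ n) {c c' : Word n}
    (hc : IsTwistedCoxeterWord c) (hc' : IsTwistedCoxeterWord c')
    (h : CommEquiv (foldedWord c) (foldedWord c')) : CommEquiv c c' := by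
  -- The tail `u` is left free because every letter `i` peeled off the prefix returns as `vee i` at
  -- the end. That letter is then erased from both sides; distinctness of labels excludes it from
  -- `c₀` and `w`.
  have key : ∀ (w c u : Word n), IsTwistedCoxeterWord c → IsTwistedCoxeterWord (w ++ u) →
      CommEquiv (foldedWord c) (foldedWord (w ++ u)) → ∃ x, CommEquiv c (w ++ x) := by
    intro w
    induction w with
    | nil => exact fun c u _ _ _ => ⟨c, CommEquiv.refl _⟩
    | cons i w ih =>
      intro c u hc hwu h
      obtain ⟨x, hx⟩ := mem_foldedWord_prefix (i :: w ++ u)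
      obtain ⟨c₀, h1, h2⟩ := hc.exists_cons (w := w ++ u ++ x) hn (by rw [hx] at h; exact h.symm)
      have h3 : CommEquiv (foldedWord (c₀ ++ [vee i])) (foldedWord (w ++ (u ++ [vee i]))) := by
        have := foldedWord_rotate hn i (w ++ u)
        rw [← List.cons_append, hx] at this
        rw [← List.append_assoc, ← (List.cons.inj this).2]
        exact h2.symm
      have hc₁ : IsTwistedCoxeterWord (i :: c₀) := hc.of_perm h1.perm
      have hwu' : IsTwistedCoxeterWord (w ++ (u ++ [vee i])) := by
        rw [← List.append_assoc]; exact IsTwistedCoxeterWord.rotate hn hwu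
      obtain ⟨y, hy⟩ := ih _ (u ++ [vee i]) (hc₁.rotate hn) hwu' h3
      have hnot : ∀ z : Word n, IsTwistedCoxeterWord (i :: z) → vee i ∉ z := by
        intro z hz hmem
        have := hz.nodup_map
        rw [List.map_cons, List.nodup_cons, ← bar_vee hn] at this
        exact this.1 (List.mem_map_of_mem hmem)
      have h4 := hy.erase (vee i)
      rw [List.erase_append_right _ (hnot _ hc₁), List.erase_append_right _ (fun hm =>
        hnot _ hwu (List.mem_append_left _ hm)), List.erase_cons_head, List.append_nil] at h4
      exact ⟨_, h1.trans (h4.cons i)⟩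
  obtain ⟨x, hx⟩ := key c' c [] hc (by simpa using hc') (by simpa using h)
  have := hx.perm.length_eq
  rw [List.length_append, hc.length, hc'.length] at this
  rwa [List.eq_nil_of_length_eq_zero (by omega : x.length = 0), List.append_nil] at hx

end Commutation

/-! ### Positive roots under simple reflections -/

section Positive

variable {n : ℕ}

theorem mem_posRoots {β : Fin (n + 1) → ℤ} : β ∈ posRoots n ↔ ∃ a b : Fin (n + 1), a < b ∧
    (β = Pi.single a 1 - Pi.single b 1 ∨ β = Pi.single a 1 + Pi.single b 1) := by
  simp only [posRoots, Finset.mem_union, Finset.mem_image, Finset.mem_filter, Finset.mem_univ,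
    true_and, Prod.exists]
  constructor
  · rintro (⟨a, b, h, rfl⟩ | ⟨a, b, h, rfl⟩)
    exacts [⟨a, b, h, .inl rfl⟩, ⟨a, b, h, .inr rfl⟩]
  · rintro ⟨a, b, h, rfl | rfl⟩
    exacts [.inl ⟨a, b, h, rfl⟩, .inr ⟨a, b, h, rfl⟩]

/-- The coweight `ρ = (n, n - 1, …, 0)`, which takes the value `1` on the simple roots. -/
def rhoVec (n : ℕ) : Fin (n + 1) → ℤ := fun i => n - i.val

theorem rhoVec_dot_simpleRoot (hn : 2 ≤ n) (i : Fin (n + 1)) : rhoVec n ⬝ᵥ simpleRoot i = 1 := by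
  by_cases h : i.val < n
  · rw [dotProduct_simpleRoot_of_lt _ _ h]; simp [rhoVec]
  · rw [dotProduct_simpleRoot_last _ _ h]
    simp only [rhoVec, Fin.val_last]
    omega

/-- Integral vectors of squared length `2` are of the form `±ε_a ± ε_b`. -/
theorem exists_of_dot_self_eq_two {β : Fin (n + 1) → ℤ} (h : β ⬝ᵥ β = 2) :
    ∃ a b : Fin (n + 1), a < b ∧ ∃ s t : ℤ, (s = 1 ∨ s = -1) ∧ (t = 1 ∨ t = -1) ∧
      β = Pi.single a s + Pi.single b t := by
  have hsplit : ∀ a, β a * β a + ∑ i ∈ Finset.univ.erase a, β i * β i = 2 := fun a => by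
    rw [Finset.add_sum_erase _ (fun i => β i * β i) (Finset.mem_univ a)]; exact h
  have hle : ∀ a, β a * β a ≤ 1 := by
    intro a
    have h0 : 0 ≤ ∑ i ∈ Finset.univ.erase a, β i * β i :=
      Finset.sum_nonneg fun i _ => mul_self_nonneg _
    have := hsplit a
    by_contra hc
    have h1 : β a < 2 := by nlinarith
    have h2 : -2 < β a := by nlinarith
    have : β a = 0 ∨ β a = 1 ∨ β a = -1 := by omega
    rcases this with h | h | h <;> rw [h] at hc <;> norm_num at hc
  have hval : ∀ a, β a = 0 ∨ β a = 1 ∨ β a = -1 := by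
    intro a
    have := hle a
    have h1 : β a < 2 := by nlinarith
    have h2 : -2 < β a := by nlinarith
    omega
  have hne : ∃ a, β a ≠ 0 := by
    by_contra hc
    push Not at hc
    simp [dotProduct, hc] at h
  obtain ⟨a, ha⟩ := hne
  have haa : β a * β a = 1 := by rcases hval a with h | h | h <;> simp_all
  have hb : ∃ b ∈ Finset.univ.erase a, β b ≠ 0 := by
    by_contra hc
    push Not at hc
    have := hsplit a
    rw [Finset.sum_eq_zero (fun i hi => by rw [hc i hi]; ring)] at this
    omega
  obtain ⟨b, hb, hb0⟩ := hb
  have hbb : β b * β b = 1 := by rcases hval b with h | h | h <;> simp_all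
  have hab : b ≠ a := (Finset.mem_erase.mp hb).1
  have hrest : ∑ i ∈ (Finset.univ.erase a).erase b, β i * β i = 0 := by
    have := hsplit a
    rw [← Finset.add_sum_erase _ (fun i => β i * β i) hb] at this
    omega
  rw [Finset.sum_eq_zero_iff_of_nonneg fun i _ => mul_self_nonneg _] at hrest
  have hz : ∀ i, i ≠ a → i ≠ b → β i = 0 := fun i hia hib =>
    mul_self_eq_zero.mp (hrest i (by simp [hia, hib]))
  have hβ : β = Pi.single a (β a) + Pi.single b (β b) := by
    ext i
    by_cases hia : i = a
    · subst hia; simp [hab.symm]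
    · by_cases hib : i = b
      · subst hib; simp [hia]
      · simp [hia, hib, hz i hia hib]
  have hsa := (hval a).resolve_left ha
  have hsb := (hval b).resolve_left hb0
  rcases lt_or_gt_of_ne hab with hlt | hlt
  · exact ⟨b, a, hlt, _, _, hsb, hsa, hβ.trans (add_comm _ _)⟩
  · exact ⟨a, b, hlt, _, _, hsa, hsb, hβ⟩

/-- The entries of `rhoVec` decrease strictly to `0`, so its product with `±ε_a ± ε_b`, `a < b`, has
the sign of the `ε_a` term. Positivity becomes a condition on two dot products that reflections
control. -/
theorem mem_posRoots_iff {β : Fin (n + 1) → ℤ} :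
    β ∈ posRoots n ↔ β ⬝ᵥ β = 2 ∧ 0 < rhoVec n ⬝ᵥ β := by
  rw [mem_posRoots]
  constructor
  · rintro ⟨a, b, hab, rfl | rfl⟩
    · have hab' : a.val < b.val := hab
      simp [dotProduct_sub, rhoVec, hab, hab.ne, hab.ne']
    · have hab' : a.val < b.val := hab
      have hb := b.isLt
      simp [dotProduct_add, rhoVec, hab.ne, hab.ne']
      omega
  · rintro ⟨h1, h2⟩
    obtain ⟨a, b, hab, s, t, hs, ht, rfl⟩ := exists_of_dot_self_eq_two h1
    have hb := b.isLt
    have hab' : a.val < b.val := hab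
    have hs1 : s = 1 := by
      rcases hs with rfl | rfl
      · rfl
      · rcases ht with rfl | rfl <;>
        · simp [dotProduct_add, rhoVec] at h2
          omega
    subst hs1
    refine ⟨a, b, hab, ?_⟩
    rcases ht with rfl | rfl
    · exact .inr rfl
    · left; rw [Pi.single_neg, sub_eq_add_neg]

theorem neg_notMem_posRoots {β : Fin (n + 1) → ℤ} (h : β ∈ posRoots n) : -β ∉ posRoots n := by
  intro h'
  have h1 := (mem_posRoots_iff.mp h).2
  have h2 := (mem_posRoots_iff.mp h').2
  rw [dotProduct_neg] at h2
  omega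

theorem simpleRoot_mem_posRoots (hn : 2 ≤ n) (i : Fin (n + 1)) : simpleRoot i ∈ posRoots n :=
  mem_posRoots_iff.mpr ⟨simpleRoot_dot_self hn i, by rw [rhoVec_dot_simpleRoot hn]; norm_num⟩

/-- The simple reflection `s_i` permutes the positive roots different from `α_i`. -/
theorem refl_mem_posRoots (hn : 2 ≤ n) {i : Fin (n + 1)} {β : Fin (n + 1) → ℤ}
    (h : β ∈ posRoots n) (hne : β ≠ simpleRoot i) : refl i β ∈ posRoots n := by
  obtain ⟨h1, h2⟩ := mem_posRoots_iff.mp h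
  have h3 : refl i β ⬝ᵥ refl i β = 2 := by rw [refl_dot_refl hn, h1]
  refine mem_posRoots_iff.mpr ⟨h3, ?_⟩
  -- A product of at least `2` would give `β - α_i` squared length at most `0`.
  have h4 : β ⬝ᵥ simpleRoot i ≤ 1 := by
    by_contra hc
    have h5 : (β - simpleRoot i) ⬝ᵥ (β - simpleRoot i) = 4 - 2 * (β ⬝ᵥ simpleRoot i) := by
      rw [sub_dotProduct, dotProduct_sub, dotProduct_sub, h1, simpleRoot_dot_self hn,
        dotProduct_comm (simpleRoot i) β]
      ring
    have h6 : 0 ≤ (β - simpleRoot i) ⬝ᵥ (β - simpleRoot i) :=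
      Finset.sum_nonneg fun i _ => mul_self_nonneg _
    have h7 : (β - simpleRoot i) ⬝ᵥ (β - simpleRoot i) = 0 := by omega
    exact hne (sub_eq_zero.mp (dotProduct_self_eq_zero.mp h7))
  have h5 : rhoVec n ⬝ᵥ refl i β = rhoVec n ⬝ᵥ β - β ⬝ᵥ simpleRoot i := by
    rw [refl, dotProduct_sub, dotProduct_smul, rhoVec_dot_simpleRoot hn, smul_eq_mul, mul_one]
  -- By `h4` and `h5` this product stays non-negative, and it vanishes on no vector `±ε_a ± ε_b`.
  have h6 : rhoVec n ⬝ᵥ refl i β ≠ 0 := by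
    obtain ⟨a, b, hab, s, t, hs, ht, he⟩ := exists_of_dot_self_eq_two h3
    have hb := b.isLt
    have hab' : a.val < b.val := hab
    rw [he]
    rcases hs with rfl | rfl <;> rcases ht with rfl | rfl <;>
    · simp [dotProduct_add, rhoVec]
      omega
  omega

theorem mem_posRoots_iff_refl (hn : 2 ≤ n) (i : Fin (n + 1)) {β : Fin (n + 1) → ℤ} :
    β ∈ posRoots n ↔ β = simpleRoot i ∨
      ∃ γ ∈ posRoots n, γ ≠ simpleRoot i ∧ β = refl i γ := by
  constructor
  · intro h
    by_cases hb : β = simpleRoot i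
    · exact .inl hb
    · refine .inr ⟨refl i β, refl_mem_posRoots hn h hb, fun he => ?_, (refl_refl hn i β).symm⟩
      have := congrArg (refl i) he
      rw [refl_refl hn, refl_simpleRoot_self hn] at this
      exact neg_notMem_posRoots (simpleRoot_mem_posRoots hn i) (this ▸ h)
  · rintro (rfl | ⟨γ, hγ, hne, rfl⟩)
    · exact simpleRoot_mem_posRoots hn i
    · exact refl_mem_posRoots hn hγ hne

end Positive

/-! ### Antiperiodic orthonormal families -/

section Frame

variable {n : ℕ}

/-- Families `v : ℤ → ℤ^{n+1}` with `v (a + n + 1) = -v a` such that any `n + 1` consecutive members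
are orthonormal. -/
structure IsFrame (v : ℤ → Fin (n + 1) → ℤ) : Prop where
  anti : ∀ a, v (a + (n + 1)) = -v a
  orth : ∀ a b : ℤ, a < b → b < a + (n + 1) → v a ⬝ᵥ v b = 0
  unit : ∀ a, v a ⬝ᵥ v a = 1

namespace IsFrame

variable {v : ℤ → Fin (n + 1) → ℤ}

theorem dot_eq_neg_one (hv : IsFrame v) {a b : ℤ} (h : b = a + (n + 1) ∨ a = b + (n + 1)) :
    v a ⬝ᵥ v b = -1 := by
  rcases h with rfl | rfl
  · rw [hv.anti, dotProduct_neg, hv.unit]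
  · rw [hv.anti, neg_dotProduct, hv.unit]

theorem dot_eq_zero (hv : IsFrame v) {a b : ℤ} (h1 : a ≠ b) (h2 : b ≠ a + (n + 1))
    (h3 : a ≠ b + (n + 1)) (h4 : b < a + 2 * (n + 1)) (h5 : a < b + 2 * (n + 1)) :
    v a ⬝ᵥ v b = 0 := by
  have key : ∀ a b : ℤ, a < b → b ≠ a + (n + 1) → b < a + 2 * (n + 1) → v a ⬝ᵥ v b = 0 := by
    intro a b hab h2 h4
    by_cases h : b < a + (n + 1)
    · exact hv.orth a b hab h
    · have := hv.anti (b - (n + 1))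
      rw [sub_add_cancel] at this
      rw [this, dotProduct_neg, hv.orth a _ (by omega) (by omega), neg_zero]
  rcases lt_or_gt_of_ne h1 with h | h
  · exact key a b h h2 h4
  · rw [dotProduct_comm]; exact key b a h h3 h5

theorem dot_le_zero (hv : IsFrame v) {a b : ℤ} (h1 : a ≠ b) (h4 : b < a + 2 * (n + 1))
    (h5 : a < b + 2 * (n + 1)) : v a ⬝ᵥ v b ≤ 0 := by
  by_cases h2 : b = a + (n + 1)
  · rw [hv.dot_eq_neg_one (.inl h2)]; norm_num
  · by_cases h3 : a = b + (n + 1)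
    · rw [hv.dot_eq_neg_one (.inr h3)]; norm_num
    · exact (hv.dot_eq_zero h1 h2 h3 h4 h5).le

/-- The chords `v x + v y` determine their ends `x`, `y` within bounded windows. -/
theorem chord_injective (hv : IsFrame v) {x y x' y' : ℤ} (hxy : x < y) (hxy2 : y < x + (n + 1))
    (hxy' : x' < y') (h1 : x < x' + 2 * (n + 1))
    (h2 : x' < x + 2 * (n + 1)) (h3 : y < y' + 2 * (n + 1)) (h4 : y' < y + 2 * (n + 1))
    (h5 : y < x' + 2 * (n + 1)) (h6 : y' < x + 2 * (n + 1))
    (h : v x + v y = v x' + v y') : x = x' ∧ y = y' := by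
  -- Pairing with `v x` gives `1` on the left, while within the assumed bounds only `v x` itself has
  -- a positive product with `v x`.
  have hx : x' = x ∨ y' = x := by
    by_contra hc
    push Not at hc
    have := congrArg (fun w => w ⬝ᵥ v x) h
    simp only [add_dotProduct, hv.unit] at this
    rw [dotProduct_comm, hv.orth x y hxy hxy2] at this
    have a1 := hv.dot_le_zero (a := x') (b := x) hc.1 (by omega) (by omega)
    have a2 := hv.dot_le_zero (a := y') (b := x) hc.2 (by omega) (by omega)
    omega
  have hy : x' = y ∨ y' = y := by
    by_contra hc
    push Not at hc
    have := congrArg (fun w => w ⬝ᵥ v y) h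
    simp only [add_dotProduct, hv.unit] at this
    rw [hv.orth x y hxy hxy2] at this
    have a1 := hv.dot_le_zero (a := x') (b := y) hc.1 (by omega) (by omega)
    have a2 := hv.dot_le_zero (a := y') (b := y) hc.2 (by omega) (by omega)
    omega
  omega

theorem map (hv : IsFrame v) {f : (Fin (n + 1) → ℤ) → Fin (n + 1) → ℤ}
    (hneg : ∀ w, f (-w) = -f w) (hdot : ∀ u w, f u ⬝ᵥ f w = u ⬝ᵥ w) :
    IsFrame fun a => f (v a) where
  anti a := by simp only [hv.anti, hneg]
  orth a b h1 h2 := by simp only [hdot, hv.orth a b h1 h2]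
  unit a := by simp only [hdot, hv.unit]

theorem shift (hv : IsFrame v) (s : ℤ) : IsFrame fun a => v (a + s) where
  anti a := by rw [← hv.anti]; congr 1; ring
  orth a b h1 h2 := hv.orth _ _ (by omega) (by omega)
  unit a := hv.unit _

theorem reverse (hv : IsFrame v) (s : ℤ) : IsFrame fun a => v (s - a) where
  anti a := by
    have := hv.anti (s - (a + (n + 1)))
    rw [show s - (a + ((n : ℤ) + 1)) + (n + 1) = s - a by ring] at this
    rw [this, neg_neg]
  orth a b h1 h2 := by rw [dotProduct_comm]; exact hv.orth _ _ (by omega) (by omega)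
  unit a := hv.unit _

end IsFrame

/-- The standard frame, with members `ε_1, …, ε_{n+1}, -ε_1, …, -ε_{n+1}`. -/
def stdFrame (n : ℕ) (a : ℤ) : Fin (n + 1) → ℤ :=
  (Int.negOnePow (a / (n + 1)) : ℤ) •
    Pi.single ⟨(a % (n + 1)).toNat, by
      have h1 := Int.emod_nonneg a (show ((n : ℤ) + 1) ≠ 0 by omega)
      have h2 := Int.emod_lt_of_pos a (show (0 : ℤ) < (n : ℤ) + 1 by omega)
      omega⟩ 1

theorem stdFrame_anti (n : ℕ) (a : ℤ) : stdFrame n (a + (n + 1)) = -stdFrame n a := by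
  have h : (a + ((n : ℤ) + 1)) / (n + 1) = a / (n + 1) + 1 :=
    Int.add_ediv_of_dvd_right (dvd_refl _) |>.trans (by rw [Int.ediv_self (by omega)])
  unfold stdFrame
  simp only [h, Int.add_emod_right, Int.negOnePow_succ, Units.val_neg, neg_smul]

theorem isFrame_stdFrame (n : ℕ) : IsFrame (stdFrame n) where
  anti := stdFrame_anti n
  orth a b h1 h2 := by
    have hne : a % ((n : ℤ) + 1) ≠ b % (n + 1) := by
      intro h
      have hd : ((n : ℤ) + 1) ∣ b - a := (show a ≡ b [ZMOD (n + 1)] from h).dvd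
      have := Int.le_of_dvd (by omega) hd
      omega
    have ha := Int.emod_nonneg a (show ((n : ℤ) + 1) ≠ 0 by omega)
    have hb := Int.emod_nonneg b (show ((n : ℤ) + 1) ≠ 0 by omega)
    simp only [stdFrame, smul_dotProduct, dotProduct_smul, single_dotProduct, Pi.single_apply,
      Fin.mk.injEq]
    rw [if_neg (by omega)]
    simp
  unit a := by
    simp only [stdFrame, smul_dotProduct, dotProduct_smul, single_dotProduct, Pi.single_eq_same,
      smul_eq_mul, mul_one]
    rw [← Units.val_mul, ← Int.negOnePow_add, Int.negOnePow_even _ ⟨_, rfl⟩, Units.val_one]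

theorem stdFrame_val (n : ℕ) (i : Fin (n + 1)) : stdFrame n i.val = Pi.single i 1 := by
  have h1 : ((i.val : ℕ) : ℤ) / ((n : ℤ) + 1) = 0 := Int.ediv_eq_zero_of_lt (by omega) (by omega)
  have h2 : ((i.val : ℕ) : ℤ) % ((n : ℤ) + 1) = i.val := Int.emod_eq_of_lt (by omega) (by omega)
  simp only [stdFrame, h1, h2, Int.negOnePow_zero, Units.val_one, one_smul, Int.toNat_natCast]

end Frame

/-! ### Chord models of twisted Coxeter words -/

section Model

variable {n : ℕ}

/-- Sections: each step increases the value by `0` or `1`. -/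
def IsSection (n : ℕ) (X : ℕ → ℤ) : Prop :=
  ∀ k, 1 ≤ k → k < n → X (k + 1) = X k ∨ X (k + 1) = X k + 1

theorem IsSection.le {X : ℕ → ℤ} (h : IsSection n X) {k l : ℕ} (hk : 1 ≤ k) (hkl : k ≤ l)
    (hl : l ≤ n) : X k ≤ X l ∧ X l ≤ X k + (l - k) := by
  induction l, hkl using Nat.le_induction with
  | base => simp
  | succ l hkl ih =>
    have h1 := ih (by omega)
    push_cast
    rcases h l (by omega) (by omega) with h | h <;> omega

/-- The chord in row `k` with first end `x`. -/
def chord (v : ℤ → Fin (n + 1) → ℤ) (k : ℕ) (x : ℤ) : Fin (n + 1) → ℤ :=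
  v x + v (x + (n + 1 - k))

/-- A row passes through its roots in `n + 1` steps and then through their negatives. Hence a chord
leaving the window at one end returns, with opposite sign, at the other. -/
theorem IsFrame.chord_add {v : ℤ → Fin (n + 1) → ℤ} (hv : IsFrame v) (k : ℕ) (x : ℤ) :
    chord v k (x + (n + 1)) = -chord v k x := by
  unfold chord
  rw [hv.anti, show x + ((n : ℤ) + 1) + (n + 1 - k) = x + (n + 1 - k) + (n + 1) by ring, hv.anti,
    neg_add]

/-- The chords in the window cut out by a section are distinct. -/
theorem IsFrame.chord_inj {v : ℤ → Fin (n + 1) → ℤ} (hv : IsFrame v) {X : ℕ → ℤ}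
    (hX : IsSection n X) {k l r s : ℕ} (hk : 1 ≤ k) (hk' : k ≤ n) (hl : 1 ≤ l) (hl' : l ≤ n)
    (hr : r ≤ n) (hs : s ≤ n) (h : chord v k (X k + r) = chord v l (X l + s)) :
    k = l ∧ r = s := by
  have hb : (X k ≤ X l ∧ X l ≤ X k + (l - k) ∧ k ≤ l) ∨
      (X l ≤ X k ∧ X k ≤ X l + (k - l) ∧ l ≤ k) := by
    rcases le_total k l with hkl | hkl
    · left; have := hX.le hk hkl hl'; exact ⟨this.1, this.2, hkl⟩
    · right; have := hX.le hl hkl hk'; exact ⟨this.1, this.2, hkl⟩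
  have h1 := hv.chord_injective (by omega) (by omega) (by omega) (by omega) (by omega)
    (by omega) (by omega) (by omega) (by omega) h
  have hkl : k = l := by omega
  subst hkl
  omega

/-- A chord model of a word `c = i_1 ⋯ i_n`: the roots `s_{i_1} ⋯ s_{i_{q-1}} α_{i_q}` are the
chords on the section `X`, the twisted Coxeter element shifts the frame, and the positive roots are
the chords in a window of width `n + 1`. -/
structure IsModel (c : Word n) (v : ℤ → Fin (n + 1) → ℤ) (X : ℕ → ℤ) : Prop where
  frame : IsFrame v
  order : c.Pairwise fun i j => (bar j = bar i + 1 → X (bar j) = X (bar i) + 1) ∧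
    (bar i = bar j + 1 → X (bar i) = X (bar j))
  roots : rootList c = c.map fun i => chord v (bar i) (X (bar i))
  cox : ∀ a, wordAct c (veeVec (v a)) = v (a + 1)
  pos : ∀ β, β ∈ posRoots n ↔
    ∃ k r : ℕ, 1 ≤ k ∧ k ≤ n ∧ r ≤ n ∧ β = chord v k (X k + r)

/-- Of two neighbouring labels one occurs first in `c`, and `order` gives the step `1` or `0`
accordingly. `R` is the symmetrized condition, insensitive to which one is first. -/
theorem IsModel.isSection {c : Word n} {v : ℤ → Fin (n + 1) → ℤ} {X : ℕ → ℤ}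
    (hc : IsTwistedCoxeterWord c) (h : IsModel c v X) : IsSection n X := by
  intro k hk hkn
  obtain ⟨i, hi, rfl⟩ := hc.exists_mem hk hkn.le
  obtain ⟨j, hj, hij⟩ := hc.exists_mem (k := bar i + 1) (by omega) (by omega)
  let R : Fin (n + 1) → Fin (n + 1) → Prop := fun i j =>
    (bar j = bar i + 1 → X (bar j) = X (bar i) ∨ X (bar j) = X (bar i) + 1) ∧
    (bar i = bar j + 1 → X (bar i) = X (bar j) ∨ X (bar i) = X (bar j) + 1)
  have hR : c.Pairwise R := h.order.imp fun {i j} h => ⟨fun e => .inr (h.1 e), fun e => .inl (h.2 e)⟩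
  have : R i j := by
    have hs : ∀ x y, R x y → R y x := fun x y h => ⟨h.2, h.1⟩
    rw [List.pairwise_iff_getElem] at hR
    obtain ⟨a, ha, rfl⟩ := List.mem_iff_getElem.mp hi
    obtain ⟨b, hb, rfl⟩ := List.mem_iff_getElem.mp hj
    rcases lt_trichotomy a b with hab | rfl | hab
    · exact hR a b ha hb hab
    · omega
    · exact hs _ _ (hR b a hb ha hab)
  rw [← hij]
  exact this.1 hij

theorem rootList_swap (u x : Word n) {i j : Fin (n + 1)} (h : simpleRoot i ⬝ᵥ simpleRoot j = 0) :
    ∃ B, rootList (u ++ i :: j :: x) =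
        rootList u ++ wordAct u (simpleRoot i) :: wordAct u (simpleRoot j) :: B ∧
      rootList (u ++ j :: i :: x) =
        rootList u ++ wordAct u (simpleRoot j) :: wordAct u (simpleRoot i) :: B := by
  have h1 : refl i (simpleRoot j) = simpleRoot j := refl_of_dot_eq_zero (by rwa [dotProduct_comm])
  have h2 : refl j (simpleRoot i) = simpleRoot i := refl_of_dot_eq_zero h
  refine ⟨((rootList x).map (refl j)).map (refl i) |>.map (wordAct u), ?_, ?_⟩
  · simp [rootList_append, rootList, h1]
  · simp [rootList_append, rootList, h2, refl_comm_of_dot h]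

/-- Commuting distinct letters have labels that are not neighbours, and their exchange only swaps
two adjacent roots; so the same frame and section serve. -/
theorem IsModel.commMove (hn : 2 ≤ n) {c c' : Word n} {v : ℤ → Fin (n + 1) → ℤ} {X : ℕ → ℤ}
    (h : IsModel c v X) (hc : IsTwistedCoxeterWord c) (hm : CommMove c c') : IsModel c' v X := by
  obtain ⟨u, x, i, j, hcomm, rfl, rfl⟩ := hm
  by_cases hij : i = j
  · subst hij; exact h
  have h0 := dot_eq_zero_of_refl_comm hn hij hcomm
  have hbar := simpleRoot_dot_of_ne hn hij
  rw [h0] at hbar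
  have hbar' : ¬ (bar j = bar i + 1 ∨ bar i = bar j + 1) := fun hb => by
    rw [if_pos hb] at hbar; norm_num at hbar
  refine ⟨h.frame, ?_, ?_, fun a => ?_, h.pos⟩
  · have := h.order
    simp only [List.pairwise_append, List.pairwise_cons, List.mem_cons] at this ⊢
    obtain ⟨h1, ⟨h2, h3, h4⟩, h5⟩ := this
    refine ⟨h1, ⟨?_, fun a ha => h2 a (.inr ha), h4⟩, fun a ha b hb => ?_⟩
    · rintro a (rfl | ha)
      · exact ⟨fun e => absurd (.inr e) hbar', fun e => absurd (.inl e) hbar'⟩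
      · exact h3 a ha
    · exact h5 a ha b (by tauto)
  · obtain ⟨B, hB1, hB2⟩ := rootList_swap u x h0
    have := h.roots
    rw [hB1] at this
    simp only [List.map_append, List.map_cons] at this
    obtain ⟨e1, e2⟩ := List.append_inj this (by rw [length_rootList, List.length_map])
    simp only [List.cons.injEq] at e2
    rw [hB2]
    simp only [List.map_append, List.map_cons, e1, e2.1, e2.2.1, e2.2.2]
  · rw [← h.cox a, wordAct_append, wordAct_append]
    simp only [wordAct_cons, hcomm]

theorem IsModel.commEquiv (hn : 2 ≤ n) {c c' : Word n} {v : ℤ → Fin (n + 1) → ℤ} {X : ℕ → ℤ}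
    (h : IsModel c v X) (hc : IsTwistedCoxeterWord c) (hm : CommEquiv c c') : IsModel c' v X := by
  induction hm with
  | refl => exact h
  | tail h1 h2 ih => exact ih.commMove hn (hc.of_perm (CommEquiv.perm h1)) h2

theorem chord_refl (i : Fin (n + 1)) (v : ℤ → Fin (n + 1) → ℤ) (k : ℕ) (x : ℤ) :
    chord (fun a => refl i (v a)) k x = refl i (chord v k x) := (refl_add _ _ _).symm

theorem bar_ne_of_mem {c : Word n} {i : Fin (n + 1)} (h : ((i :: c).map bar).Nodup) {j}
    (hj : j ∈ c) : bar j ≠ bar i := by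
  intro he
  rw [List.map_cons, List.nodup_cons] at h
  exact h.1 (he ▸ List.mem_map_of_mem hj)

/-- Moving the first letter of a twisted Coxeter word to the end. -/
theorem IsModel.rotate (hn : 2 ≤ n) {c : Word n} {i : Fin (n + 1)} {v : ℤ → Fin (n + 1) → ℤ}
    {X : ℕ → ℤ} (hc : IsTwistedCoxeterWord (i :: c)) (h : IsModel (i :: c) v X) :
    IsModel (c ++ [vee i]) (fun a => refl i (v a)) (Function.update X (bar i) (X (bar i) + 1)) := by
  have hne : ∀ j ∈ c, bar j ≠ bar i := fun j hj => bar_ne_of_mem hc.nodup_map hj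
  have hX : ∀ j ∈ c, Function.update X (bar i) (X (bar i) + 1) (bar j) = X (bar j) :=
    fun j hj => Function.update_of_ne (hne j hj) _ _
  have hroots := h.roots
  rw [rootList, List.map_cons, List.cons.injEq] at hroots
  -- The new twisted Coxeter element is the conjugate of the old one by `s_i`.
  have hcox : ∀ w, wordAct (c ++ [vee i]) (veeVec (refl i w)) =
      refl i (wordAct (i :: c) (veeVec w)) := by
    intro w
    rw [wordAct_append, veeVec_refl hn]
    change wordAct c (refl (vee i) (refl (vee i) _)) = _
    rw [refl_refl hn, wordAct_cons, refl_refl hn]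
  refine ⟨h.frame.map (refl_neg i) (refl_dot_refl hn i), ?_, ?_, fun a => ?_, fun β => ?_⟩
  · have ho := h.order
    rw [List.pairwise_cons] at ho
    rw [List.pairwise_append]
    refine ⟨ho.2.imp_of_mem fun {a b} ha hb hab => ?_, List.pairwise_singleton _ _,
      fun a ha b hb => ?_⟩
    · rw [hX a ha, hX b hb]; exact hab
    · rw [List.mem_singleton] at hb
      subst hb
      rw [bar_vee hn, hX a ha, Function.update_self]
      have := ho.1 a ha
      constructor
      · intro e; rw [this.2 e]
      · intro e; rw [this.1 e]
  · have e1 : rootList c = c.map fun j => refl i (chord v (bar j) (X (bar j))) := by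
      have := congrArg (List.map (refl i)) hroots.2
      rw [List.map_map, List.map_map] at this
      rw [show refl i ∘ refl i = id from funext fun w => refl_refl hn i w, List.map_id] at this
      exact this
    -- `α_i` is the first chord of its row, and the twisted Coxeter element moves it to the second,
    -- which becomes the first of the new row.
    have e2 : wordAct c (simpleRoot (vee i)) = refl i (chord v (bar i) (X (bar i) + 1)) := by
      have h1 : wordAct (i :: c) (veeVec (chord v (bar i) (X (bar i)))) =
          chord v (bar i) (X (bar i) + 1) := by
        unfold chord
        rw [veeVec_add, wordAct_add, h.cox, h.cox]
        congr 2; ring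
      rw [← h1, wordAct_cons, refl_refl hn, ← hroots.1, veeVec_simpleRoot hn]
    rw [rootList_append, e1]
    simp only [rootList, List.map_nil, List.map_cons, List.map_append, chord_refl, e2, bar_vee hn,
      Function.update_self]
    congr 1
    exact List.map_congr_left fun j hj => by rw [hX j hj]
  · rw [hcox, h.cox]
  · have hsec := h.isSection hc
    have hb1 := one_le_bar hn i
    have hb2 := bar_le i
    rw [mem_posRoots_iff_refl hn i]
    constructor
    · rintro (rfl | ⟨γ, hγ, hne', rfl⟩)
      -- The chord `n + 1` steps after `α_i` is `-α_i`; the reflection makes it `α_i`, now the last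
      -- of the row.
      · refine ⟨bar i, n, hb1, hb2, le_rfl, ?_⟩
        rw [Function.update_self, chord_refl, show X (bar i) + 1 + (n : ℤ) = X (bar i) + (n + 1) by
          ring, h.frame.chord_add, refl_neg, ← hroots.1, refl_simpleRoot_self hn, neg_neg]
      · obtain ⟨k, r, hk, hk', hr, rfl⟩ := (h.pos γ).mp hγ
        by_cases hki : k = bar i
        · subst hki
          have hr0 : r ≠ 0 := by
            rintro rfl
            rw [hroots.1] at hne'
            simp at hne'
          refine ⟨bar i, r - 1, hb1, hb2, by omega, ?_⟩
          rw [Function.update_self, chord_refl, Nat.cast_sub (by omega)]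
          congr 2; push_cast; ring
        · exact ⟨k, r, hk, hk', hr, by rw [Function.update_of_ne hki, chord_refl]⟩
    · rintro ⟨k, r, hk, hk', hr, rfl⟩
      rw [chord_refl]
      by_cases hki : k = bar i
      · subst hki
        rw [Function.update_self]
        by_cases hrn : r = n
        · left
          rw [hrn, show X (bar i) + 1 + (n : ℤ) = X (bar i) + (n + 1) by
            ring, h.frame.chord_add, refl_neg, ← hroots.1, refl_simpleRoot_self hn, neg_neg]
        · right
          refine ⟨chord v (bar i) (X (bar i) + (r + 1 : ℕ)), (h.pos _).mpr
            ⟨bar i, r + 1, hb1, hb2, by omega, rfl⟩, fun he => ?_, ?_⟩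
          · rw [hroots.1] at he
            have := h.frame.chord_inj hsec (r := r + 1) (s := 0) hk hk' hk hk' (by omega)
              (by omega) (by simpa using he)
            omega
          · congr 2; push_cast; ring
      · right
        rw [Function.update_of_ne hki]
        refine ⟨chord v k (X k + r), (h.pos _).mpr ⟨k, r, hk, hk', hr, rfl⟩, fun he => ?_, rfl⟩
        rw [hroots.1] at he
        exact hki (h.frame.chord_inj hsec (s := 0) hk hk' hb1 hb2 hr (by omega)
          (by simpa using he)).1

/-- Moving the last letter of a twisted Coxeter word to the front. -/
theorem IsModel.rotate_symm (hn : 2 ≤ n) {c : Word n} {i : Fin (n + 1)}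
    {v : ℤ → Fin (n + 1) → ℤ} {X : ℕ → ℤ} (hc : IsTwistedCoxeterWord (c ++ [vee i]))
    (h : IsModel (c ++ [vee i]) v X) :
    IsModel (i :: c) (fun a => refl i (v a)) (Function.update X (bar i) (X (bar i) - 1)) := by
  have hnodup : ((i :: c).map bar).Nodup := by
    have := hc.nodup_map
    rw [List.map_append, List.map_cons, List.map_nil, bar_vee hn] at this
    rw [List.map_cons]
    exact (List.perm_append_singleton _ _).nodup_iff.mp this
  have hne : ∀ j ∈ c, bar j ≠ bar i := fun j hj => bar_ne_of_mem hnodup hj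
  have hX : ∀ j ∈ c, Function.update X (bar i) (X (bar i) - 1) (bar j) = X (bar j) :=
    fun j hj => Function.update_of_ne (hne j hj) _ _
  have hroots := h.roots
  rw [rootList_append, List.map_append] at hroots
  obtain ⟨hroots1, hroots2⟩ := List.append_inj hroots (by rw [length_rootList, List.length_map])
  simp only [rootList, List.map_cons, List.map_nil, List.cons.injEq, and_true, bar_vee hn]
    at hroots2
  have hcox : ∀ w, wordAct (i :: c) (veeVec (refl i w)) =
      refl i (wordAct (c ++ [vee i]) (veeVec w)) := by
    intro w
    rw [wordAct_append, veeVec_refl hn]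
    rfl
  -- The twisted Coxeter element moves the chord just before the row to the first chord of the row,
  -- which is the root of the last letter; cancelling `c` and the twist leaves `α_i`.
  have hα : refl i (chord v (bar i) (X (bar i) - 1)) = simpleRoot i := by
    have h1 : wordAct (c ++ [vee i]) (veeVec (chord v (bar i) (X (bar i) - 1))) =
        chord v (bar i) (X (bar i)) := by
      unfold chord
      rw [veeVec_add, wordAct_add, h.cox, h.cox]
      congr 2 <;> ring
    rw [← hroots2, wordAct_append] at h1
    have h2 := wordAct_injective hn c h1
    change refl (vee i) (veeVec _) = _ at h2
    rw [← veeVec_refl hn, ← veeVec_simpleRoot hn] at h2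
    rw [← veeVec_veeVec (refl i _), h2, veeVec_veeVec]
  -- So `α_i` is the last chord of the old row, the one that leaves the window.
  have hlast : chord v (bar i) (X (bar i) + n) = simpleRoot i := by
    have := congrArg (refl i) hα
    rw [refl_refl hn, refl_simpleRoot_self hn] at this
    rw [show X (bar i) + (n : ℤ) = X (bar i) - 1 + (n + 1) by ring, h.frame.chord_add, this,
      neg_neg]
  refine ⟨h.frame.map (refl_neg i) (refl_dot_refl hn i), ?_, ?_, fun a => ?_, fun β => ?_⟩
  · have ho := h.order
    rw [List.pairwise_append] at ho
    rw [List.pairwise_cons]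
    refine ⟨fun a ha => ?_, ho.1.imp_of_mem fun {a b} ha hb hab => ?_⟩
    · rw [hX a ha, Function.update_self]
      have := ho.2.2 a ha _ (List.mem_singleton_self _)
      rw [bar_vee hn] at this
      constructor
      · intro e; rw [this.2 e]; ring
      · intro e; rw [this.1 e]; ring
    · rw [hX a ha, hX b hb]; exact hab
  · simp only [rootList, List.map_cons, chord_refl, hα, Function.update_self, List.cons.injEq,
      true_and]
    rw [hroots1, List.map_map]
    exact List.map_congr_left fun j hj => by rw [hX j hj]; rfl
  · rw [hcox, h.cox]
  · have hsec := h.isSection hc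
    have hb1 := one_le_bar hn i
    have hb2 := bar_le i
    rw [mem_posRoots_iff_refl hn i]
    constructor
    · rintro (rfl | ⟨γ, hγ, hne', rfl⟩)
      · exact ⟨bar i, 0, hb1, hb2, by omega, by rw [Function.update_self, chord_refl, ← hα]; simp⟩
      · obtain ⟨k, r, hk, hk', hr, rfl⟩ := (h.pos γ).mp hγ
        by_cases hki : k = bar i
        · subst hki
          have hrn : r ≠ n := by
            rintro rfl
            exact hne' hlast
          refine ⟨bar i, r + 1, hb1, hb2, by omega, ?_⟩
          rw [Function.update_self, chord_refl]
          congr 2; push_cast; ring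
        · exact ⟨k, r, hk, hk', hr, by rw [Function.update_of_ne hki, chord_refl]⟩
    · rintro ⟨k, r, hk, hk', hr, rfl⟩
      rw [chord_refl]
      by_cases hki : k = bar i
      · subst hki
        rw [Function.update_self]
        by_cases hr0 : r = 0
        · left
          rw [← hα, hr0]; simp
        · right
          refine ⟨chord v (bar i) (X (bar i) + (r - 1 : ℕ)), (h.pos _).mpr
            ⟨bar i, r - 1, hb1, hb2, by omega, rfl⟩, fun he => ?_, ?_⟩
          · rw [← hlast] at he
            have := h.frame.chord_inj hsec hk hk' hk hk' (by omega) (by omega) he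
            omega
          · rw [Nat.cast_sub (by omega)]
            congr 2; push_cast; ring
      · right
        rw [Function.update_of_ne hki]
        refine ⟨chord v k (X k + r), (h.pos _).mpr ⟨k, r, hk, hk', hr, rfl⟩, fun he => ?_, rfl⟩
        rw [← hlast] at he
        exact hki (h.frame.chord_inj hsec hk hk' hb1 hb2 hr le_rfl he).1

/-! ### The initial word -/

theorem refl_apply_of_lt {i : Fin (n + 1)} (h : i.val < n) (v : Fin (n + 1) → ℤ)
    (j : Fin (n + 1)) : refl i v j =
      if j.val = i.val then v ⟨i.val + 1, by omega⟩ else if j.val = i.val + 1 then v i else v j := by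
  rw [refl, Pi.sub_apply, Pi.smul_apply, dotProduct_simpleRoot_of_lt _ _ h, simpleRoot_apply,
    if_pos h, smul_eq_mul]
  by_cases h1 : j.val = i.val
  · have : j = i := Fin.ext h1
    subst this
    simp
  · by_cases h2 : j.val = i.val + 1
    · have : j = ⟨i.val + 1, by omega⟩ := Fin.ext h2
      rw [if_neg h1, if_neg h1, if_pos h2, if_pos h2, this]
      ring
    · simp [h1, h2]

/-- The word `1 2 ⋯ m`. -/
def risingWord (n m : ℕ) : Word n := (List.range m).map fun q => Fin.ofNat (n + 1) q

theorem risingWord_succ (n m : ℕ) : risingWord n (m + 1) = risingWord n m ++ [Fin.ofNat (n + 1) m] := by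
  simp [risingWord, List.range_succ]

theorem risingWord_eq (n : ℕ) : risingWord n n = (List.finRange n).map Fin.castSucc := by
  apply List.ext_getElem
  · simp [risingWord]
  · intro k h1 h2
    simp only [risingWord, List.length_map, List.length_range] at h1
    simp [risingWord, Fin.ext_iff]
    omega

theorem val_ofNat {q : ℕ} (h : q < n + 1) : (Fin.ofNat (n + 1) q).val = q :=
  Nat.mod_eq_of_lt h

theorem wordAct_risingWord {m : ℕ} (hm : m ≤ n) (v : Fin (n + 1) → ℤ) (j : Fin (n + 1)) :
    wordAct (risingWord n m) v j = if j.val = 0 then v (Fin.ofNat (n + 1) m)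
      else if j.val ≤ m then v (Fin.ofNat (n + 1) (j.val - 1)) else v j := by
  induction m generalizing v with
  | zero =>
    have : (risingWord n 0) = [] := rfl
    rw [this]
    change v j = _
    split_ifs with h1 h2
    · rw [Fin.ext (h1.trans (val_ofNat (show 0 < n + 1 by omega)).symm)]
    · omega
    · rfl
  | succ m ih =>
    rw [risingWord_succ, wordAct_append, ih (by omega)]
    change (if _ then refl _ v _ else if _ then refl _ v _ else refl _ v j) = _
    have hv := val_ofNat (n := n) (q := m) (by omega)
    have hlt : (Fin.ofNat (n + 1) m).val < n := by omega
    have hj := j.isLt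
    simp only [refl_apply_of_lt hlt, hv, val_ofNat (show j.val - 1 < n + 1 by omega)]
    by_cases h0 : j.val = 0
    · simp only [h0, if_true]
      congr 1
      exact Fin.ext (val_ofNat (by omega)).symm
    · by_cases h1 : j.val ≤ m
      · simp only [if_neg h0, if_pos h1, if_neg (show ¬ j.val - 1 = m by omega),
          if_neg (show ¬ j.val - 1 = m + 1 by omega), if_pos (show j.val ≤ m + 1 by omega)]
      · by_cases h2 : j.val = m + 1
        · simp only [if_neg h0, if_neg h1, if_neg (show ¬ j.val = m by omega), if_pos h2,
            if_pos h2.le]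
          rw [h2, Nat.add_sub_cancel]
        · simp only [if_neg h0, if_neg h1, if_neg (show ¬ j.val = m by omega), if_neg h2,
            if_neg (show ¬ j.val ≤ m + 1 by omega)]

theorem rootList_risingWord {m : ℕ} (hm : m ≤ n) : rootList (risingWord n m) =
    (List.range m).map fun q => Pi.single 0 1 - Pi.single (Fin.ofNat (n + 1) (q + 1)) 1 := by
  induction m with
  | zero => rfl
  | succ m ih =>
    rw [risingWord_succ, rootList_append, ih (by omega), List.range_succ, List.map_append]
    congr 1
    simp only [rootList, List.map_nil, List.map_cons, List.cons.injEq, and_true]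
    ext j
    have hv := val_ofNat (n := n) (q := m) (by omega)
    have hv' := val_ofNat (n := n) (q := m + 1) (by omega)
    have hj := j.isLt
    rw [wordAct_risingWord (by omega)]
    simp only [simpleRoot_apply, hv, val_ofNat (show j.val - 1 < n + 1 by omega), Pi.sub_apply,
      Pi.single_apply, Fin.ext_iff, hv', Fin.val_zero]
    split_ifs <;> omega

theorem stdFrame_add (n : ℕ) (i : Fin (n + 1)) :
    stdFrame n (i.val + (n + 1)) = -Pi.single i 1 := by
  rw [stdFrame_anti, stdFrame_val]

theorem stdFrame_add_add (n : ℕ) (i : Fin (n + 1)) :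
    stdFrame n (i.val + (n + 1) + (n + 1)) = Pi.single i 1 := by
  rw [stdFrame_anti, stdFrame_add, neg_neg]

theorem isTwistedCoxeterWord_risingWord (n : ℕ) : IsTwistedCoxeterWord (risingWord n n) := by
  unfold IsTwistedCoxeterWord
  have : (risingWord n n).map bar = List.range' 1 n := by
    rw [List.range'_eq_map_range, risingWord, List.map_map]
    refine List.map_congr_left fun q hq => ?_
    rw [List.mem_range] at hq
    simp only [Function.comp_apply, bar, val_ofNat (show q < n + 1 by omega)]
    omega
  rw [this]

/-- The roots of `1 2 ⋯ n` are `ε_1 - ε_b` with `b = k + 1`, `1 ≤ k ≤ n`. Their chords share the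
second end `2 (n + 1)`, where the frame is `ε_1`; the first end `k + (n + 1)`, where it is `-ε_b`,
gives the section. -/
theorem isModel_risingWord (hn : 2 ≤ n) :
    IsModel (risingWord n n) (stdFrame n) (fun k => k + (n + 1)) := by
  have hbar : ∀ q, q < n → bar (Fin.ofNat (n + 1) q) = q + 1 := fun q hq => by
    simp only [bar, val_ofNat (show q < n + 1 by omega)]; omega
  refine ⟨isFrame_stdFrame n, ?_, ?_, ?_, ?_⟩
  · rw [risingWord, List.pairwise_map]
    refine List.pairwise_lt_range.imp_of_mem fun {a b} ha hb hab => ?_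
    rw [List.mem_range] at ha hb
    rw [hbar a ha, hbar b hb]
    exact ⟨fun e => by rw [e]; push_cast; ring, fun e => by omega⟩
  · rw [rootList_risingWord le_rfl]
    conv_rhs => rw [risingWord, List.map_map]
    refine List.map_congr_left fun q hq => ?_
    rw [List.mem_range] at hq
    have h1 := stdFrame_add n (Fin.ofNat (n + 1) (q + 1))
    have h2 := stdFrame_add_add n (0 : Fin (n + 1))
    rw [val_ofNat (by omega)] at h1
    simp only [Fin.val_zero] at h2
    simp only [Function.comp_apply, hbar q hq, chord, h1]
    rw [show ((q + 1 : ℕ) : ℤ) + (n + 1) + (n + 1 - (q + 1 : ℕ)) = ((0 : ℕ) : ℤ) + (n + 1) + (n + 1) by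
      push_cast; ring, h2]
    abel
  -- The word permutes the `ε_j` cyclically, and the twist inserts a sign where the cycle closes;
  -- this makes the orbit antiperiodic.
  · have key : ∀ i : Fin (n + 1), wordAct (risingWord n n) (veeVec (stdFrame n i.val)) =
        stdFrame n (i.val + 1) := by
      intro i
      have hi := i.isLt
      ext j
      have hj := j.isLt
      rw [wordAct_risingWord le_rfl, stdFrame_val]
      by_cases hin : i.val = n
      · have h0 := stdFrame_add n (0 : Fin (n + 1))
        simp only [Fin.val_zero, Nat.cast_zero, zero_add] at h0
        rw [hin, h0]
        simp only [veeVec, Fin.ext_iff, Pi.single_apply, Fin.val_last, Pi.neg_apply, Fin.val_zero,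
          val_ofNat (show n < n + 1 by omega), val_ofNat (show j.val - 1 < n + 1 by omega), hin]
        split_ifs <;> omega
      · have h0 := stdFrame_val n (Fin.ofNat (n + 1) (i.val + 1))
        rw [val_ofNat (by omega)] at h0
        push_cast at h0
        rw [h0]
        simp only [veeVec, Fin.ext_iff, Pi.single_apply, Fin.val_last,
          val_ofNat (show n < n + 1 by omega), val_ofNat (show j.val - 1 < n + 1 by omega),
          val_ofNat (show i.val + 1 < n + 1 by omega)]
        split_ifs <;> omega
    have hstep : ∀ a, wordAct (risingWord n n) (veeVec (stdFrame n (a + (n + 1)))) =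
        stdFrame n (a + (n + 1) + 1) ↔
        wordAct (risingWord n n) (veeVec (stdFrame n a)) = stdFrame n (a + 1) := by
      intro a
      rw [show a + ((n : ℤ) + 1) + 1 = a + 1 + (n + 1) by ring, stdFrame_anti, stdFrame_anti,
        veeVec_neg, wordAct_neg, neg_inj]
    intro a
    have hall : ∀ (i : Fin (n + 1)) (q : ℤ),
        wordAct (risingWord n n) (veeVec (stdFrame n (i.val + q * (n + 1)))) =
          stdFrame n (i.val + q * (n + 1) + 1) := by
      intro i q
      induction q using Int.induction_on with
      | zero => simpa using key i
      | succ q ih =>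
        rw [show (i.val : ℤ) + ((q : ℤ) + 1) * (n + 1) = i.val + q * (n + 1) + (n + 1) by ring, hstep]
        exact ih
      | pred q ih =>
        rw [← hstep]
        rw [show (i.val : ℤ) + (-(q : ℤ) - 1) * (n + 1) + (n + 1) = i.val + -q * (n + 1) by ring]
        exact ih
    have h1 := Int.emod_nonneg a (show ((n : ℤ) + 1) ≠ 0 by omega)
    have h2 := Int.emod_lt_of_pos a (show (0 : ℤ) < (n : ℤ) + 1 by omega)
    have h3 := Int.emod_add_ediv_mul a (n + 1)
    have := hall ⟨(a % (n + 1)).toNat, by omega⟩ (a / (n + 1))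
    simp only [Int.toNat_of_nonneg h1] at this
    rwa [h3] at this
  · intro β
    rw [mem_posRoots]
    have hs : ∀ a : Fin (n + 1), ∀ x : ℤ, x = a.val + (n + 1) → stdFrame n x = -Pi.single a 1 := by
      rintro a x rfl; exact stdFrame_add n a
    have hs' : ∀ a : Fin (n + 1), ∀ x : ℤ, x = a.val + (n + 1) + (n + 1) →
        stdFrame n x = Pi.single a 1 := by
      rintro a x rfl; exact stdFrame_add_add n a
    constructor
    -- A minus sign is realized by an end in the second period of the frame, a plus sign by an end
    -- in the third.
    · rintro ⟨a, b, hab, rfl | rfl⟩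
      · have hab' : a.val < b.val := hab
        refine ⟨b.val - a.val, a.val, by omega, by omega, by omega, ?_⟩
        rw [chord, hs b _ (by omega), hs' a _ (by omega)]
        abel
      · have hab' : a.val < b.val := hab
        refine ⟨a.val + (n + 1) - b.val, b.val, by omega, by omega, by omega, ?_⟩
        rw [chord, hs' a _ (by omega), hs' b _ (by omega)]
    · rintro ⟨k, r, hk, hk', hr, rfl⟩
      by_cases hkr : k + r ≤ n
      · refine ⟨⟨r, by omega⟩, ⟨k + r, by omega⟩, Fin.mk_lt_mk.mpr (by omega), .inl ?_⟩
        rw [chord, hs ⟨k + r, by omega⟩ _ (by push_cast; ring), hs' ⟨r, by omega⟩ _ (by push_cast; ring)]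
        abel
      · refine ⟨⟨k + r - (n + 1), by omega⟩, ⟨r, by omega⟩, Fin.mk_lt_mk.mpr (by omega), .inr ?_⟩
        rw [chord, hs' ⟨k + r - (n + 1), by omega⟩ _ (by simp only; omega),
          hs' ⟨r, by omega⟩ _ (by push_cast; ring)]

/-! ### Propagation of chord models through the cluster point -/

/-- Twisted adapted classes come from twisted Coxeter words that have a chord model. -/
theorem exists_isModel_of_mem_cluster (hn : 2 ≤ n) {K : Set (Word n)}
    (hK : K ∈ twistedAdaptedClusterPoint n) : ∃ c v X, IsTwistedCoxeterWord c ∧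
      K = commClass (foldedWord c) ∧ IsModel c v X := by
  have hclass : ∀ {w w' : Word n}, CommEquiv w w' → commClass w = commClass w' := by
    intro w w' h
    ext x
    exact ⟨fun hx => h.symm.trans hx, fun hx => h.trans hx⟩
  have hmem : ∀ {w w' : Word n}, commClass w = commClass w' → CommEquiv w w' := by
    intro w w' h
    have : w' ∈ commClass w := h ▸ CommEquiv.refl w'
    exact this
  induction hK with
  | refl =>
    rw [← risingWord_eq]
    exact ⟨_, _, _, isTwistedCoxeterWord_risingWord n, rfl, isModel_risingWord hn⟩
  | @tail K₁ K₂ _ hstep ih =>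
    obtain ⟨c, v, X, hc, hK, hM⟩ := ih
    cases hstep with
    | right i w =>
      obtain ⟨c₀, h1, h2⟩ := hc.exists_cons hn (hmem hK)
      have hc₀ := hc.of_perm h1.perm
      exact ⟨_, _, _, hc₀.rotate hn, hclass h2, (hM.commEquiv hn hc h1).rotate hn hc₀⟩
    | left i w =>
      -- Reversing the words turns the left step into a right step for the reversed twisted Coxeter
      -- word; the result is reversed back.
      have hrev := (hmem hK).reverse
      rw [foldedWord_reverse hn, List.reverse_append] at hrev
      have hbarn : ∀ (k : ℕ) (j : Fin (n + 1)), bar (vee^[k] j) = bar j := by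
        intro k j
        induction k with
        | zero => rfl
        | succ k ih => rw [Function.iterate_succ_apply', bar_vee hn, ih]
      have hrevtw : ∀ c : Word n, IsTwistedCoxeterWord c →
          IsTwistedCoxeterWord (c.map vee^[n]).reverse := by
        intro c hc
        unfold IsTwistedCoxeterWord at *
        rw [List.map_reverse, List.map_map]
        refine (List.reverse_perm _).trans ?_
        rwa [show bar ∘ vee^[n] = bar from funext fun j => hbarn n j]
      have hinv : ∀ c : Word n, (((c.map vee^[n]).reverse).map vee^[n]).reverse = c := by
        intro c
        rw [List.map_reverse, List.reverse_reverse, List.map_map, ← Function.iterate_add]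
        have : (vee : Fin (n + 1) → Fin (n + 1))^[n + n] = id := by
          rw [← two_mul, Function.iterate_mul, show (vee : Fin (n + 1) → Fin (n + 1))^[2] = id from
            funext fun i => vee_vee hn i, Function.iterate_id]
        rw [this, List.map_id]
      obtain ⟨c₀, h1, h2⟩ := (hrevtw c hc).exists_cons (w := w.reverse) hn hrev
      have h1' := (h1.map_vee_iterate hn n).reverse
      have h2' := h2.reverse
      rw [hinv] at h1'
      rw [foldedWord_reverse hn, List.reverse_append, List.reverse_reverse] at h2'
      set d := (c₀.map vee^[n]).reverse with hd
      have e1 : ((i :: c₀).map vee^[n]).reverse = d ++ [vee (vee^[n + 1] i)] := by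
        rw [List.map_cons, List.reverse_cons, Function.iterate_succ_apply', vee_vee hn]
      have e2 : ((c₀ ++ [vee i]).map vee^[n]).reverse = vee^[n + 1] i :: d := by
        simp [Function.iterate_succ_apply, hd]
      rw [e1] at h1'
      rw [e2] at h2'
      have hd1 := hc.of_perm h1'.perm
      refine ⟨_, _, _, ?_, hclass h2', (hM.commEquiv hn hc h1').rotate_symm hn hd1⟩
      have := hrevtw _ (((hrevtw _ hc).of_perm h1.perm).rotate hn)
      rwa [e2] at this

end Model

/-! ### Orders of the letters of a list without repetitions -/

section Lists

variable {α : Type*}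

theorem pair_sublist_iff_idxOf [BEq α] [LawfulBEq α] {C : List α} (hC : C.Nodup) {a b : α} :
    [a, b].Sublist C ↔ b ∈ C ∧ C.idxOf a < C.idxOf b := by
  induction C with
  | nil => simp
  | cons x t ih =>
    rw [List.nodup_cons] at hC
    rw [List.cons_sublist_cons']
    simp only [List.singleton_sublist, ih hC.2, List.mem_cons, List.idxOf_cons]
    by_cases hb : x = b
    · subst hb
      simp [hC.1]
    · by_cases ha : x = a
      · subst ha
        have h1 : b ≠ x := fun h => hb h.symm
        have h2 : (x == b) = false := by simpa using hb
        simp [h1, h2]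
        tauto
      · have h1 : b ≠ x := fun h => hb h.symm
        have h2 : a ≠ x := fun h => ha h.symm
        have h3 : (x == b) = false := by simpa using hb
        have h4 : (x == a) = false := by simpa using ha
        simp [h1, h2, h3, h4]

theorem pair_sublist_iff_append {C : List α} {a b : α} :
    [a, b].Sublist C ↔ ∃ A B D, C = A ++ a :: (B ++ b :: D) := by
  constructor
  · intro h
    obtain ⟨r₁, r₂, rfl, ha, hb⟩ := List.cons_sublist_iff.mp h
    obtain ⟨s, t, rfl⟩ := List.append_of_mem ha
    obtain ⟨s', t', rfl⟩ := List.append_of_mem (List.singleton_sublist.mp hb)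
    exact ⟨s, t ++ s', t', by simp⟩
  · rintro ⟨A, B, D, rfl⟩
    exact (List.Sublist.cons_cons a ((List.singleton_sublist.mpr (by simp)))).trans
      (List.sublist_append_right _ _)

end Lists

/-! ### Coordinates of the roots -/

section Coordinates

variable {n : ℕ}

/-- The root with the ends `x`, `y`. -/
def rootAt (v : ℤ → Fin (n + 1) → ℤ) (z : ℤ × ℤ) : Fin (n + 1) → ℤ := v z.1 + v z.2

/-- The window cut out by a section. -/
def InWindow (n : ℕ) (X : ℕ → ℤ) (z : ℤ × ℤ) : Prop :=
  ∃ k r : ℕ, 1 ≤ k ∧ k ≤ n ∧ r ≤ n ∧ z = (X k + r, X k + r + (n + 1 - k))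

theorem InWindow.strip {X : ℕ → ℤ} {z : ℤ × ℤ} (h : InWindow n X z) :
    z.1 < z.2 ∧ z.2 ≤ z.1 + n := by
  obtain ⟨k, r, hk, hk', hr, rfl⟩ := h
  constructor <;> simp only <;> omega

theorem inWindow_of_row {X : ℕ → ℤ} {z : ℤ × ℤ} {k : ℕ} (hk : 1 ≤ k) (hk' : k ≤ n)
    (hz : z.2 = z.1 + (n + 1 - k)) (h1 : X k ≤ z.1) (h2 : z.1 ≤ X k + n) : InWindow n X z := by
  refine ⟨k, (z.1 - X k).toNat, hk, hk', by omega, Prod.ext ?_ ?_⟩ <;> simp only <;> omega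

theorem IsSection.total {X : ℕ → ℤ} (hX : IsSection n X) {k l : ℕ} (hk : 1 ≤ k) (hk' : k ≤ n)
    (hl : 1 ≤ l) (hl' : l ≤ n) : (X k ≤ X l ∧ X l ≤ X k + (l - k) ∧ k ≤ l) ∨
      (X l ≤ X k ∧ X k ≤ X l + (k - l) ∧ l ≤ k) := by
  rcases le_total k l with hkl | hkl
  · left; have := hX.le hk hkl hl'; exact ⟨this.1, this.2, hkl⟩
  · right; have := hX.le hl hkl hk'; exact ⟨this.1, this.2, hkl⟩

/-- Windows are convex in the strip. -/
theorem InWindow.convex {X : ℕ → ℤ} (hX : IsSection n X) {a b z : ℤ × ℤ} (ha : InWindow n X a)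
    (hb : InWindow n X b) (h1 : a ≤ z) (h2 : z ≤ b) (hz : z.1 < z.2) (hz' : z.2 ≤ z.1 + n) :
    InWindow n X z := by
  obtain ⟨k, r, hk, hk', hr, rfl⟩ := ha
  obtain ⟨l, s, hl, hl', hs, rfl⟩ := hb
  rw [Prod.le_def] at h1 h2
  simp only at h1 h2
  -- The row of `z` is `n + 1 - (z.2 - z.1)`; the slope bounds of the section compare its start with
  -- those of the rows of `a` and `b`.
  have e1 := hX.total hk hk' (l := (n + 1 - (z.2 - z.1)).toNat) (by omega) (by omega)
  have e2 := hX.total hl hl' (l := (n + 1 - (z.2 - z.1)).toNat) (by omega) (by omega)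
  refine inWindow_of_row (k := (n + 1 - (z.2 - z.1)).toNat) (by omega) (by omega) (by omega) ?_ ?_
    <;> omega

theorem rootAt_injOn {v : ℤ → Fin (n + 1) → ℤ} (hv : IsFrame v) {X : ℕ → ℤ} (hX : IsSection n X)
    {a b : ℤ × ℤ} (ha : InWindow n X a) (hb : InWindow n X b) (h : rootAt v a = rootAt v b) :
    a = b := by
  obtain ⟨k, r, hk, hk', hr, rfl⟩ := ha
  obtain ⟨l, s, hl, hl', hs, rfl⟩ := hb
  obtain ⟨rfl, rfl⟩ := hv.chord_inj hX hk hk' hl hl' hr hs h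
  rfl

/-- Incomparable elements of a window are orthogonal. -/
theorem rootAt_dot_of_incomparable {v : ℤ → Fin (n + 1) → ℤ} (hv : IsFrame v) {X : ℕ → ℤ}
    {a b : ℤ × ℤ} (ha : InWindow n X a) (hb : InWindow n X b) (h1 : ¬ a ≤ b) (h2 : ¬ b ≤ a) :
    rootAt v a ⬝ᵥ rootAt v b = 0 := by
  -- Incomparable chords are nested, so their four distinct ends lie among `n + 1` consecutive
  -- indices.
  have key : ∀ a b : ℤ × ℤ, InWindow n X a → InWindow n X b → a.1 < b.1 → b.2 < a.2 →
      rootAt v a ⬝ᵥ rootAt v b = 0 := by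
    intro a b ha hb h1 h2
    have sa := ha.strip
    have sb := hb.strip
    simp only [rootAt, add_dotProduct, dotProduct_add]
    rw [hv.orth a.1 b.1 h1 (by omega), hv.orth a.1 b.2 (by omega) (by omega),
      dotProduct_comm (v a.2), hv.orth b.1 a.2 (by omega) (by omega), dotProduct_comm (v a.2),
      hv.orth b.2 a.2 (by omega) (by omega)]
    rfl
  rw [Prod.le_def] at h1 h2
  by_cases h : a.1 < b.1
  · exact key a b ha hb h (by omega)
  · rw [dotProduct_comm]; exact key b a hb ha (by omega) (by omega)

/-- `b` is obtained from `a` by moving one end by one step. -/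
def UnitStep (a b : ℤ × ℤ) : Prop := b = (a.1 + 1, a.2) ∨ b = (a.1, a.2 + 1)

/-- The chords share one end and are otherwise orthogonal, so the product is `1`. Hence no
commutation can exchange them. -/
theorem rootAt_dot_of_unitStep {v : ℤ → Fin (n + 1) → ℤ} (hv : IsFrame v) {X : ℕ → ℤ}
    {a b : ℤ × ℤ} (ha : InWindow n X a) (hb : InWindow n X b) (h : UnitStep a b) :
    rootAt v a ⬝ᵥ rootAt v b ≠ 0 := by
  have sa := ha.strip
  have sb := hb.strip
  rcases h with rfl | rfl
  · simp only [rootAt, add_dotProduct, dotProduct_add] at *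
    rw [hv.orth a.1 (a.1 + 1) (by omega) (by omega), hv.orth a.1 a.2 (by omega) (by omega),
      dotProduct_comm (v a.2), hv.orth (a.1 + 1) a.2 (by omega) (by omega), hv.unit]
    norm_num
  · simp only [rootAt, add_dotProduct, dotProduct_add] at *
    rw [hv.unit, hv.orth a.1 (a.2 + 1) (by omega) (by omega), dotProduct_comm (v a.2),
      hv.orth a.1 a.2 (by omega) (by omega), hv.orth a.2 (a.2 + 1) (by omega) (by omega)]
    norm_num

/-- The coordinates of the roots of a folded word, in the order of the letters. -/
def coordList (c : Word n) (X : ℕ → ℤ) (m : ℕ) : List (ℤ × ℤ) :=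
  (List.range m).flatMap fun r : ℕ => c.map fun i =>
    (X (bar i) + (r : ℤ), X (bar i) + (r : ℤ) + (n + 1 - bar i))

/-- Each further copy of `c` applies the twisted Coxeter element once more and moves all chords by
one step; the induction therefore splits off the first copy. -/
theorem rootList_foldedWord (hn : 2 ≤ n) {c : Word n} {v : ℤ → Fin (n + 1) → ℤ} {X : ℕ → ℤ}
    (h : IsModel c v X) :
    rootList (foldedWord c) = (coordList c X (n + 1)).map (rootAt v) := by
  have key : ∀ m : ℕ, rootList ((List.range m).flatMap fun k => c.map (vee^[k])) =
      (coordList c X m).map (rootAt v) := by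
    intro m
    induction m with
    | zero => rfl
    | succ m ih =>
      have e1 : ((List.range m).map Nat.succ).flatMap (fun k => c.map (vee^[k])) =
          ((List.range m).flatMap fun k => c.map (vee^[k])).map vee := by
        simp only [List.flatMap_map, List.map_flatMap, List.map_map, ← Function.iterate_succ']
      have e2 : ((List.range m).map Nat.succ).flatMap
          (fun r : ℕ => c.map fun i =>
            (X (bar i) + (r : ℤ), X (bar i) + (r : ℤ) + (n + 1 - bar i))) =
          (coordList c X m).map fun z => (z.1 + 1, z.2 + 1) := by
        simp only [coordList, List.flatMap_map, List.map_flatMap, List.map_map]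
        refine List.flatMap_congr fun r _ => List.map_congr_left fun i _ => Prod.ext ?_ ?_ <;>
          simp only [Function.comp_apply] <;> push_cast <;> ring
      have e3 : coordList c X (m + 1) = (c.map fun i =>
          (X (bar i) + ((0 : ℕ) : ℤ), X (bar i) + ((0 : ℕ) : ℤ) + (n + 1 - bar i))) ++
          (coordList c X m).map fun z => (z.1 + 1, z.2 + 1) := by
        rw [← e2]
        conv_lhs => rw [coordList, List.range_succ_eq_map, List.flatMap_cons]
      rw [List.range_succ_eq_map, List.flatMap_cons, e1, rootList_append, rootList_map_vee hn, ih,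
        e3, List.map_append, List.map_map,
        List.map_map, List.map_map]
      congr 1
      · simp only [Function.iterate_zero, List.map_id, h.roots]
        exact List.map_congr_left fun i _ => by
          simp only [Function.comp_apply, rootAt, chord]
          congr 2 <;> simp
      · rw [List.map_map]
        refine List.map_congr_left fun z _ => ?_
        simp only [Function.comp_apply, rootAt, veeVec_add, wordAct_add, Function.iterate_zero,
          List.map_id, h.cox]
  exact key (n + 1)

theorem inWindow_of_mem_coordList (hn : 2 ≤ n) {c : Word n} {X : ℕ → ℤ} {z : ℤ × ℤ}
    (h : z ∈ coordList c X (n + 1)) : InWindow n X z := by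
  simp only [coordList, List.mem_flatMap, List.mem_range, List.mem_map] at h
  obtain ⟨r, hr, i, -, rfl⟩ := h
  exact ⟨bar i, r, one_le_bar hn i, bar_le i, by omega, rfl⟩

theorem mem_coordList_of_inWindow {c : Word n} {X : ℕ → ℤ} (hc : IsTwistedCoxeterWord c)
    {z : ℤ × ℤ} (h : InWindow n X z) : z ∈ coordList c X (n + 1) := by
  obtain ⟨k, r, hk, hk', hr, rfl⟩ := h
  obtain ⟨i, hi, rfl⟩ := hc.exists_mem hk hk'
  simp only [coordList, List.mem_flatMap, List.mem_range, List.mem_map]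
  exact ⟨r, by omega, i, hi, rfl⟩

/-- The coordinate list is a linear extension of the componentwise order. -/
theorem coordList_pairwise (hn : 2 ≤ n) {c : Word n} {v : ℤ → Fin (n + 1) → ℤ} {X : ℕ → ℤ}
    (hc : IsTwistedCoxeterWord c) (h : IsModel c v X) :
    (coordList c X (n + 1)).Pairwise fun z z' => ¬ z' ≤ z := by
  have hX := h.isSection hc
  have hnd := hc.nodup_map
  have hord : (c.map bar).Pairwise fun k l => (l = k + 1 → X l = X k + 1) ∧
      (k = l + 1 → X k = X l) := by
    rw [List.pairwise_map]; exact h.order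
  rw [List.pairwise_iff_forall_sublist] at hord
  have hmem : ∀ k, 1 ≤ k → k ≤ n → k ∈ c.map bar := fun k hk hk' => by
    obtain ⟨i, hi, rfl⟩ := hc.exists_mem hk hk'
    exact List.mem_map_of_mem hi
  -- The converse of `order`: the section determines which of two neighbouring labels occurs first.
  have hlt : ∀ k, 1 ≤ k → k < n → (X (k + 1) = X k + 1 →
      (c.map bar).idxOf k < (c.map bar).idxOf (k + 1)) ∧
      (X (k + 1) = X k → (c.map bar).idxOf (k + 1) < (c.map bar).idxOf k) := by
    intro k hk hk'
    have hne : (c.map bar).idxOf k ≠ (c.map bar).idxOf (k + 1) := fun e => by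
      have := (List.idxOf_inj (hmem k hk hk'.le)).mp e
      omega
    constructor
    · intro e
      by_contra hcon
      have := (hord ((pair_sublist_iff_idxOf hnd).mpr
        ⟨hmem k hk hk'.le, lt_of_le_of_ne (not_lt.mp hcon) hne.symm⟩)).2 rfl
      omega
    · intro e
      by_contra hcon
      have := (hord ((pair_sublist_iff_idxOf hnd).mpr
        ⟨hmem (k + 1) (by omega) hk', lt_of_le_of_ne (not_lt.mp hcon) hne⟩)).1 rfl
      omega
  have hup : ∀ k l, 1 ≤ k → k ≤ l → l ≤ n → X l = X k + (l - k) →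
      (c.map bar).idxOf k ≤ (c.map bar).idxOf l := by
    intro k l hk hkl
    induction l, hkl using Nat.le_induction with
    | base => intros; exact le_rfl
    | succ l hkl ih =>
      intro hl e
      have e1 := hX.le hk hkl (by omega)
      have e2 := hX l (by omega) (by omega)
      push_cast at e
      exact (ih (by omega) (by omega)).trans ((hlt l (by omega) (by omega)).1 (by omega)).le
  have hdown : ∀ k l, 1 ≤ k → k ≤ l → l ≤ n → X l = X k →
      (c.map bar).idxOf l ≤ (c.map bar).idxOf k := by
    intro k l hk hkl
    induction l, hkl using Nat.le_induction with
    | base => intros; exact le_rfl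
    | succ l hkl ih =>
      intro hl e
      have e1 := hX.le hk hkl (by omega)
      have e2 := hX l (by omega) (by omega)
      exact ((hlt l (by omega) (by omega)).2 (by omega)).le.trans (ih (by omega) (by omega))
  rw [coordList, List.pairwise_flatMap]
  constructor
  · intro r _
    have : c.Pairwise fun i j => (c.map bar).idxOf (bar i) < (c.map bar).idxOf (bar j) := by
      have h1 : (c.map bar).Pairwise fun k l => (c.map bar).idxOf k < (c.map bar).idxOf l :=
        List.pairwise_iff_forall_sublist.mpr fun {a b} hab =>
          ((pair_sublist_iff_idxOf hnd).mp hab).2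
      rwa [List.pairwise_map] at h1
    rw [List.pairwise_map]
    -- Within one copy, `z' ≤ z` forces the section to have constant slope `0` or constant slope `1`
    -- between the two rows; `hdown` or `hup` then contradicts the order of occurrence.
    refine this.imp fun {i j} hij hle => ?_
    rw [Prod.le_def] at hle
    simp only at hle
    rcases hX.total (one_le_bar hn i) (bar_le i) (one_le_bar hn j) (bar_le j) with e | e
    · have := hdown (bar i) (bar j) (one_le_bar hn i) e.2.2 (bar_le j) (by omega)
      omega
    · have := hup (bar j) (bar i) (one_le_bar hn j) e.2.2 (bar_le i) (by omega)
      omega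
  · refine List.pairwise_lt_range.imp fun {r s} hrs => ?_
    intro z hz z' hz' hle
    simp only [List.mem_map] at hz hz'
    obtain ⟨i, -, rfl⟩ := hz
    obtain ⟨j, -, rfl⟩ := hz'
    rw [Prod.le_def] at hle
    simp only at hle
    have := hX.total (one_le_bar hn i) (bar_le i) (one_le_bar hn j) (bar_le j)
    omega

/-! ### Words of a class as linear extensions -/

/-- Exchange of adjacent orthogonal members of a list of coordinates. -/
def OrthMove (v : ℤ → Fin (n + 1) → ℤ) (C C' : List (ℤ × ℤ)) : Prop :=
  ∃ A B z z', rootAt v z ⬝ᵥ rootAt v z' = 0 ∧ C = A ++ z :: z' :: B ∧ C' = A ++ z' :: z :: B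

theorem OrthMove.append_left {v : ℤ → Fin (n + 1) → ℤ} {C C' : List (ℤ × ℤ)}
    (D : List (ℤ × ℤ)) (h : OrthMove v C C') : OrthMove v (D ++ C) (D ++ C') := by
  obtain ⟨A, B, z, z', h0, rfl, rfl⟩ := h
  exact ⟨D ++ A, B, z, z', h0, by simp, by simp⟩

/-- Splitting a list of coordinates stably according to a predicate. -/
theorem orthMove_partition (v : ℤ → Fin (n + 1) → ℤ) (p : ℤ × ℤ → Bool) (C : List (ℤ × ℤ))
    (h : C.Pairwise fun z z' => ¬ p z → p z' → rootAt v z ⬝ᵥ rootAt v z' = 0) :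
    Relation.ReflTransGen (OrthMove v) C (C.filter p ++ C.filter (fun z => !p z)) := by
  induction C with
  | nil => exact Relation.ReflTransGen.refl
  | cons z C ih =>
    rw [List.pairwise_cons] at h
    have h1 : Relation.ReflTransGen (OrthMove v) (z :: C)
        (z :: (C.filter p ++ C.filter (fun z => !p z))) :=
      Relation.ReflTransGen.lift (List.cons z) (fun _ _ h => h.append_left [z]) _ _ (ih h.2)
    by_cases hp : p z
    · rw [List.filter_cons_of_pos hp, List.filter_cons_of_neg (by simp [hp])]
      exact h1
    · rw [List.filter_cons_of_neg hp, List.filter_cons_of_pos (by simp [hp])]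
      refine h1.trans ?_
      have key : ∀ A B : List (ℤ × ℤ), (∀ a ∈ A, rootAt v z ⬝ᵥ rootAt v a = 0) →
          Relation.ReflTransGen (OrthMove v) (z :: (A ++ B)) (A ++ z :: B) := by
        intro A
        induction A with
        | nil => exact fun B _ => Relation.ReflTransGen.refl
        | cons a A ihA =>
          intro B hA
          refine Relation.ReflTransGen.head ⟨[], A ++ B, z, a, hA a List.mem_cons_self, rfl, rfl⟩ ?_
          exact Relation.ReflTransGen.lift (List.cons a) (fun _ _ h => h.append_left [a]) _ _
            (ihA B fun b hb => hA b (List.mem_cons_of_mem _ hb))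
      exact key _ _ fun a ha => h.1 a (List.mem_filter.mp ha).1 hp (List.mem_filter.mp ha).2

/-- The adjacent roots `u α_i` and `u s_i α_j` have product `-(α_i, α_j)`, so they are orthogonal
exactly when the simple roots are. -/
theorem OrthMove.lift (hn : 2 ≤ n) {v : ℤ → Fin (n + 1) → ℤ} {C C' : List (ℤ × ℤ)}
    (h : OrthMove v C C') {w : Word n} (hw : rootList w = C.map (rootAt v)) :
    ∃ w', CommEquiv w w' ∧ rootList w' = C'.map (rootAt v) := by
  obtain ⟨A, B, z, z', h0, rfl, rfl⟩ := h
  rw [List.map_append, List.map_cons, List.map_cons] at hw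
  have hl : w.length = A.length + (B.length + 2) := by
    rw [← length_rootList, hw]; simp
  obtain ⟨u, t, rfl, hu⟩ : ∃ u t, w = u ++ t ∧ u.length = A.length :=
    ⟨w.take A.length, w.drop A.length, by simp, by simp; omega⟩
  rcases t with _ | ⟨i, _ | ⟨j, x⟩⟩
  · simp at hl; omega
  · simp at hl; omega
  have hw2 := hw
  rw [rootList_append] at hw2
  obtain ⟨e1, e2⟩ := List.append_inj hw2 (by rw [length_rootList, List.length_map, hu])
  simp only [rootList, List.map_cons, List.cons.injEq] at e2
  have hij : simpleRoot i ⬝ᵥ simpleRoot j = 0 := by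
    rw [← e2.1, ← e2.2.1, wordAct_dot_wordAct hn, refl, dotProduct_sub, dotProduct_smul,
      simpleRoot_dot_self hn, smul_eq_mul, dotProduct_comm (simpleRoot j)] at h0
    linarith
  obtain ⟨B', h1, h2⟩ := rootList_swap u x hij
  refine ⟨u ++ j :: i :: x, Relation.ReflTransGen.single
    ⟨u, x, i, j, refl_comm_of_dot hij, rfl, rfl⟩, ?_⟩
  rw [h1, e1] at hw
  have := List.append_cancel_left hw
  simp only [List.cons.injEq] at this
  rw [h2, e1, List.map_append, List.map_cons, List.map_cons, this.1, this.2.1, this.2.2]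

theorem orthMoves_lift (hn : 2 ≤ n) {v : ℤ → Fin (n + 1) → ℤ} {C C' : List (ℤ × ℤ)}
    (h : Relation.ReflTransGen (OrthMove v) C C') {w : Word n}
    (hw : rootList w = C.map (rootAt v)) :
    ∃ w', CommEquiv w w' ∧ rootList w' = C'.map (rootAt v) := by
  induction h with
  | refl => exact ⟨w, CommEquiv.refl w, hw⟩
  | tail _ h ih =>
    obtain ⟨w', h1, h2⟩ := ih
    obtain ⟨w'', h3, h4⟩ := h.lift hn h2
    exact ⟨w'', h1.trans h3, h4⟩

/-- A list of coordinates is a listing of the window. -/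
structure IsListing (n : ℕ) (X : ℕ → ℤ) (C : List (ℤ × ℤ)) : Prop where
  nodup : C.Nodup
  mem : ∀ z, z ∈ C ↔ InWindow n X z
  step : C.Pairwise fun z z' => ¬ UnitStep z' z

/-- Commutations of distinct letters exchange orthogonal roots, and a unit step is never orthogonal;
so the direction of unit steps is an invariant of the class. -/
theorem IsListing.commMove (hn : 2 ≤ n) {v : ℤ → Fin (n + 1) → ℤ} (hv : IsFrame v)
    {X : ℕ → ℤ} {C : List (ℤ × ℤ)} (hC : IsListing n X C) {w w' : Word n}
    (hw : rootList w = C.map (rootAt v)) (h : CommMove w w') :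
    ∃ C', IsListing n X C' ∧ rootList w' = C'.map (rootAt v) := by
  obtain ⟨u, x, i, j, hcomm, rfl, rfl⟩ := h
  by_cases hij : i = j
  · subst hij; exact ⟨C, hC, hw⟩
  have h0 := dot_eq_zero_of_refl_comm hn hij hcomm
  obtain ⟨B, h1, h2⟩ := rootList_swap u x h0
  rw [h1] at hw
  obtain ⟨A', C₁, rfl, hA, hC₁⟩ := List.map_eq_append_iff.mp hw.symm
  obtain ⟨z, C₂, rfl, hz, hC₂⟩ := List.map_eq_cons_iff.mp hC₁
  obtain ⟨z', B', rfl, hz', hB⟩ := List.map_eq_cons_iff.mp hC₂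
  have hp : (A' ++ z :: z' :: B').Perm (A' ++ z' :: z :: B') :=
    List.Perm.append_left _ (List.Perm.swap _ _ _)
  refine ⟨A' ++ z' :: z :: B', ⟨hp.nodup_iff.mp hC.nodup, fun y => ?_, ?_⟩, ?_⟩
  · rw [← hp.mem_iff, hC.mem]
  · have := hC.step
    simp only [List.pairwise_append, List.pairwise_cons, List.mem_cons] at this ⊢
    obtain ⟨g1, ⟨g2, g3, g4⟩, g5⟩ := this
    refine ⟨g1, ⟨?_, fun a ha => g2 a (.inr ha), g4⟩, fun a ha b hb => g5 a ha b (by tauto)⟩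
    rintro a (rfl | ha)
    · intro hs
      refine rootAt_dot_of_unitStep hv ((hC.mem _).mp (by simp)) ((hC.mem _).mp (by simp)) hs ?_
      rw [hz, hz', wordAct_dot_wordAct hn, h0]
    · exact g3 a ha
  · rw [h2, ← hA, ← hz, ← hz', ← hB]
    simp

theorem IsListing.commEquiv (hn : 2 ≤ n) {v : ℤ → Fin (n + 1) → ℤ} (hv : IsFrame v)
    {X : ℕ → ℤ} {C : List (ℤ × ℤ)} (hC : IsListing n X C) {w w' : Word n}
    (hw : rootList w = C.map (rootAt v)) (h : CommEquiv w w') :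
    ∃ C', IsListing n X C' ∧ rootList w' = C'.map (rootAt v) := by
  induction h with
  | refl => exact ⟨C, hC, hw⟩
  | tail _ h ih =>
    obtain ⟨C', h1, h2⟩ := ih
    exact h1.commMove hn hv h2 h

/-- Listings are linear extensions of the componentwise order. -/
theorem IsListing.sublist_of_lt (hn : 2 ≤ n) {X : ℕ → ℤ} (hX : IsSection n X)
    {C : List (ℤ × ℤ)} (hC : IsListing n X C) {a b : ℤ × ℤ} (ha : InWindow n X a)
    (hb : InWindow n X b) (hab : a < b) : [a, b].Sublist C := by
  rw [pair_sublist_iff_idxOf hC.nodup]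
  refine ⟨(hC.mem b).mpr hb, ?_⟩
  have hstep : ∀ a a', InWindow n X a → InWindow n X a' → UnitStep a a' →
      C.idxOf a < C.idxOf a' := by
    intro a a' ha ha' h
    by_contra hcon
    have hne : C.idxOf a' ≠ C.idxOf a := fun e => by
      have e' := (List.idxOf_inj ((hC.mem a').mpr ha')).mp e
      subst e'
      rcases h with h | h <;> simp [Prod.ext_iff] at h
    exact List.pairwise_iff_forall_sublist.mp hC.step ((pair_sublist_iff_idxOf hC.nodup).mpr
      ⟨(hC.mem a).mpr ha, lt_of_le_of_ne (not_lt.mp hcon) hne⟩) h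
  obtain ⟨d, hd⟩ : ∃ d : ℕ, b.1 - a.1 + (b.2 - a.2) = d := by
    have := (Prod.le_def.mp hab.le)
    exact ⟨(b.1 - a.1 + (b.2 - a.2)).toNat, by omega⟩
  induction d using Nat.strong_induction_on generalizing a with
  | _ d ih =>
    have sa := ha.strip
    have sb := hb.strip
    have hle := Prod.le_def.mp hab.le
    have hne : ¬ (a.1 = b.1 ∧ a.2 = b.2) := fun e => hab.ne (Prod.ext e.1 e.2)
    -- Move towards `b` inside the strip: advance the second end if possible, otherwise the first.
    -- Convexity keeps the path in the window.
    obtain ⟨a', hs, hle', hst⟩ : ∃ a', UnitStep a a' ∧ (a'.1 ≤ b.1 ∧ a'.2 ≤ b.2) ∧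
        (a'.1 < a'.2 ∧ a'.2 ≤ a'.1 + n) := by
      by_cases h : a.2 < b.2 ∧ a.2 < a.1 + n
      · exact ⟨(a.1, a.2 + 1), .inr rfl, by simp only; omega, by simp only; omega⟩
      · exact ⟨(a.1 + 1, a.2), .inl rfl, by simp only; omega, by simp only; omega⟩
    have haa' : a ≤ a' ∧ a'.1 + a'.2 = a.1 + a.2 + 1 := by
      rcases hs with rfl | rfl
      · exact ⟨Prod.le_def.mpr (by simp), by simp only; ring⟩
      · exact ⟨Prod.le_def.mpr (by simp), by simp only; ring⟩
    have hle'' : a' ≤ b := Prod.le_def.mpr hle'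
    have ha' : InWindow n X a' := ha.convex hX hb haa'.1 hle'' hst.1 hst.2
    have h1 := hstep a a' ha ha' hs
    rcases hle''.eq_or_lt with rfl | hlt
    · exact h1
    · exact h1.trans (ih (d - 1) (by omega) ha' hlt (by omega))

end Coordinates

/-! ### Generalized distances in abstract finite posets with weights -/

section Abstract

theorem extend_single_add_single {A B : Type*} [DecidableEq A] [DecidableEq B] {f : A → B}
    (hf : Function.Injective f) (a b : A) :
    Function.extend f (Pi.single a 1 + Pi.single b 1 : A → ℕ) 0 =
      Pi.single (f a) 1 + Pi.single (f b) 1 := by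
  ext y
  by_cases hy : ∃ x, f x = y
  · obtain ⟨x, rfl⟩ := hy
    rw [hf.extend_apply]
    simp [Pi.single_apply, hf.eq_iff]
  · rw [Function.extend_apply' _ _ _ hy]
    have ha : y ≠ f a := fun h => hy ⟨a, h.symm⟩
    have hb : y ≠ f b := fun h => hy ⟨b, h.symm⟩
    simp [ha, hb]

theorem extend_zero_injective {A B : Type*} {f : A → B} (hf : Function.Injective f) :
    Function.Injective fun m : A → ℕ => Function.extend f m 0 := by
  intro m m' h
  ext a
  have := congrFun h (f a)
  simpa [hf.extend_apply] using this

variable {A B V W : Type*} [Fintype A] [Fintype B] [AddCommGroup V] [AddCommGroup W]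

/-- The order on sequences attached to a relation `r` and weights `ω`: the weights agree, and the
first sequence is smaller wherever the two differ in a minimal or maximal place. -/
structure AbsSeqLT (r : A → A → Prop) (ω : A → V) (m m' : A → ℕ) : Prop where
  weight : ∑ a, (m a : ℤ) • ω a = ∑ a, (m' a : ℤ) • ω a
  ne : m ≠ m'
  min : ∀ d, m d ≠ m' d → (∀ e, r e d → m e = m' e) → m d < m' d
  max : ∀ d, m d ≠ m' d → (∀ e, r d e → m e = m' e) → m d < m' d

theorem absSeqLT_flip (r : A → A → Prop) (ω : A → V) : AbsSeqLT (flip r) ω = AbsSeqLT r ω := by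
  ext m m'
  exact ⟨fun h => ⟨h.weight, h.ne, h.max, h.min⟩, fun h => ⟨h.weight, h.ne, h.max, h.min⟩⟩

/-- Descend from `b` to a minimal place of difference. Together with `AbsSeqLT.exists_max` this
traps every difference between places where `m'` is positive. -/
theorem AbsSeqLT.exists_min {s : A → A → Prop} {ω : A → V} {m m' : A → ℕ} (h : AbsSeqLT s ω m m')
    (hirr : ∀ b, ¬ s b b) (htr : ∀ a b c, s a b → s b c → s a c) {b : A} (hb : m b ≠ m' b) :
    ∃ d, (d = b ∨ s d b) ∧ m d < m' d := by
  have : Std.Irrefl s := ⟨hirr⟩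
  have : IsTrans A s := ⟨htr⟩
  obtain ⟨d, ⟨hd1, hd2⟩, hd3⟩ := (Finite.wellFounded_of_trans_of_irrefl s).has_min
    {d | m d ≠ m' d ∧ (d = b ∨ s d b)} ⟨b, hb, .inl rfl⟩
  refine ⟨d, hd2, h.min d hd1 fun e he => ?_⟩
  by_contra hc
  refine hd3 e ⟨hc, .inr ?_⟩ he
  rcases hd2 with rfl | hd2
  · exact he
  · exact htr _ _ _ he hd2

theorem AbsSeqLT.exists_max {s : A → A → Prop} {ω : A → V} {m m' : A → ℕ} (h : AbsSeqLT s ω m m')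
    (hirr : ∀ b, ¬ s b b) (htr : ∀ a b c, s a b → s b c → s a c) {b : A} (hb : m b ≠ m' b) :
    ∃ d, (d = b ∨ s b d) ∧ m d < m' d := by
  rw [← absSeqLT_flip] at h
  exact h.exists_min hirr (fun a b c h1 h2 => htr c b a h2 h1) hb

variable [DecidableEq A] [DecidableEq B]

/-- Simple pairs with respect to a relation on sequences. -/
def AbsSimplePair (lt : (A → ℕ) → (A → ℕ) → Prop) (a b : A) : Prop :=
  ¬ ∃ m, lt m (Pi.single a 1 + Pi.single b 1)

/-- Simple sequences with respect to a relation on sequences. -/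
def AbsSimpleSeq (lt : (A → ℕ) → (A → ℕ) → Prop) (m : A → ℕ) : Prop :=
  (∑ a, m a = 1) ∨ ∀ a b, a ≠ b → 0 < m a → 0 < m b → AbsSimplePair lt a b

open Classical in
/-- The generalized distance with respect to a relation on sequences. -/
noncomputable def absGdist (lt : (A → ℕ) → (A → ℕ) → Prop) (m : A → ℕ) : ℕ :=
  if AbsSimpleSeq lt m then 0
  else sSup {r | ∃ L : List (A → ℕ), L.IsChain lt ∧ (∀ x ∈ L, ¬ AbsSimpleSeq lt x) ∧
    L.getLast? = some m ∧ L.length = r}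

theorem sum_extend {f : A → B} (hf : Function.Injective f) (m : A → ℕ) (g : B → ℕ → V)
    (hg : ∀ b, g b 0 = 0) : ∑ b, g b (Function.extend f m 0 b) = ∑ a, g (f a) (m a) := by
  have : ∀ a, g (f a) (m a) = g (f a) (Function.extend f m 0 (f a)) := fun a => by
    rw [hf.extend_apply]
  rw [Finset.sum_congr rfl fun a _ => this a,
    ← Finset.sum_image (f := fun b => g b (Function.extend f m 0 b)) (s := Finset.univ) (g := f)
      hf.injOn]
  refine (Finset.sum_subset (Finset.subset_univ _) fun b _ hb => ?_).symm
  rw [Function.extend_apply' _ _ _ fun ⟨a, ha⟩ => hb (by simp [← ha]), Pi.zero_apply, hg]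

/-- Generalized distances are compatible with convex embeddings that preserve weights up to an
injective homomorphism. -/
theorem absGdist_extend {r : A → A → Prop} {s : B → B → Prop} {ω : A → V} {ω' : B → W} {f : A → B}
    (hf : Function.Injective f) (hr : ∀ a a', r a a' ↔ s (f a) (f a'))
    (hirr : ∀ b, ¬ s b b) (htr : ∀ a b c, s a b → s b c → s a c)
    (hconv : ∀ a b a', s (f a) b → s b (f a') → ∃ x, f x = b)
    (T : V →+ W) (hT : Function.Injective T) (hω : ∀ a, ω' (f a) = T (ω a)) (m : A → ℕ) :
    absGdist (AbsSeqLT s ω') (Function.extend f m 0) = absGdist (AbsSeqLT r ω) m := by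
  set E : (A → ℕ) → B → ℕ := fun m => Function.extend f m 0 with hE
  have hEf : ∀ m a, E m (f a) = m a := fun m a => hf.extend_apply m 0 a
  have hE0 : ∀ m b, (¬ ∃ a, f a = b) → E m b = 0 := fun m b hb =>
    Function.extend_apply' _ _ _ hb
  have hEinj : Function.Injective E := extend_zero_injective hf
  have hwt : ∀ m, ∑ b, (E m b : ℤ) • ω' b = T (∑ a, (m a : ℤ) • ω a) := by
    intro m
    rw [sum_extend hf m (fun b k => (k : ℤ) • ω' b) (by simp), map_sum]
    exact Finset.sum_congr rfl fun a _ => by rw [hω, map_zsmul]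
  have hlt : ∀ m m', AbsSeqLT s ω' (E m) (E m') ↔ AbsSeqLT r ω m m' := by
    intro m m'
    constructor
    · intro h
      refine ⟨hT (by rw [← hwt, ← hwt, h.weight]), fun e => h.ne (by rw [e]), fun d h1 h2 => ?_,
        fun d h1 h2 => ?_⟩
      · have := h.min (f d) (by rwa [hEf, hEf]) fun e he => by
          by_cases hx : ∃ a, f a = e
          · obtain ⟨a, rfl⟩ := hx
            rw [hEf, hEf, h2 a ((hr _ _).mpr he)]
          · rw [hE0 _ _ hx, hE0 _ _ hx]
        rwa [hEf, hEf] at this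
      · have := h.max (f d) (by rwa [hEf, hEf]) fun e he => by
          by_cases hx : ∃ a, f a = e
          · obtain ⟨a, rfl⟩ := hx
            rw [hEf, hEf, h2 a ((hr _ _).mpr he)]
          · rw [hE0 _ _ hx, hE0 _ _ hx]
        rwa [hEf, hEf] at this
    · intro h
      have hrange : ∀ d, E m d ≠ E m' d → ∃ a, f a = d := by
        intro d hd
        by_contra hx
        exact hd (by rw [hE0 _ _ hx, hE0 _ _ hx])
      refine ⟨by rw [hwt, hwt, h.weight], fun e => h.ne (hEinj e), fun d h1 h2 => ?_,
        fun d h1 h2 => ?_⟩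
      · obtain ⟨a, rfl⟩ := hrange d h1
        rw [hEf, hEf] at h1 ⊢
        exact h.min a h1 fun e he => by
          have := h2 (f e) ((hr _ _).mp he)
          rwa [hEf, hEf] at this
      · obtain ⟨a, rfl⟩ := hrange d h1
        rw [hEf, hEf] at h1 ⊢
        exact h.max a h1 fun e he => by
          have := h2 (f e) ((hr _ _).mp he)
          rwa [hEf, hEf] at this
  -- A place outside the image with `m₀` nonzero would lie between two places where `E m'` is
  -- positive; these belong to the image, and convexity gives a contradiction.
  have hsupp : ∀ m₀ m', AbsSeqLT s ω' m₀ (E m') → ∃ m, E m = m₀ := by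
    intro m₀ m' h
    refine ⟨fun a => m₀ (f a), funext fun b => ?_⟩
    by_cases hb : ∃ a, f a = b
    · obtain ⟨a, rfl⟩ := hb
      exact hEf _ a
    rw [hE0 _ _ hb]
    by_contra hne
    have hD : m₀ b ≠ E m' b := by rw [hE0 _ _ hb]; exact fun e => hne e.symm
    have hpos : ∀ d, m₀ d < E m' d → ∃ a, f a = d := by
      intro d hd
      by_contra hx
      rw [hE0 _ _ hx] at hd
      exact absurd hd (Nat.not_lt_zero _)
    obtain ⟨d, hd, hlt⟩ := h.exists_min hirr htr hD
    obtain ⟨d', hd', hlt'⟩ := h.exists_max hirr htr hD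
    obtain ⟨a, rfl⟩ := hpos d hlt
    obtain ⟨a', rfl⟩ := hpos d' hlt'
    have ha := hd.resolve_left fun e => hb ⟨a, e⟩
    have ha' := hd'.resolve_left fun e => hb ⟨a', e⟩
    exact hb (hconv a b a' ha ha')
  have hpair : ∀ a b, AbsSimplePair (AbsSeqLT s ω') (f a) (f b) ↔
      AbsSimplePair (AbsSeqLT r ω) a b := by
    intro a b
    unfold AbsSimplePair
    rw [← extend_single_add_single hf]
    refine not_congr ⟨?_, ?_⟩
    · rintro ⟨m₀, h⟩
      obtain ⟨m, rfl⟩ := hsupp m₀ _ h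
      exact ⟨m, (hlt _ _).mp h⟩
    · rintro ⟨m, h⟩
      exact ⟨E m, (hlt _ _).mpr h⟩
  have hsimple : ∀ m, AbsSimpleSeq (AbsSeqLT s ω') (E m) ↔ AbsSimpleSeq (AbsSeqLT r ω) m := by
    intro m
    unfold AbsSimpleSeq
    have hrange : ∀ d, 0 < E m d → ∃ a, f a = d := by
      intro d hd
      by_contra hx
      rw [hE0 _ _ hx] at hd
      exact absurd hd (Nat.not_lt_zero _)
    have hsum : ∑ b, E m b = ∑ a, m a := by
      have := sum_extend (V := ℤ) hf m (fun _ k => (k : ℤ)) (by simp)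
      exact_mod_cast this
    rw [hsum]
    refine or_congr Iff.rfl ⟨fun h a b hab ha hb => ?_, fun h a b hab ha hb => ?_⟩
    · exact (hpair a b).mp (h (f a) (f b) (hf.ne hab) (by rwa [hEf]) (by rwa [hEf]))
    · obtain ⟨a, rfl⟩ := hrange a ha
      obtain ⟨b, rfl⟩ := hrange b hb
      rw [hEf] at ha hb
      exact (hpair a b).mpr (h a b (fun e => hab (by rw [e])) ha hb)
  -- A chain is pulled back from its last member, one predecessor at a time, by `hsupp`.
  have hlist : ∀ (L : List (B → ℕ)) (m : A → ℕ), L.IsChain (AbsSeqLT s ω') →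
      L.getLast? = some (E m) → ∃ L' : List (A → ℕ), L = L'.map E := by
    intro L
    induction L with
    | nil => intro m _ h; simp at h
    | cons x L ih =>
      intro m hch hlast
      cases L with
      | nil => exact ⟨[m], by simpa using hlast⟩
      | cons y L =>
        rw [List.isChain_cons_cons] at hch
        rw [List.getLast?_cons_cons] at hlast
        obtain ⟨L', hL'⟩ := ih m hch.2 hlast
        cases L' with
        | nil => simp at hL'
        | cons y' L'' =>
          have hy : y = E y' := (List.cons.inj hL').1
          obtain ⟨x', rfl⟩ := hsupp x y' (hy ▸ hch.1)
          exact ⟨x' :: y' :: L'', by rw [List.map_cons, ← hL']⟩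
  change absGdist _ (E m) = _
  unfold absGdist
  by_cases hm : AbsSimpleSeq (AbsSeqLT r ω) m
  · rw [if_pos hm, if_pos ((hsimple m).mpr hm)]
  rw [if_neg hm, if_neg fun h => hm ((hsimple m).mp h)]
  -- The two sets of lengths coincide, so the suprema agree without any bound on them.
  congr 1
  ext k
  constructor
  · rintro ⟨L, h1, h2, h3, h4⟩
    obtain ⟨L', rfl⟩ := hlist L m h1 h3
    refine ⟨L', ?_, fun x hx => ?_, ?_, by simpa using h4⟩
    · rw [List.isChain_map] at h1
      exact h1.imp fun _ _ h => (hlt _ _).mp h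
    · rw [← hsimple]; exact h2 _ (List.mem_map_of_mem hx)
    · rw [List.getLast?_map] at h3
      obtain ⟨x, hx, hxm⟩ := Option.map_eq_some_iff.mp h3
      rw [hx, hEinj hxm]
  · rintro ⟨L, h1, h2, h3, h4⟩
    refine ⟨L.map E, ?_, fun x hx => ?_, ?_, by simpa using h4⟩
    · rw [List.isChain_map]
      exact h1.imp fun _ _ h => (hlt _ _).mpr h
    · obtain ⟨y, hy, rfl⟩ := List.mem_map.mp hx
      rw [hsimple]; exact h2 _ hy
    · rw [List.getLast?_map, h3]; rfl

end Abstract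

/-! ### Orders of commutation classes -/

section Heap

variable {n : ℕ}

/-- The words of `K` induce total orders on the positive roots, and every root can be moved as far
to the front or to the end as the order of `K` permits. -/
structure IsHeapClass (K : Set (Word n)) : Prop where
  nonempty : K.Nonempty
  irrefl : ∀ w ∈ K, ∀ β, ¬ WordLT w β β
  trans : ∀ w ∈ K, ∀ β γ δ, WordLT w β γ → WordLT w γ δ → WordLT w β δ
  total : ∀ w ∈ K, ∀ β γ, β ≠ γ → WordLT w β γ ∨ WordLT w γ β
  early : ∀ δ, ∃ w ∈ K, ∀ ε, WordLT w ε δ → ClassLT K ε δ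
  late : ∀ δ, ∃ w ∈ K, ∀ ε, WordLT w δ ε → ClassLT K δ ε

/-- The first difference along any word is a minimal place of difference for the order of `K`.
Conversely, for a minimal place, `early` supplies a word in which everything before it lies below
it, so that it is the first difference there. Last differences are dual, through `late`. -/
theorem IsHeapClass.seqLT_eq {K : Set (Word n)} (h : IsHeapClass K) :
    SeqLT K = AbsSeqLT (ClassLT K) fun β : PosRoot n => β.val := by
  ext m m'
  have first : ∀ t : PosRoot n → PosRoot n → Prop, (∀ b, ¬ t b b) →
      (∀ a b c, t a b → t b c → t a c) → m ≠ m' →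
      ∃ d, m d ≠ m' d ∧ ∀ e, t e d → m e = m' e := by
    intro t h1 h2 hne
    have : Std.Irrefl t := ⟨h1⟩
    have : IsTrans _ t := ⟨h2⟩
    obtain ⟨b, hb⟩ := Function.ne_iff.mp hne
    obtain ⟨d, hd, hd'⟩ := (Finite.wellFounded_of_trans_of_irrefl t).has_min
      {d | m d ≠ m' d} ⟨b, hb⟩
    exact ⟨d, hd, fun e he => by by_contra hc; exact hd' e hc he⟩
  constructor
  · rintro ⟨hwt, hlex⟩
    refine ⟨hwt, ?_, fun d hd hmin => ?_, fun d hd hmax => ?_⟩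
    · rintro rfl
      obtain ⟨w, hw⟩ := h.nonempty
      obtain ⟨⟨β, hβ, -⟩, -⟩ := hlex w hw
      exact lt_irrefl _ hβ
    · obtain ⟨w, hw, he⟩ := h.early d
      obtain ⟨⟨β, hβ, hβ'⟩, -⟩ := hlex w hw
      by_cases hdb : d = β
      · exact hdb ▸ hβ
      · rcases h.total w hw d β hdb with hlt | hlt
        · exact absurd (hβ' d hlt) hd
        · exact absurd (hmin β (he β hlt)) hβ.ne
    · obtain ⟨w, hw, he⟩ := h.late d
      obtain ⟨-, ⟨β, hβ, hβ'⟩⟩ := hlex w hw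
      by_cases hdb : d = β
      · exact hdb ▸ hβ
      · rcases h.total w hw d β hdb with hlt | hlt
        · exact absurd (hmax β (he β hlt)) hβ.ne
        · exact absurd (hβ' d hlt) hd
  · intro H
    refine ⟨H.weight, fun w hw => ⟨?_, ?_⟩⟩
    · obtain ⟨d, hd, hd'⟩ := first (WordLT w) (h.irrefl w hw) (h.trans w hw) H.ne
      exact ⟨d, H.min d hd fun e he => hd' e (he w hw), hd'⟩
    · obtain ⟨d, hd, hd'⟩ := first (flip (WordLT w)) (h.irrefl w hw)
        (fun a b c h1 h2 => h.trans w hw c b a h2 h1) H.ne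
      exact ⟨d, H.max d hd fun e he => hd' e (he w hw), hd'⟩

theorem gdist_eq_absGdist {K : Set (Word n)} (h : IsHeapClass K) (m : RootSeq n) :
    gdist K m = absGdist (AbsSeqLT (ClassLT K) fun β : PosRoot n => β.val) m := by
  rw [← h.seqLT_eq]
  rfl

end Heap

/-! ### The order of a class with a chord model -/

section Position

variable {n : ℕ}

/-- Coordinates of the positive roots that turn the order of `K` into the componentwise order. -/
structure IsPosition (K : Set (Word n)) (v : ℤ → Fin (n + 1) → ℤ) (X : ℕ → ℤ)
    (pos : PosRoot n → ℤ × ℤ) : Prop where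
  frame : IsFrame v
  sec : IsSection n X
  window : ∀ β, InWindow n X (pos β)
  val : ∀ β, β.val = rootAt v (pos β)
  surj : ∀ z, InWindow n X z → ∃ β, pos β = z
  heap : IsHeapClass K
  lt_iff : ∀ β γ, ClassLT K β γ ↔ pos β < pos γ

theorem IsPosition.injective {K : Set (Word n)} {v : ℤ → Fin (n + 1) → ℤ} {X : ℕ → ℤ}
    {pos : PosRoot n → ℤ × ℤ} (h : IsPosition K v X pos) : Function.Injective pos :=
  fun β γ e => Subtype.ext (by rw [h.val, h.val, e])

theorem IsPosition.pos_eq {K : Set (Word n)} {v : ℤ → Fin (n + 1) → ℤ} {X : ℕ → ℤ}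
    {pos : PosRoot n → ℤ × ℤ} (h : IsPosition K v X pos) {β : PosRoot n} {z : ℤ × ℤ}
    (hz : InWindow n X z) (hβ : β.val = rootAt v z) : pos β = z :=
  rootAt_injOn h.frame h.sec (h.window β) hz (by rw [← h.val, hβ])

/-- All words of the class list the window compatibly with the componentwise order. Conversely,
there are enough words to rule out further relations, since incomparable chords can be exchanged
(`hpart`). -/
theorem exists_isPosition (hn : 2 ≤ n) {c : Word n} {v : ℤ → Fin (n + 1) → ℤ} {X : ℕ → ℤ}
    (hc : IsTwistedCoxeterWord c) (h : IsModel c v X) :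
    ∃ pos, IsPosition (commClass (foldedWord c)) v X pos := by
  have hX := h.isSection hc
  have hex : ∀ β : PosRoot n, ∃ z, InWindow n X z ∧ β.val = rootAt v z := by
    intro β
    obtain ⟨k, r, hk, hk', hr, hβ⟩ := (h.pos β.val).mp β.2
    exact ⟨_, ⟨k, r, hk, hk', hr, rfl⟩, hβ⟩
  choose pos hwin hval using hex
  have hinj : Function.Injective pos := fun β γ e => Subtype.ext (by rw [hval, hval, e])
  have hsurj : ∀ z, InWindow n X z → ∃ β, pos β = z := by
    rintro z ⟨k, r, hk, hk', hr, rfl⟩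
    refine ⟨⟨_, (h.pos _).mpr ⟨k, r, hk, hk', hr, rfl⟩⟩, ?_⟩
    exact rootAt_injOn h.frame hX (hwin _) ⟨k, r, hk, hk', hr, rfl⟩ (hval _).symm
  have hpw := coordList_pairwise hn hc h
  have hL₀ : IsListing n X (coordList c X (n + 1)) := by
    refine ⟨hpw.imp fun {a b} hab e => hab e.ge, fun z =>
      ⟨inWindow_of_mem_coordList hn, mem_coordList_of_inWindow hc⟩, hpw.imp fun {a b} hab hs =>
        hab ?_⟩
    rcases hs with rfl | rfl <;> exact Prod.le_def.mpr (by simp)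
  have hroots := rootList_foldedWord hn h
  have hlist : ∀ w ∈ commClass (foldedWord c), ∃ C, IsListing n X C ∧
      rootList w = C.map (rootAt v) := fun w hw => hL₀.commEquiv hn h.frame hroots hw
  have hword : ∀ {w : Word n} {C}, (∀ z ∈ C, InWindow n X z) → rootList w = C.map (rootAt v) →
      ∀ β γ, WordLT w β γ ↔ [pos β, pos γ].Sublist C := by
    intro w C hC hw β γ
    rw [wordLT_iff, pair_sublist_iff_append, hw]
    constructor
    · rintro ⟨A, B, D, e⟩
      obtain ⟨A', C₁, rfl, -, hC₁⟩ := List.map_eq_append_iff.mp e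
      obtain ⟨z, C₂, rfl, hz, hC₂⟩ := List.map_eq_cons_iff.mp hC₁
      obtain ⟨B', C₃, rfl, -, hC₃⟩ := List.map_eq_append_iff.mp hC₂
      obtain ⟨z', D', rfl, hz', -⟩ := List.map_eq_cons_iff.mp hC₃
      have e1 : pos β = z := rootAt_injOn h.frame hX (hwin β) (hC z (by simp))
        (by rw [← hval, hz])
      have e2 : pos γ = z' := rootAt_injOn h.frame hX (hwin γ) (hC z' (by simp))
        (by rw [← hval, hz'])
      exact ⟨A', B', D', by rw [e1, e2]⟩
    · rintro ⟨A, B, D, rfl⟩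
      exact ⟨A.map (rootAt v), B.map (rootAt v), D.map (rootAt v), by
        rw [hval, hval]; simp⟩
  -- The hypothesis says that `p` is a down-set. Moving its members to the front takes them only
  -- past incomparable chords.
  have hpart : ∀ p : ℤ × ℤ → Bool, (∀ z z', ¬ p z → p z' → ¬ z ≤ z') →
      ∃ w ∈ commClass (foldedWord c), ∀ β γ, WordLT w β γ → p (pos γ) → p (pos β) := by
    intro p hp
    have hmove := orthMove_partition v p (coordList c X (n + 1)) (hpw.imp_of_mem
      fun {a b} ha hb hab h1 h2 => rootAt_dot_of_incomparable h.frame ((hL₀.mem a).mp ha)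
        ((hL₀.mem b).mp hb) (hp a b h1 h2) hab)
    obtain ⟨w, hw, hw'⟩ := orthMoves_lift hn hmove hroots
    refine ⟨w, hw, fun β γ hlt hγ => ?_⟩
    have hsub := (hword (fun z hz => (hL₀.mem z).mp (by
      rcases List.mem_append.mp hz with hz | hz <;> exact (List.mem_filter.mp hz).1)) hw' β γ).mp hlt
    have hp2 : ((coordList c X (n + 1)).filter p ++
        (coordList c X (n + 1)).filter (fun z => !p z)).Pairwise fun z z' => p z' → p z := by
      rw [List.pairwise_append]
      refine ⟨List.pairwise_of_forall_mem_list fun a ha b _ _ => (List.mem_filter.mp ha).2,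
        List.pairwise_of_forall_mem_list fun a _ b hb hpb => ?_, fun a ha b _ _ =>
          (List.mem_filter.mp ha).2⟩
      have := (List.mem_filter.mp hb).2
      rw [hpb] at this
      simp at this
    exact List.pairwise_iff_forall_sublist.mp hp2 hsub hγ
  have hidx : ∀ w ∈ commClass (foldedWord c), ∃ ι : PosRoot n → ℕ, Function.Injective ι ∧
      ∀ β γ, WordLT w β γ ↔ ι β < ι γ := by
    intro w hw
    obtain ⟨C, hC, hwC⟩ := hlist w hw
    refine ⟨fun β => C.idxOf (pos β), fun β γ e =>
      hinj ((List.idxOf_inj ((hC.mem _).mpr (hwin β))).mp e), fun β γ => ?_⟩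
    rw [hword (fun z hz => (hC.mem z).mp hz) hwC, pair_sublist_iff_idxOf hC.nodup]
    exact and_iff_right ((hC.mem _).mpr (hwin γ))
  have hsub : ∀ w ∈ commClass (foldedWord c), ∀ β γ, pos β < pos γ → WordLT w β γ := by
    intro w hw β γ hlt
    obtain ⟨C, hC, hwC⟩ := hlist w hw
    exact (hword (fun z hz => (hC.mem z).mp hz) hwC β γ).mpr (hC.sublist_of_lt hn hX (hwin β) (hwin γ) hlt)
  have hirr : ∀ w ∈ commClass (foldedWord c), ∀ β, ¬ WordLT w β β := by
    intro w hw β hlt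
    obtain ⟨ι, -, hι⟩ := hidx w hw
    exact lt_irrefl _ ((hι β β).mp hlt)
  have hearly : ∀ δ, ∃ w ∈ commClass (foldedWord c), ∀ ε, WordLT w ε δ → pos ε < pos δ := by
    intro δ
    obtain ⟨w, hw, hw'⟩ := hpart (fun z => decide (z ≤ pos δ)) fun z z' h1 h2 h3 =>
      h1 (by simpa using h3.trans (by simpa using h2))
    refine ⟨w, hw, fun ε hε => lt_of_le_of_ne (by simpa using hw' ε δ hε (by simp)) fun e => ?_⟩
    exact hirr w hw δ (hinj e ▸ hε)
  have hlate : ∀ δ, ∃ w ∈ commClass (foldedWord c), ∀ ε, WordLT w δ ε → pos δ < pos ε := by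
    intro δ
    -- The down-set is the complement of the up-set of `pos δ`; so whatever follows `δ` in this word
    -- lies in that up-set.
    obtain ⟨w, hw, hw'⟩ := hpart (fun z => !decide (pos δ ≤ z)) fun z z' h1 h2 h3 => by
      simp only [Bool.not_eq_true', decide_eq_false_iff_not, not_not] at h1 h2
      exact h2 (h1.trans h3)
    refine ⟨w, hw, fun ε hε => lt_of_le_of_ne ?_ fun e => hirr w hw δ (by
      have := hinj e
      subst this
      exact hε)⟩
    by_contra hcon
    have := hw' δ ε hε (by simpa using hcon)
    simp at this
  have hlt : ∀ β γ, ClassLT (commClass (foldedWord c)) β γ ↔ pos β < pos γ := by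
    intro β γ
    refine ⟨fun hcl => ?_, fun hlt w hw => hsub w hw β γ hlt⟩
    obtain ⟨w, hw, hw'⟩ := hearly γ
    exact hw' β (hcl w hw)
  refine ⟨pos, h.frame, hX, hwin, hval, hsurj, ⟨⟨_, CommEquiv.refl _⟩, hirr, ?_, ?_, ?_, ?_⟩, hlt⟩
  · intro w hw β γ δ
    obtain ⟨ι, -, hι⟩ := hidx w hw
    rw [hι, hι, hι]
    exact lt_trans
  · intro w hw β γ hne
    obtain ⟨ι, hι', hι⟩ := hidx w hw
    rw [hι, hι]
    exact lt_or_gt_of_ne (hι'.ne hne)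
  · intro δ
    obtain ⟨w, hw, hw'⟩ := hearly δ
    exact ⟨w, hw, fun ε hε => (hlt ε δ).mpr (hw' ε hε)⟩
  · intro δ
    obtain ⟨w, hw, hw'⟩ := hlate δ
    exact ⟨w, hw, fun ε hε => (hlt δ ε).mpr (hw' ε hε)⟩

/-! ### Generalized distances in the strip -/

theorem antiperiodic_eq {F G : ℤ → Fin (n + 1) → ℤ} (hF : ∀ a, F (a + (n + 1)) = -F a)
    (hG : ∀ a, G (a + (n + 1)) = -G a) (h : ∀ i : Fin (n + 1), F i.val = G i.val) : F = G := by
  have hall : ∀ (i : Fin (n + 1)) (q : ℤ), F (i.val + q * (n + 1)) = G (i.val + q * (n + 1)) := by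
    intro i q
    induction q using Int.induction_on with
    | zero => simpa using h i
    | succ q ih =>
      rw [show (i.val : ℤ) + ((q : ℤ) + 1) * (n + 1) = i.val + q * (n + 1) + (n + 1) by ring, hF,
        hG, ih]
    | pred q ih =>
      rw [show (i.val : ℤ) + -(q : ℤ) * (n + 1) =
        i.val + (-(q : ℤ) - 1) * (n + 1) + (n + 1) by ring, hF, hG, neg_inj] at ih
      exact ih
  ext1 a
  have h1 := Int.emod_nonneg a (show ((n : ℤ) + 1) ≠ 0 by omega)
  have h2 := Int.emod_lt_of_pos a (show (0 : ℤ) < (n : ℤ) + 1 by omega)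
  have h3 := Int.emod_add_ediv_mul a (n + 1)
  have := hall ⟨(a % (n + 1)).toNat, by omega⟩ (a / (n + 1))
  simp only [Int.toNat_of_nonneg h1] at this
  rwa [h3] at this

/-- Every frame is the image of the standard frame under an injective homomorphism. -/
theorem IsFrame.exists_hom {u : ℤ → Fin (n + 1) → ℤ} (hu : IsFrame u) :
    ∃ T : (Fin (n + 1) → ℤ) →+ (Fin (n + 1) → ℤ), Function.Injective T ∧
      ∀ a, T (stdFrame n a) = u a := by
  let T : (Fin (n + 1) → ℤ) →+ (Fin (n + 1) → ℤ) :=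
    { toFun := fun w => ∑ i, w i • u i.val
      map_zero' := by simp
      map_add' := fun w w' => by simp [add_smul, Finset.sum_add_distrib] }
  have hT : ∀ w, T w = ∑ i, w i • u i.val := fun w => rfl
  refine ⟨T, fun w w' h => ?_, fun a => ?_⟩
  · have hdot : ∀ (w : Fin (n + 1) → ℤ) (j : Fin (n + 1)), T w ⬝ᵥ u j.val = w j := by
      intro w j
      rw [hT, sum_dotProduct, Finset.sum_eq_single j]
      · rw [smul_dotProduct, hu.unit, smul_eq_mul, mul_one]
      · intro i _ hij
        have hij' : i.val ≠ j.val := fun e => hij (Fin.ext e)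
        rw [smul_dotProduct, hu.dot_eq_zero (by omega) (by omega) (by omega) (by omega) (by omega),
          smul_zero]
      · intro hj; exact absurd (Finset.mem_univ j) hj
    ext j
    rw [← hdot w j, ← hdot w' j, h]
  · have := antiperiodic_eq (F := fun a => T (stdFrame n a)) (G := u)
      (fun a => by simp only [stdFrame_anti, map_neg]) hu.anti fun i => by
        simp only [stdFrame_val, hT]
        rw [Finset.sum_eq_single i]
        · simp
        · intro j _ hj; simp [hj]
        · intro hi; exact absurd (Finset.mem_univ i) hi
    exact congrFun this a

/-- The interval from `a` to `b` in the strip `1 ≤ y - x ≤ n`. -/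
abbrev Strip (n : ℕ) (a b : ℤ × ℤ) : Type :=
  {z : ℤ × ℤ // z ∈ (Finset.Icc a b).filter fun z : ℤ × ℤ => z.1 < z.2 ∧ z.2 ≤ z.1 + n}

/-- The generalized distance of `a` and `b` in the strip. -/
noncomputable def stripDist (n : ℕ) (a b : ℤ × ℤ) : ℕ :=
  absGdist (AbsSeqLT (fun z z' : Strip n a b => z.val < z'.val) fun z => rootAt (stdFrame n) z.val)
    fun z => (if z.val = a then 1 else 0) + (if z.val = b then 1 else 0)

/-- Generalized distances of a class are computed in the strip. -/
theorem IsPosition.gdist_eq {K : Set (Word n)} {v u : ℤ → Fin (n + 1) → ℤ} {X : ℕ → ℤ}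
    {pos : PosRoot n → ℤ × ℤ} (h : IsPosition K v X pos) (hu : IsFrame u) (φ : ℤ × ℤ ≃ ℤ × ℤ)
    (hφu : ∀ z, rootAt v (φ z) = rootAt u z)
    (hφs : ∀ z : ℤ × ℤ, (z.1 < z.2 ∧ z.2 ≤ z.1 + n) ↔ ((φ z).1 < (φ z).2 ∧ (φ z).2 ≤ (φ z).1 + n))
    (hφ : (∀ z z' : ℤ × ℤ, z ≤ z' ↔ φ z ≤ φ z') ∨ (∀ z z' : ℤ × ℤ, z ≤ z' ↔ φ z' ≤ φ z)) {a b : ℤ × ℤ}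
    (hab : a ≤ b) {α β : PosRoot n} (hα : pos α = φ a) (hβ : pos β = φ b) :
    gdist K (pairSeq α β) = stripDist n a b := by
  have hwin : ∀ z : Strip n a b, InWindow n X (φ z.val) := by
    intro z
    obtain ⟨hz1, hz2⟩ := Finset.mem_filter.mp z.2
    rw [Finset.mem_Icc] at hz1
    have hs := (hφs z.val).mp hz2
    rcases hφ with hφ | hφ
    · exact InWindow.convex h.sec (hα ▸ h.window α) (hβ ▸ h.window β) ((hφ _ _).mp hz1.1)
        ((hφ _ _).mp hz1.2) hs.1 hs.2
    · exact InWindow.convex h.sec (hβ ▸ h.window β) (hα ▸ h.window α) ((hφ _ _).mp hz1.2)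
        ((hφ _ _).mp hz1.1) hs.1 hs.2
  choose f hf using fun z : Strip n a b => h.surj _ (hwin z)
  have hfinj : Function.Injective f := fun z z' e => by
    have := hf z
    rw [e, hf z'] at this
    exact Subtype.ext (φ.injective this.symm)
  have hstrip : ∀ γ, pos γ = φ a ∨ pos γ = φ b ∨ (a ≤ φ.symm (pos γ) ∧ φ.symm (pos γ) ≤ b) →
      ∃ z, f z = γ ∧ z.val = φ.symm (pos γ) := by
    intro γ hγ
    have hs := (h.window γ).strip
    rw [← φ.apply_symm_apply (pos γ)] at hs
    have hs' := (hφs _).mpr hs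
    have hin : φ.symm (pos γ) ∈ Finset.Icc a b := by
      rw [Finset.mem_Icc]
      rcases hγ with e | e | e
      · rw [e, φ.symm_apply_apply]; exact ⟨le_rfl, hab⟩
      · rw [e, φ.symm_apply_apply]; exact ⟨hab, le_rfl⟩
      · exact e
    refine ⟨⟨_, Finset.mem_filter.mpr ⟨hin, hs'⟩⟩, h.injective ?_, rfl⟩
    rw [hf, φ.apply_symm_apply]
  obtain ⟨za, hza, hza'⟩ := hstrip α (.inl hα)
  obtain ⟨zb, hzb, hzb'⟩ := hstrip β (.inr (.inl hβ))
  rw [hα, φ.symm_apply_apply] at hza'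
  rw [hβ, φ.symm_apply_apply] at hzb'
  obtain ⟨T, hT, hTu⟩ := hu.exists_hom
  have hω : ∀ z : Strip n a b, (f z).val = T (rootAt (stdFrame n) z.val) := by
    intro z
    rw [h.val, hf, hφu, rootAt, rootAt, map_add, hTu, hTu]
  have hm : (fun z : Strip n a b => (if z.val = a then 1 else 0) + (if z.val = b then 1 else 0)) =
      (Pi.single za 1 + Pi.single zb 1 : Strip n a b → ℕ) := by
    ext z
    simp only [Pi.add_apply, Pi.single_apply, Subtype.ext_iff, hza', hzb']
  rw [gdist_eq_absGdist h.heap, stripDist, hm, pairSeq, ← hza, ← hzb,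
    ← extend_single_add_single hfinj]
  have hlt : ∀ z z' : ℤ × ℤ, z < z' ↔ z ≤ z' ∧ ¬ z' ≤ z := fun z z' => lt_iff_le_not_ge
  rcases hφ with hφ | hφ
  · refine absGdist_extend hfinj (fun z z' => ?_) (fun γ hγ => ?_) (fun γ δ ε h1 h2 => ?_)
      (fun z γ z' h1 h2 => ?_) T hT hω _
    · rw [h.lt_iff, hf, hf, hlt, hlt]
      exact and_congr (hφ _ _) (not_congr (hφ _ _))
    · exact lt_irrefl _ ((h.lt_iff _ _).mp hγ)
    · rw [h.lt_iff] at *; exact lt_trans h1 h2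
    · rw [h.lt_iff, hf] at h1 h2
      obtain ⟨hz1, -⟩ := Finset.mem_filter.mp z.2
      obtain ⟨hz2, -⟩ := Finset.mem_filter.mp z'.2
      rw [Finset.mem_Icc] at hz1 hz2
      rw [← φ.apply_symm_apply (pos γ)] at h1 h2
      obtain ⟨x, hx, -⟩ := hstrip γ (.inr (.inr ⟨hz1.1.trans ((hφ _ _).mpr h1.le),
        ((hφ _ _).mpr h2.le).trans hz2.2⟩))
      exact ⟨x, hx⟩
  -- Reversal is harmless, because the order on sequences treats minimal and maximal places alike.
  · rw [← absSeqLT_flip (ClassLT K)]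
    refine absGdist_extend hfinj (fun z z' => ?_) (fun γ hγ => ?_) (fun γ δ ε h1 h2 => ?_)
      (fun z γ z' h1 h2 => ?_) T hT hω _
    · rw [flip, h.lt_iff, hf, hf, hlt, hlt]
      exact and_congr (hφ _ _) (not_congr (hφ _ _))
    · exact lt_irrefl _ ((h.lt_iff _ _).mp hγ)
    · rw [flip, h.lt_iff] at *; exact lt_trans h2 h1
    · rw [flip, h.lt_iff, hf] at h1 h2
      obtain ⟨hz1, -⟩ := Finset.mem_filter.mp z.2
      obtain ⟨hz2, -⟩ := Finset.mem_filter.mp z'.2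
      rw [Finset.mem_Icc] at hz1 hz2
      rw [← φ.apply_symm_apply (pos γ)] at h1 h2
      obtain ⟨x, hx, -⟩ := hstrip γ (.inr (.inr ⟨hz1.1.trans ((hφ _ _).mpr h1.le),
        ((hφ _ _).mpr h2.le).trans hz2.2⟩))
      exact ⟨x, hx⟩

end Position

/-! ### Distant pairs are simple -/

section Distant

variable {n : ℕ}

theorem pairSeq_comm (α β : PosRoot n) : pairSeq α β = pairSeq β α := add_comm _ _

/-- A pair is simple if some functional is `-1` on both members and non-negative in between. -/
theorem IsPosition.gdist_eq_zero {K : Set (Word n)} {v : ℤ → Fin (n + 1) → ℤ} {X : ℕ → ℤ}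
    {pos : PosRoot n → ℤ × ℤ} (h : IsPosition K v X pos) {α β : PosRoot n}
    (hαβ : pos α < pos β) (F : (Fin (n + 1) → ℤ) →+ ℤ) (hα : F α.val = -1) (hβ : F β.val = -1)
    (hF : ∀ γ, pos α < pos γ → pos γ < pos β → 0 ≤ F γ.val) : gdist K (pairSeq α β) = 0 := by
  have hne : α ≠ β := fun e => hαβ.ne (by rw [e])
  have hpair : ∀ γ, pairSeq α β γ = if γ = α ∨ γ = β then 1 else 0 := by
    intro γ
    simp only [pairSeq, Pi.add_apply, Pi.single_apply]
    by_cases h1 : γ = α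
    · have : γ ≠ β := fun e => hne (h1.symm.trans e)
      simp [h1, hne]
    · simp [h1]
  have hirr : ∀ b, ¬ ClassLT K b b := fun b hb => lt_irrefl _ ((h.lt_iff b b).mp hb)
  have htr : ∀ a b c, ClassLT K a b → ClassLT K b c → ClassLT K a c := fun a b c h1 h2 => by
    rw [h.lt_iff] at *; exact h1.trans h2
  have hsimple : IsSimplePair K α β := by
    rintro ⟨m, hm⟩
    rw [h.heap.seqLT_eq] at hm
    have hsmall : ∀ e, m e < pairSeq α β e → (e = α ∨ e = β) ∧ m e = 0 := by
      intro e he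
      rw [hpair] at he
      split_ifs at he with h1
      · exact ⟨h1, by omega⟩
      · omega
    -- A larger count at `α` would need a place at or below `α` where `m` is smaller than the pair.
    -- Only `α` and `β` can be such places, and `β` lies above.
    have hmα : m α ≤ 1 := by
      by_contra hc
      have hD : m α ≠ pairSeq α β α := by rw [hpair]; simp; omega
      obtain ⟨e, he, hlt⟩ := hm.exists_min hirr htr hD
      obtain ⟨he', h0⟩ := hsmall e hlt
      rcases he' with rfl | rfl
      · omega
      · rcases he with he | he
        · exact hne he.symm
        · exact absurd ((h.lt_iff _ _).mp he) hαβ.not_gt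
    have hmβ : m β ≤ 1 := by
      by_contra hc
      have hD : m β ≠ pairSeq α β β := by rw [hpair]; simp; omega
      obtain ⟨e, he, hlt⟩ := hm.exists_max hirr htr hD
      obtain ⟨he', h0⟩ := hsmall e hlt
      rcases he' with rfl | rfl
      · rcases he with he | he
        · exact hne he
        · exact absurd ((h.lt_iff _ _).mp he) hαβ.not_gt
      · omega
    have hother : ∀ γ, γ ≠ α → γ ≠ β → 0 ≤ (m γ : ℤ) * F γ.val := by
      intro γ h1 h2
      by_cases h0 : m γ = 0
      · simp [h0]
      have hD : m γ ≠ pairSeq α β γ := by rw [hpair, if_neg (by tauto)]; exact h0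
      obtain ⟨e, he, hlt⟩ := hm.exists_min hirr htr hD
      obtain ⟨e', he', hlt'⟩ := hm.exists_max hirr htr hD
      have he1 := (hsmall e hlt).1
      have he2 := (hsmall e' hlt').1
      have hl : pos e < pos γ := by
        rcases he with rfl | he
        · rcases he1 with rfl | rfl <;> contradiction
        · exact (h.lt_iff _ _).mp he
      have hr : pos γ < pos e' := by
        rcases he' with rfl | he'
        · rcases he2 with rfl | rfl <;> contradiction
        · exact (h.lt_iff _ _).mp he'
      refine mul_nonneg (by positivity) (hF γ ?_ ?_)
      · rcases he1 with rfl | rfl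
        · exact hl
        · exact hαβ.trans hl
      · rcases he2 with rfl | rfl
        · exact hr.trans hαβ
        · exact hr
    have hFw : ∀ m : RootSeq n, F (∑ γ, (m γ : ℤ) • γ.val) = -(m α : ℤ) - m β +
        ∑ γ ∈ (Finset.univ.erase α).erase β, (m γ : ℤ) * F γ.val := by
      intro m
      rw [map_sum, ← Finset.add_sum_erase _ _ (Finset.mem_univ α), ← Finset.add_sum_erase _ _
        (Finset.mem_erase.mpr ⟨hne.symm, Finset.mem_univ β⟩)]
      simp only [map_zsmul, smul_eq_mul, hα, hβ]
      ring
    -- `F` is `-2` on the weight of the pair and at least `-m α - m β` on that of `m`. Hence `m α =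
    -- m β = 1`, and `m` is nowhere smaller than the pair.
    have hw := congrArg F hm.weight
    rw [hFw, hFw, Finset.sum_eq_zero (f := fun γ => (pairSeq α β γ : ℤ) * F γ.val)
      (fun γ hγ => by
        rw [Finset.mem_erase, Finset.mem_erase] at hγ
        rw [hpair, if_neg (by tauto)]; simp), hpair, hpair, if_pos (.inl rfl), if_pos (.inr rfl)] at hw
    have hnn : 0 ≤ ∑ γ ∈ (Finset.univ.erase α).erase β, (m γ : ℤ) * F γ.val :=
      Finset.sum_nonneg fun γ hγ => by
        rw [Finset.mem_erase, Finset.mem_erase] at hγ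
        exact hother γ hγ.2.1 hγ.1
    obtain ⟨d, hd⟩ := Function.ne_iff.mp hm.ne
    obtain ⟨e, -, he⟩ := hm.exists_min hirr htr hd
    push_cast at hw
    obtain ⟨rfl | rfl, h0⟩ := hsmall e he <;> omega
  have : IsSimpleSeq K (pairSeq α β) := by
    refine .inr fun a b hab ha hb => ?_
    rw [hpair] at ha hb
    split_ifs at ha hb with h1 h2 <;> try omega
    rcases h1 with rfl | rfl <;> rcases h2 with rfl | rfl
    · exact absurd rfl hab
    · exact hsimple
    · unfold IsSimplePair at *
      rwa [pairSeq_comm]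
    · exact absurd rfl hab
  rw [gdist, if_pos this]

/-- A functional that separates two distant chords from everything between them. -/
theorem IsFrame.exists_functional {u : ℤ → Fin (n + 1) → ℤ} (hu : IsFrame u) {x y z x' : ℤ}
    (hxy : x < y) (hyz : y < z) (hzx : z < x') (hx' : x' ≤ x + n) :
    ∃ F : (Fin (n + 1) → ℤ) →+ ℤ, F (u x + u y) = -1 ∧ F (u x' + u (z + (n + 1))) = -1 ∧
      ∀ a b, x ≤ a → a ≤ x' → y ≤ b → b ≤ z + (n + 1) → a < b → b ≤ a + n → ¬ (a = x ∧ b = y) →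
        ¬ (a = x' ∧ b = z + (n + 1)) → 0 ≤ F (u a + u b) := by
  -- The values of `F` on `u x, …, u (x + n)`; the end `z + (n + 1)` contributes `-g z`. The linear
  -- function `2 (j - x)` is lowered at `x` and `x'` just enough to give the two extreme chords the
  -- value `-1`; the factor `2` keeps all other chords non-negative.
  let g : ℤ → ℤ := fun j =>
    if j = x then -2 * (y - x) - 1 else if j = x' then 2 * (z - x) - 1 else 2 * (j - x)
  let F : (Fin (n + 1) → ℤ) →+ ℤ :=
    { toFun := fun w => ∑ j ∈ Finset.range (n + 1), g (x + j) * (w ⬝ᵥ u (x + j))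
      map_zero' := by simp
      map_add' := fun w w' => by simp [add_dotProduct, mul_add, Finset.sum_add_distrib] }
  have hF : ∀ w, F w = ∑ j ∈ Finset.range (n + 1), g (x + j) * (w ⬝ᵥ u (x + j)) := fun w => rfl
  have h1 : ∀ a, x ≤ a → a ≤ x + n → F (u a) = g a := by
    intro a ha ha'
    rw [hF, Finset.sum_eq_single (a - x).toNat]
    · rw [Int.toNat_of_nonneg (by omega), add_sub_cancel, hu.unit, mul_one]
    · intro j hj hne
      rw [Finset.mem_range] at hj
      rw [hu.dot_eq_zero (by omega) (by omega) (by omega) (by omega) (by omega), mul_zero]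
    · intro hj
      exact absurd (Finset.mem_range.mpr (by omega)) hj
  have h2 : ∀ a, x + (n + 1) ≤ a → a ≤ x + (n + 1) + n → F (u a) = -g (a - (n + 1)) := by
    intro a ha ha'
    have := hu.anti (a - (n + 1))
    rw [sub_add_cancel] at this
    rw [this, map_neg, h1 _ (by omega) (by omega)]
  refine ⟨F, ?_, ?_, ?_⟩
  · rw [map_add, h1 x le_rfl (by omega), h1 y (by omega) (by omega)]
    simp only [g]
    split_ifs <;> omega
  · rw [map_add, h1 x' (by omega) (by omega), h2 _ (by omega) (by omega)]
    simp only [g]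
    split_ifs <;> omega
  · intro a b ha1 ha2 hb1 hb2 hab hab' hne1 hne2
    rw [map_add, h1 a ha1 (by omega)]
    by_cases hb : b ≤ x + n
    · rw [h1 b (by omega) hb]
      simp only [g]
      split_ifs <;> omega
    · rw [h2 b (by omega) (by omega)]
      simp only [g]
      split_ifs <;> omega

/-- Since both chords lie in one window, at this distance one end moves by at most `n` and the other
by at least `n + 2`. The ends then interlace as `IsFrame.exists_functional` requires, directly or
after reversing the frame. -/
theorem IsPosition.gdist_eq_zero_of_distant {K : Set (Word n)} {v : ℤ → Fin (n + 1) → ℤ}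
    {X : ℕ → ℤ} {pos : PosRoot n → ℤ × ℤ} (h : IsPosition K v X pos) {α β : PosRoot n}
    (hαβ : pos α < pos β)
    (hd : (pos α).1 + (pos α).2 + (2 * n + 2) ≤ (pos β).1 + (pos β).2) :
    gdist K (pairSeq α β) = 0 := by
  have sα := (h.window α).strip
  have sβ := (h.window β).strip
  have hb : ((pos β).1 - (pos α).1 ≤ n ∧ (pos β).2 - (pos α).2 ≥ n + 2) ∨
      ((pos β).2 - (pos α).2 ≤ n ∧ (pos β).1 - (pos α).1 ≥ n + 2) := by
    obtain ⟨k, r, hk, hk', hr, e1⟩ := h.window α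
    obtain ⟨l, s, hl, hl', hs, e2⟩ := h.window β
    have := h.sec.total hk hk' hl hl'
    rw [e1, e2] at hd ⊢
    simp only at hd ⊢
    omega
  have hsub : ∀ γ, pos α < pos γ → pos γ < pos β →
      ((pos α).1 ≤ (pos γ).1 ∧ (pos α).2 ≤ (pos γ).2) ∧
      ((pos γ).1 ≤ (pos β).1 ∧ (pos γ).2 ≤ (pos β).2) ∧
      ¬ ((pos γ).1 = (pos α).1 ∧ (pos γ).2 = (pos α).2) ∧
      ¬ ((pos γ).1 = (pos β).1 ∧ (pos γ).2 = (pos β).2) := fun γ h1 h2 =>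
    ⟨Prod.le_def.mp h1.le, Prod.le_def.mp h2.le, fun e => h1.ne' (Prod.ext e.1 e.2),
      fun e => h2.ne (Prod.ext e.1 e.2)⟩
  rcases hb with hb | hb
  · obtain ⟨F, h1, h2, h3⟩ := h.frame.exists_functional (x := (pos α).1) (y := (pos α).2)
      (z := (pos β).2 - (n + 1)) (x' := (pos β).1) (by omega) (by omega) (by omega) (by omega)
    rw [sub_add_cancel] at h2 h3
    refine h.gdist_eq_zero hαβ F (by rw [h.val]; exact h1) (by rw [h.val]; exact h2)
      fun γ g1 g2 => ?_
    obtain ⟨e1, e2, e3, e4⟩ := hsub γ g1 g2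
    have sγ := (h.window γ).strip
    rw [h.val]
    exact h3 _ _ e1.1 e2.1 e1.2 e2.2 sγ.1 sγ.2 e3 e4
  · have hu := h.frame.reverse 0
    obtain ⟨F, h1, h2, h3⟩ := hu.exists_functional (x := -(pos β).2) (y := -(pos β).1)
      (z := -(pos α).1 - (n + 1)) (x' := -(pos α).2) (by omega) (by omega) (by omega) (by omega)
    rw [sub_add_cancel] at h2 h3
    simp only [zero_sub, neg_neg] at h1 h2 h3
    refine h.gdist_eq_zero hαβ F (by rw [h.val, rootAt, add_comm (v _)]; exact h2)
      (by rw [h.val, rootAt, add_comm (v _)]; exact h1) fun γ g1 g2 => ?_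
    obtain ⟨e1, e2, e3, e4⟩ := hsub γ g1 g2
    have sγ := (h.window γ).strip
    have := h3 (-(pos γ).2) (-(pos γ).1) (by omega) (by omega) (by omega) (by omega) (by omega)
      (by omega) (by omega) (by omega)
    simp only [neg_neg] at this
    rw [h.val, rootAt, add_comm (v _)]
    exact this

end Distant

/-! ### Folded coordinates -/

section FoldedCoordinates

variable {n : ℕ}

theorem IsModel.wordAct_chord {c : Word n} {v : ℤ → Fin (n + 1) → ℤ} {X : ℕ → ℤ}
    (h : IsModel c v X) (k : ℕ) (x : ℤ) :
    wordAct c (veeVec (chord v k x)) = chord v k (x + 1) := by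
  unfold chord
  rw [veeVec_add, wordAct_add, h.cox, h.cox]
  congr 2; ring

theorem IsModel.wordAct_prefix {c : Word n} {v : ℤ → Fin (n + 1) → ℤ} {X : ℕ → ℤ}
    (h : IsModel c v X) {u x : Word n} {i : Fin (n + 1)} (hc : c = u ++ i :: x) :
    wordAct u (simpleRoot i) = chord v (bar i) (X (bar i)) := by
  have := h.roots
  rw [hc, rootList_append, List.map_append] at this
  obtain ⟨-, e⟩ := List.append_inj this (by rw [length_rootList, List.length_map])
  exact (List.cons.inj e).1

theorem IsModel.wordAct_twice (hn : 2 ≤ n) {c : Word n} {v : ℤ → Fin (n + 1) → ℤ} {X : ℕ → ℤ}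
    (h : IsModel c v X) (k : ℕ) (x : ℤ) :
    wordAct (c ++ c.map vee) (chord v k x) = chord v k (x + 2) := by
  rw [wordAct_append, ← veeVec_veeVec (chord v k x), wordAct_map_vee hn, h.wordAct_chord,
    h.wordAct_chord]
  congr 1; ring

theorem IsModel.wordAct_second (hn : 2 ≤ n) {c : Word n} {v : ℤ → Fin (n + 1) → ℤ} {X : ℕ → ℤ}
    (h : IsModel c v X) {u x : Word n} {i : Fin (n + 1)} (hc : c = u ++ i :: x) :
    wordAct (c ++ u.map vee) (simpleRoot (vee i)) = chord v (bar i) (X (bar i) + 1) := by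
  rw [wordAct_append, ← veeVec_simpleRoot hn, wordAct_map_vee hn, h.wordAct_prefix hc,
    h.wordAct_chord]

/-- The first two clauses give the offsets `0` and `1`, and `ψ`, the square of the twisted Coxeter
element, adds `2`. Passing the offset `n` would produce a negative root. -/
theorem IsModel.chord_of_hasCoord (hn : 2 ≤ n) {c : Word n} {v : ℤ → Fin (n + 1) → ℤ} {X : ℕ → ℤ}
    {ξ : ℕ → ℤ} (h : IsModel c v X) {β : Fin (n + 1) → ℤ} {i : Fin (n + 1)} {p : ℤ}
    (hβ : HasCoord c ξ β i p) (hpos : β ∈ posRoots n) :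
    ∃ r : ℕ, r ≤ n ∧ β = chord v (bar i) (X (bar i) + r) ∧ p = ξ (bar i) - 2 * r := by
  induction hβ with
  | first u x i hc => exact ⟨0, by omega, by rw [h.wordAct_prefix hc]; simp, by simp⟩
  | second u x i hc =>
    exact ⟨1, by omega, by rw [h.wordAct_second hn hc, bar_vee hn]; simp, by
      rw [bar_vee hn]; push_cast; ring⟩
  | step β i p hβ hβ' hψ ih =>
    obtain ⟨r, hr, rfl, rfl⟩ := ih hβ'
    rw [h.wordAct_twice hn] at hψ ⊢
    by_cases hr2 : r + 2 ≤ n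
    · exact ⟨r + 2, hr2, by push_cast; rw [add_assoc], by push_cast; ring⟩
    · exfalso
      rw [show X (bar i) + (r : ℤ) + 2 = X (bar i) + ((r + 1 - n : ℕ) : ℤ) + (n + 1) by
        rw [Nat.cast_sub (by omega)]; push_cast; ring, h.frame.chord_add] at hψ
      exact neg_notMem_posRoots ((h.pos _).mpr ⟨bar i, r + 1 - n, one_le_bar hn i, bar_le i,
        by omega, rfl⟩) hψ

theorem IsModel.hasCoord_chord (hn : 2 ≤ n) {c : Word n} {v : ℤ → Fin (n + 1) → ℤ} {X : ℕ → ℤ}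
    (ξ : ℕ → ℤ) (hc : IsTwistedCoxeterWord c) (h : IsModel c v X) {k r : ℕ} (hk : 1 ≤ k)
    (hk' : k ≤ n) (hr : r ≤ n) :
    ∃ i, HasCoord c ξ (chord v k (X k + r)) i (ξ k - 2 * r) ∧ bar i = k := by
  obtain ⟨i, hi, rfl⟩ := hc.exists_mem hk hk'
  obtain ⟨u, x, hux⟩ := List.append_of_mem hi
  induction r using Nat.twoStepInduction with
  | zero =>
    refine ⟨i, ?_, rfl⟩
    have := HasCoord.first (ξ := ξ) u x i hux
    rw [h.wordAct_prefix hux] at this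
    simpa using this
  | one =>
    refine ⟨vee i, ?_, bar_vee hn i⟩
    have := HasCoord.second (ξ := ξ) u x i hux
    rw [h.wordAct_second hn hux] at this
    simpa using this
  | more r ih _ =>
    obtain ⟨j, hj, hji⟩ := ih (by omega)
    refine ⟨j, ?_, hji⟩
    have e : X (bar i) + ((r + 2 : ℕ) : ℤ) = X (bar i) + r + 2 := by push_cast; ring
    have := HasCoord.step _ _ _ hj ((h.pos _).mpr ⟨bar i, r, hk, hk', by omega, rfl⟩) (by
      rw [h.wordAct_twice hn, ← e]
      exact (h.pos _).mpr ⟨bar i, r + 2, hk, hk', hr, rfl⟩)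
    rw [h.wordAct_twice hn, ← e] at this
    convert this using 1
    push_cast; ring

/-- Height functions are the sections up to normalization. -/
theorem IsModel.exists_height {c : Word n} {v : ℤ → Fin (n + 1) → ℤ} {X : ℕ → ℤ}
    {ξ : ℕ → ℤ} (hc : IsTwistedCoxeterWord c) (h : IsModel c v X) (hξ : IsHeightFunction c ξ) :
    ∃ a : ℤ, ∀ k, 1 ≤ k → k ≤ n → ξ k = a - (2 * X k + (n + 1 - k)) := by
  -- The bracket is the sum of the ends of the first chord of row `k`, which changes by `±1` from
  -- row to row; the constant is fitted at row `1`.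
  refine ⟨ξ 1 + 2 * X 1 + n, fun k hk => ?_⟩
  have hord : (c.map bar).Pairwise fun k l => (l = k + 1 → X l = X k + 1) ∧
      (k = l + 1 → X k = X l) := by
    rw [List.pairwise_map]; exact h.order
  rw [List.pairwise_iff_forall_sublist] at hord
  induction k, hk using Nat.le_induction with
  | base => intro _; push_cast; ring
  | succ k hk ih =>
    intro hk'
    have e := ih (by omega)
    have hmem : ∀ k, 1 ≤ k → k ≤ n → k ∈ c.map bar := fun k hk hk' => by
      obtain ⟨i, hi, rfl⟩ := hc.exists_mem hk hk'
      exact List.mem_map_of_mem hi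
    have hnd := hc.nodup_map
    have hne : (c.map bar).idxOf k ≠ (c.map bar).idxOf (k + 1) := fun e => by
      have := (List.idxOf_inj (hmem k hk (by omega))).mp e
      omega
    rcases lt_or_gt_of_ne hne with hlt | hlt
    · have hs := (pair_sublist_iff_idxOf hnd).mpr ⟨hmem (k + 1) (by omega) hk', hlt⟩
      have e1 := (hord hs).1 rfl
      have e2 := hξ _ _ (.inr rfl) hs
      push_cast
      omega
    · have hs := (pair_sublist_iff_idxOf hnd).mpr ⟨hmem k hk (by omega), hlt⟩
      have e1 := (hord hs).2 rfl
      have e2 := hξ _ _ (.inl rfl) hs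
      push_cast
      omega

/-- The labels form a path, so the prescribed differences `s` of neighbours can simply be summed. -/
theorem exists_heightFunction {c : Word n} (hc : IsTwistedCoxeterWord c) :
    ∃ ξ, IsHeightFunction c ξ := by
  have hnd := hc.nodup_map
  let s : ℕ → ℤ := fun k => if (c.map bar).idxOf k < (c.map bar).idxOf (k + 1) then -1 else 1
  refine ⟨fun k => ∑ j ∈ Finset.range k, s j, fun a b hab hsub => ?_⟩
  have hlt := ((pair_sublist_iff_idxOf hnd).mp hsub).2
  rcases hab with rfl | rfl
  · simp only [Finset.sum_range_succ, s]
    rw [if_neg hlt.not_gt]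
  · simp only [Finset.sum_range_succ, s]
    rw [if_pos hlt]
    ring

end FoldedCoordinates

/-! ### Folded distances -/

section FoldedDistance

variable {n : ℕ}

/-- The generalized distance of two chords in rows `k` and `l` whose heights differ by `t`, provided
that there is such a comparable pair in a window. -/
noncomputable def rowDist (n k l t : ℕ) : ℕ :=
  -- Passing from row `k` to row `l` with first end raised by `d` raises the sum of the ends by `2 d
  -- + k - l`; equating this to `t` gives `d`. The two inequalities say that neither end decreases.
  if t ≤ 2 * n + 1 ∧ t ≠ 0 ∧ l ≤ k + t ∧ k ≤ l + t ∧ (2 : ℤ) ∣ t + l - k then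
    stripDist n (0, n + 1 - k)
      (((t : ℤ) + l - k) / 2, ((t : ℤ) + l - k) / 2 + (n + 1 - l))
  else 0

/-- If the chord in row `k` is the lower one, a translation brings it to `(0, n + 1 - k)`. If it is
the upper one, a reversal does so; it keeps the rows and makes this chord the lower one. -/
theorem IsPosition.gdist_eq_rowDist {K : Set (Word n)} {v : ℤ → Fin (n + 1) → ℤ} {X : ℕ → ℤ}
    {pos : PosRoot n → ℤ × ℤ} (h : IsPosition K v X pos) {α β : PosRoot n} {k l t : ℕ}
    (hα : (pos α).2 = (pos α).1 + (n + 1 - k)) (hβ : (pos β).2 = (pos β).1 + (n + 1 - l))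
    (hcomp : ClassLT K α β ∨ ClassLT K β α)
    (ht : |((pos α).1 + (pos α).2) - ((pos β).1 + (pos β).2)| = t) :
    gdist K (pairSeq α β) = rowDist n k l t := by
  have hlt : ∀ {z z' : ℤ × ℤ}, z < z' →
      z.1 ≤ z'.1 ∧ z.2 ≤ z'.2 ∧ z.1 + z.2 < z'.1 + z'.2 := by
    intro z z' h
    rcases Prod.lt_iff.mp h with h | h <;> omega
  rw [h.lt_iff, h.lt_iff] at hcomp
  rcases hcomp with hc | hc
  · obtain ⟨h1, h2, h3⟩ := hlt hc
    rw [abs_of_neg (by omega)] at ht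
    by_cases htn : t ≤ 2 * n + 1
    · rw [rowDist, if_pos (by omega)]
      refine h.gdist_eq (h.frame.shift (pos α).1) (Equiv.addRight ((pos α).1, (pos α).1))
        (fun z => rfl) (fun z => ?_) (.inl fun z z' => ?_) ?_ ?_ ?_
      · simp only [Equiv.coe_addRight, Prod.fst_add, Prod.snd_add]
        omega
      · simp
      · rw [Prod.le_def]; simp only; omega
      · ext <;> simp only [Equiv.coe_addRight, Prod.fst_add, Prod.snd_add] <;> omega
      · ext <;> simp only [Equiv.coe_addRight, Prod.fst_add, Prod.snd_add] <;> omega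
    · rw [rowDist, if_neg (by omega)]
      exact h.gdist_eq_zero_of_distant hc (by omega)
  · obtain ⟨h1, h2, h3⟩ := hlt hc
    rw [abs_of_pos (by omega)] at ht
    by_cases htn : t ≤ 2 * n + 1
    · rw [rowDist, if_pos (by omega)]
      let φ : ℤ × ℤ ≃ ℤ × ℤ :=
        { toFun := fun z => ((pos α).2 - z.2, (pos α).2 - z.1)
          invFun := fun z => ((pos α).2 - z.2, (pos α).2 - z.1)
          left_inv := fun z => by simp
          right_inv := fun z => by simp }
      have hφ : ∀ z, φ z = ((pos α).2 - z.2, (pos α).2 - z.1) := fun z => rfl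
      refine h.gdist_eq (h.frame.reverse (pos α).2) φ (fun z => ?_) (fun z => ?_)
        (.inr fun z z' => ?_) ?_ ?_ ?_
      · rw [hφ]; exact add_comm _ _
      · rw [hφ]; simp only; omega
      · rw [hφ, hφ, Prod.le_def, Prod.le_def]; simp only; omega
      · rw [Prod.le_def]; simp only; omega
      · rw [hφ]; ext <;> simp only <;> omega
      · rw [hφ]; ext <;> simp only <;> omega
    · rw [rowDist, if_neg (by omega), pairSeq_comm]
      exact h.gdist_eq_zero_of_distant hc (by omega)

/-- Comparable chords in given rows at a given distance exist unless `rowDist` is trivially zero. -/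
theorem IsSection.exists_comparable {X : ℕ → ℤ} (hX : IsSection n X) {k l t : ℕ} (hk : 1 ≤ k)
    (hk' : k ≤ n) (hl : 1 ≤ l) (hl' : l ≤ n) (ht : t ≤ 2 * n + 1) (ht0 : t ≠ 0) (hlk : l ≤ k + t)
    (hkl : k ≤ l + t) (hdvd : (2 : ℤ) ∣ t + l - k) : ∃ r s : ℕ, r ≤ n ∧ s ≤ n ∧
      (((X k + r, X k + r + (n + 1 - k)) : ℤ × ℤ) < (X l + s, X l + s + (n + 1 - l)) ∨
        ((X l + s, X l + s + (n + 1 - l)) : ℤ × ℤ) < (X k + r, X k + r + (n + 1 - k))) ∧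
      |(X k + r + (X k + r + (n + 1 - k))) - (X l + s + (X l + s + (n + 1 - l)))| = t := by
  have hb : (X k ≤ X l ∧ X l ≤ X k + (l - k) ∧ k ≤ l) ∨
      (X l ≤ X k ∧ X k ≤ X l + (k - l) ∧ l ≤ k) := by
    rcases le_total k l with hkl | hkl
    · left; have := hX.le hk hkl hl'; exact ⟨this.1, this.2, hkl⟩
    · right; have := hX.le hl hkl hk'; exact ⟨this.1, this.2, hkl⟩
  obtain ⟨q, hq⟩ := hdvd
  -- Take the first chord of the row whose first chord has the smaller sum of ends. Twice the offset
  -- of the other chord is then `t` minus the difference of these sums, which lies between `0` and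
  -- `2 n + 1`.
  by_cases hD : 2 * X k + (n + 1 - k) ≤ 2 * X l + (n + 1 - l)
  · obtain ⟨s, hs⟩ := Int.eq_ofNat_of_zero_le (a := q - (X l - X k)) (by omega)
    refine ⟨0, s, by omega, by omega, .inl ?_, ?_⟩
    · rw [Prod.lt_iff]; simp only; omega
    · rw [abs_of_nonpos (by omega)]; omega
  · obtain ⟨r, hr⟩ := Int.eq_ofNat_of_zero_le (a := q - (l - k) - (X k - X l)) (by omega)
    refine ⟨r, 0, by omega, by omega, .inr ?_, ?_⟩
    · rw [Prod.lt_iff]; simp only; omega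
    · rw [abs_of_nonneg (by omega)]; omega

theorem exists_isCoordDatum (hn : 2 ≤ n) {K : Set (Word n)}
    (hK : K ∈ twistedAdaptedClusterPoint n) : ∃ c ξ, IsCoordDatum K c ξ := by
  obtain ⟨c, v, X, hc, hKc, -⟩ := exists_isModel_of_mem_cluster hn hK
  obtain ⟨ξ, hξ⟩ := exists_heightFunction hc
  exact ⟨c, ξ, hc, hKc, hξ⟩

/-- The word of the datum need not be the one found by propagation; but both give the same class of
folded words, so they differ by commutations and the model transfers. -/
theorem IsCoordDatum.exists_isModel (hn : 2 ≤ n) {K : Set (Word n)}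
    (hK : K ∈ twistedAdaptedClusterPoint n) {c : Word n} {ξ : ℕ → ℤ} (hd : IsCoordDatum K c ξ) :
    ∃ v X, IsModel c v X := by
  obtain ⟨c₀, v, X, hc₀, hK₀, hM⟩ := exists_isModel_of_mem_cluster hn hK
  have he : foldedWord c ∈ commClass (foldedWord c₀) := by
    rw [← hK₀, hd.2.1]; exact CommEquiv.refl _
  exact ⟨v, X, hM.commEquiv hn hc₀ (hc₀.commEquiv_of_foldedWord hn hd.1 he)⟩

/-- The row and the height of a root with given folded coordinates. -/
theorem IsPosition.of_hasFoldedCoord (hn : 2 ≤ n) {K : Set (Word n)} {c : Word n}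
    {v : ℤ → Fin (n + 1) → ℤ} {X : ℕ → ℤ} {ξ : ℕ → ℤ} {pos : PosRoot n → ℤ × ℤ}
    (h : IsPosition K v X pos) (hM : IsModel c v X) {a : ℤ}
    (ha : ∀ k, 1 ≤ k → k ≤ n → ξ k = a - (2 * X k + (n + 1 - k))) {β : PosRoot n} {k : ℕ} {p : ℤ}
    (hβ : HasFoldedCoord c ξ β k p) :
    (pos β).2 = (pos β).1 + (n + 1 - k) ∧ p = a - ((pos β).1 + (pos β).2) := by
  obtain ⟨i, hi, rfl⟩ := hβ
  obtain ⟨r, hr, hβr, rfl⟩ := hM.chord_of_hasCoord hn hi β.2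
  rw [h.pos_eq ⟨bar i, r, one_le_bar hn i, bar_le i, hr, rfl⟩ hβr,
    ha _ (one_le_bar hn i) (bar_le i)]
  refine ⟨rfl, ?_⟩
  simp only
  ring

theorem gdistRoots_of_mem_pairsAtDist (hn : 2 ≤ n) {K : Set (Word n)}
    (hK : K ∈ twistedAdaptedClusterPoint n) {k l t : ℕ} {P : PosRoot n × PosRoot n}
    (hP : P ∈ pairsAtDist K k l t) : gdistRoots K P.1 P.2 = rowDist n k l t := by
  obtain ⟨hcomp, c, ξ, hd, a, b, hab, hP⟩ := hP
  obtain ⟨v, X, hM⟩ := hd.exists_isModel hn hK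
  obtain ⟨pos, hpos⟩ := exists_isPosition hn hd.1 hM
  rw [← hd.2.1] at hpos
  obtain ⟨e, he⟩ := hM.exists_height hd.1 hd.2.2
  rw [gdistRoots, if_pos hcomp]
  rcases hP with ⟨h1, h2⟩ | ⟨h1, h2⟩
  · obtain ⟨r1, rfl⟩ := hpos.of_hasFoldedCoord hn hM he h1
    obtain ⟨r2, rfl⟩ := hpos.of_hasFoldedCoord hn hM he h2
    refine hpos.gdist_eq_rowDist r1 r2 hcomp ?_
    rw [← hab, sub_sub_sub_cancel_left, abs_sub_comm]
  · obtain ⟨r1, rfl⟩ := hpos.of_hasFoldedCoord hn hM he h1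
    obtain ⟨r2, rfl⟩ := hpos.of_hasFoldedCoord hn hM he h2
    rw [pairSeq_comm]
    refine hpos.gdist_eq_rowDist r2 r1 hcomp.symm ?_
    rw [← hab, sub_sub_sub_cancel_left, abs_sub_comm]

theorem pairsAtDist_nonempty (hn : 2 ≤ n) {K : Set (Word n)}
    (hK : K ∈ twistedAdaptedClusterPoint n) {k l t : ℕ} (hk : 1 ≤ k) (hk' : k ≤ n) (hl : 1 ≤ l)
    (hl' : l ≤ n) (ht : t ≤ 2 * n + 1) (ht0 : t ≠ 0) (hlk : l ≤ k + t) (hkl : k ≤ l + t)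
    (hdvd : (2 : ℤ) ∣ t + l - k) : (pairsAtDist K k l t).Nonempty := by
  obtain ⟨c, ξ, hd⟩ := exists_isCoordDatum hn hK
  obtain ⟨v, X, hM⟩ := hd.exists_isModel hn hK
  obtain ⟨pos, hpos⟩ := exists_isPosition hn hd.1 hM
  rw [← hd.2.1] at hpos
  obtain ⟨e, he⟩ := hM.exists_height hd.1 hd.2.2
  obtain ⟨r, s, hr, hs, hrs, hd'⟩ :=
    hpos.sec.exists_comparable hk hk' hl hl' ht ht0 hlk hkl hdvd
  have hα := (hM.pos _).mpr ⟨k, r, hk, hk', hr, rfl⟩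
  have hβ := (hM.pos _).mpr ⟨l, s, hl, hl', hs, rfl⟩
  refine ⟨(⟨_, hα⟩, ⟨_, hβ⟩), ?_, c, ξ, hd, ξ k - 2 * r, ξ l - 2 * s, ?_,
    .inl ⟨hM.hasCoord_chord hn ξ hd.1 hk hk' hr, hM.hasCoord_chord hn ξ hd.1 hl hl' hs⟩⟩
  · rw [hpos.lt_iff, hpos.lt_iff, hpos.pos_eq ⟨k, r, hk, hk', hr, rfl⟩ rfl,
      hpos.pos_eq ⟨l, s, hl, hl', hs, rfl⟩ rfl]
    exact hrs
  · rw [← hd', abs_sub_comm, he k hk hk', he l hl hl']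
    congr 1
    ring

/-- The distances `o_t^K(k, l)` do not depend on the twisted adapted class `K`. -/
theorem distAt_eq_rowDist (hn : 2 ≤ n) {K : Set (Word n)}
    (hK : K ∈ twistedAdaptedClusterPoint n) {k l : ℕ} (hk : 1 ≤ k) (hk' : k ≤ n) (hl : 1 ≤ l)
    (hl' : l ≤ n) (t : ℕ) : distAt K k l t = rowDist n k l t := by
  unfold distAt
  rcases (pairsAtDist K k l t).eq_empty_or_nonempty with he | hne
  -- Here `sSup ∅ = 0`, and some condition in `rowDist` fails, since together they would produce a
  -- pair.
  · rw [he, Set.image_empty, csSup_empty, rowDist, if_neg]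
    · rfl
    · rintro ⟨h1, h2, h3, h4, h5⟩
      exact (pairsAtDist_nonempty hn hK hk hk' hl hl' h1 h2 h3 h4 h5).ne_empty he
  · rw [Set.image_congr fun P hP => gdistRoots_of_mem_pairsAtDist hn hK hP,
      hne.image_const, csSup_singleton]

end FoldedDistance

end TwistedD

/-! ### The main theorem -/

open TwistedD in
theorem proposition9p10 (n : ℕ) (hn : 2 ≤ n) (k l : ℕ) (hk : k ∈ Set.Icc 1 n)
    (hl : l ∈ Set.Icc 1 n) (qs : BaseField) (hqs : qs ^ 2 = qElt) :
    (∀ K ∈ twistedAdaptedClusterPoint n,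
      (∃ c ξ, IsCoordDatum K c ξ) ∧
      (∀ t : ℕ, ∀ P ∈ pairsAtDist K k l t, ∀ P' ∈ pairsAtDist K k l t,
        gdistRoots K P.1 P.2 = gdistRoots K P'.1 P'.2) ∧
      {t : ℕ | distAt K k l t ≠ 0}.Finite) ∧
    ∀ K₁ ∈ twistedAdaptedClusterPoint n, ∀ K₂ ∈ twistedAdaptedClusterPoint n,
      foldedDistPoly qs K₁ k l = foldedDistPoly qs K₂ k l ∧
      foldedDistPolyFloor qs K₁ k l = foldedDistPolyFloor qs K₂ k l := by
  have hdist : ∀ K ∈ twistedAdaptedClusterPoint n, ∀ t, distAt K k l t = rowDist n k l t :=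
    fun K hK => distAt_eq_rowDist hn hK hk.1 hk.2 hl.1 hl.2
  refine ⟨fun K hK => ⟨exists_isCoordDatum hn hK, fun t P hP P' hP' => ?_, ?_⟩,
    fun K₁ h₁ K₂ h₂ => ⟨?_, ?_⟩⟩
  · rw [gdistRoots_of_mem_pairsAtDist hn hK hP, gdistRoots_of_mem_pairsAtDist hn hK hP']
  · refine (Set.finite_Iic (2 * n + 1)).subset fun t ht => ?_
    rw [Set.mem_ofPred_eq, hdist K hK, rowDist] at ht
    by_contra hcon
    exact ht (if_neg fun h => hcon h.1)
  · simp only [foldedDistPoly, hdist K₁ h₁, hdist K₂ h₂]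
  · simp only [foldedDistPolyFloor, hdist K₁ h₁, hdist K₂ h₂]
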